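/- **Setting.** Let $n\ge 1$ and let $(M,\eta)$ be a contact manifold of dimension $2n+1$: $M$ is a smooth (Hausdorff, second countable) manifold and $\eta$ is a smooth 1-form that vanishes nowhere and such that $d\eta$ is nondegenerate on $\ker\eta$. Put $b(X)=X\lrcorner d\eta+\eta(X)\eta$, let $\mathcal R=b^{-1}(\eta)$ be the Reeb field, $E=-\mathcal R$, and $\Lambda(\alpha,\beta)=-d\eta(b^{-1}\alpha,b^{-1}\beta)$. The Jacobi bracket is $\{f,g\}=\Lambda(df,dg)+fE(g)-gE(f)$, and the Hamiltonian vector field $X_f$ of $f\in C^\infty(M)$ is given by $b(X_f)=df-(\mathcal R(f)+f)\eta$. For vector fields $Y_i$ on an open set $V$, $\langle Y_i\rangle$ is the $C^\infty(V)$-module that they generate. Let $H\in C^\infty(M)$. A *Jacobi $C^\infty$-structure* for $(M,H)$ is a family $(f_1,\dots,f_{2n-1})$ of smooth functions on $M$ such that, with $f_0=H$: 1. $X_{f_0},\dots,X_{f_{2n-1}}$ are pointwise linearly independent on an open dense subset of $M$; 2. for all $0\le i<j\le 2n-1$ there is $F_{ji}\in C^\infty(\mathbb R^{j+1})$ with $\{f_j,f_i\}=F_{ji}(f_0,\dots,f_j)$;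 3. for these $F_{ji}$, the vector field $\bigl(F_{ji}(f_0,\dots,f_j)-\sum_{k=0}^{j}f_k\,\tfrac{\partial F_{ji}}{\partial u_k}(f_0,\dots,f_j)\bigr)E$ belongs to $\langle X_{f_0},\dots,X_{f_j}\rangle$ locally around each point at which $X_{f_0},\dots,X_{f_{2n-1}}$ are linearly independent. A *$C^\infty$-structure* on an open set $V$ for a distribution $\mathcal D$ of rank $k$ is an ordered family of $\dim M-k$ smooth vector fields $(X_1,\dots,X_{\dim M-k})$ on $V$ such that each $X_j$ is nowhere tangent to $\mathcal D_{j-1}=\mathcal D\oplus\langle X_1,\dots,X_{j-1}\rangle$ and $[X_j,\mathcal D_{j-1}]\subset\mathcal D_{j-1}\oplus\langle X_j\rangle$. **Theorem.** Let $(f_1,\dots,f_{2n-1})$ be a Jacobi $C^\infty$-structure for the Hamiltonian system $(M,H)$ on the $(2n+1)$-dimensional contact manifold $(M,\eta)$. Then the set $U$ of points at which $X_{f_0},\dots,X_{f_{2n-1}}$ are linearly independent is open and dense. Each point of $U$ has an open neighbourhood $V\subseteq U$ that carries a volume form and a smooth vector field $R$ with $R(p)\notin\operatorname{span}\{X_{f_0}(p),\dots,X_{f_{2n-1}}(p)\}$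 for all $p\in V$. Moreover, for every open $V\subseteq U$ and every such $R$ on $V$: **(A)** $(X_1,\dots,X_{2n}):=(X_{f_1},\dots,X_{f_{2n-1}},R)$ is a $C^\infty$-structure on $V$ for $\mathcal D_H=\langle X_H\rangle$. **(B)** $\mathcal D_H$ is integrated by solving a sequence of $2n$ completely integrable Pfaffian equations. Precisely, for every volume form $\Omega$ on $V$, the $2n$ 1-forms $$\omega_i=X_{2n}\lrcorner\cdots\widehat{X_i}\cdots\lrcorner X_1\lrcorner X_H\lrcorner\Omega,\qquad 1\le i\le 2n,$$ are smooth and pointwise linearly independent on $V$, their common kernel at $p$ is $\mathbb R X_H(p)$, and $d\omega_i\equiv 0$ modulo $\langle\omega_i,\dots,\omega_{2n}\rangle$, that is, $d\omega_i=\sum_{l\ge i}\theta_l\wedge\omega_l$ with smooth 1-forms $\theta_l$ on $V$. For open $W\subseteq V$ and functions $I_k$ on $W$, say that $I_k$ *solves the $k$-th equation* (given $I_{k+1},\dots,I_{2n}$) if it is smooth and, on $\bigcap_{l>k}\ker dI_l$ at every point of $W$, $dI_k\wedge\omega_k=0$ and $dI_k\ne 0$; i.e. $I_k$ is a regular solution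 of $\omega_k\equiv 0$ restricted to the common level sets of $I_{k+1},\dots,I_{2n}$. Then: - for each $k$, if $I_{k+1},\dots,I_{2n}$ solve the equations $k+1,\dots,2n$ on $W$, then every point of $W$ has an open neighbourhood $W'\subseteq W$ on which some function $I_k$ solves the $k$-th equation; - if $I_1,\dots,I_{2n}$ on $W$ solve all $2n$ equations, then every common level set $\{p\in W: I_1(p)=c_1,\dots,I_{2n}(p)=c_{2n}\}$ is an integral manifold of $\mathcal D_H$: near each of its points it is an embedded arc of an integral curve of $X_H$. -/

import Mathlib

open scoped Manifold ContDiff Topology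

noncomputable section

namespace ContactPfaff

/-! ### Vector fields, 1-forms and volume forms on a smooth `m`-dimensional manifold

All fields and forms are functions on `M`; smoothness is required on a given open set only, so that
the local objects of the theory need no separate type. -/

section Forms

variable (m : ℕ) (M : Type*) [TopologicalSpace M] [ChartedSpace (EuclideanSpace ℝ (Fin m)) M]
  [IsManifold (𝓡 m) ∞ M]

/-- A (not necessarily smooth) vector field. -/
abbrev VField := (p : M) → TangentSpace (𝓡 m) p

/-- A (not necessarily smooth) 1-form. -/
abbrev OneForm := (p : M) → (TangentSpace (𝓡 m) p →L[ℝ] ℝ)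

/-- A (not necessarily smooth) differential form of degree `m = dim M`. -/
abbrev TopForm := (p : M) → (TangentSpace (𝓡 m) p [⋀^Fin m]→L[ℝ] ℝ)

variable {m M}

/-- The real function `f` is smooth on `V`. -/
def SmoothFunOn (V : Set M) (f : M → ℝ) : Prop :=
  ContMDiffOn (𝓡 m) 𝓘(ℝ, ℝ) ∞ f V

/-- The vector field `X` is smooth on `V`. -/
def VField.SmoothOn (V : Set M) (X : VField m M) : Prop :=
  ContMDiffOn (𝓡 m) (𝓡 m).tangent ∞ (fun p => (⟨p, X p⟩ : TangentBundle (𝓡 m) M)) V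

/-- The differential `df`. -/
def diff (f : M → ℝ) : OneForm m M := fun p => mfderiv (𝓡 m) 𝓘(ℝ, ℝ) f p

/-- The local representative of a 1-form in the chart at `x`: its pullback by the inverse chart. -/
def OneForm.rep (α : OneForm m M) (x : M) (y : EuclideanSpace ℝ (Fin m)) :
    EuclideanSpace ℝ (Fin m) →L[ℝ] ℝ :=
  (α ((extChartAt (𝓡 m) x).symm y)).comp
    (mfderiv 𝓘(ℝ, EuclideanSpace ℝ (Fin m)) (𝓡 m) (extChartAt (𝓡 m) x).symm y)

/-- The 1-form `α` is smooth on `V`: its local representatives are smooth. -/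
def OneForm.SmoothOn (V : Set M) (α : OneForm m M) : Prop :=
  ∀ x : M, ContDiffOn ℝ ∞ (α.rep x)
    ((extChartAt (𝓡 m) x).target ∩ (extChartAt (𝓡 m) x).symm ⁻¹' V)

/-- The exterior derivative of a 1-form, `dα(u, v) = ∂ᵤα(v) - ∂ᵥα(u)`, computed at `p` in the
chart at `p`. -/
def OneForm.extd (α : OneForm m M) (p : M) :
    TangentSpace (𝓡 m) p →L[ℝ] TangentSpace (𝓡 m) p →L[ℝ] ℝ :=
  let A : EuclideanSpace ℝ (Fin m) →L[ℝ] EuclideanSpace ℝ (Fin m) →L[ℝ] ℝ :=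
    fderiv ℝ (α.rep p) (extChartAt (𝓡 m) p p)
  let T : EuclideanSpace ℝ (Fin m) →L[ℝ] EuclideanSpace ℝ (Fin m) :=
    mfderiv (𝓡 m) 𝓘(ℝ, EuclideanSpace ℝ (Fin m)) (extChartAt (𝓡 m) p) p
  (A - A.flip).bilinearComp T T

theorem OneForm.extd_skew (α : OneForm m M) (p : M) (u v : TangentSpace (𝓡 m) p) :
    α.extd p u v = -α.extd p v u := by
  let A : EuclideanSpace ℝ (Fin m) →L[ℝ] EuclideanSpace ℝ (Fin m) →L[ℝ] ℝ :=
    fderiv ℝ (α.rep p) (extChartAt (𝓡 m) p p)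
  let T : EuclideanSpace ℝ (Fin m) →L[ℝ] EuclideanSpace ℝ (Fin m) :=
    mfderiv (𝓡 m) 𝓘(ℝ, EuclideanSpace ℝ (Fin m)) (extChartAt (𝓡 m) p) p
  change A (T u) (T v) - A (T v) (T u) = -(A (T v) (T u) - A (T u) (T v))
  ring

/-- The local representative of a top-degree form in the chart at `x`. -/
def TopForm.rep (Ω : TopForm m M) (x : M) (y : EuclideanSpace ℝ (Fin m)) :
    EuclideanSpace ℝ (Fin m) [⋀^Fin m]→L[ℝ] ℝ :=
  (Ω ((extChartAt (𝓡 m) x).symm y)).compContinuousLinearMap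
    (mfderiv 𝓘(ℝ, EuclideanSpace ℝ (Fin m)) (𝓡 m) (extChartAt (𝓡 m) x).symm y)

/-- `Ω` is a volume form on `V`: smooth and nowhere zero there. -/
structure TopForm.IsVolumeOn (V : Set M) (Ω : TopForm m M) : Prop where
  smooth : ∀ x : M, ContDiffOn ℝ ∞ (Ω.rep x)
    ((extChartAt (𝓡 m) x).target ∩ (extChartAt (𝓡 m) x).symm ⁻¹' V)
  ne_zero : ∀ p ∈ V, Ω p ≠ 0

/-! ### `C^∞`-symmetries and `C^∞`-structures of distributions -/

/-- `Z` belongs to the `C^∞(V)`-module `⟨Y_i⟩` generated by the vector fields `Y i` on `V`. -/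
def InModule {ι : Type} [Fintype ι] (V : Set M) (Y : ι → VField m M) (Z : VField m M) : Prop :=
  ∃ c : ι → M → ℝ, (∀ i, SmoothFunOn (m := m) V (c i)) ∧ ∀ p ∈ V, Z p = ∑ i, c i p • Y i p

/-- `X` is a `C^∞`-symmetry on `V` of the distribution `𝒟 = ⟨Y_i⟩`: it is nowhere tangent to `𝒟`
and `[X, 𝒟] ⊆ 𝒟 ⊕ ⟨X⟩`. -/
structure IsCInfSymmetry {ι : Type} [Fintype ι] (V : Set M) (Y : ι → VField m M)
    (X : VField m M) : Prop where
  smooth : X.SmoothOn V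
  transverse : ∀ p ∈ V, X p ∉ Submodule.span ℝ (Set.range fun i => Y i p)
  bracket : ∀ Z : VField m M, Z.SmoothOn V → InModule V Y Z →
    InModule V (fun o : Option ι => o.elim X Y) (VectorField.mlieBracket (𝓡 m) X Z)

/-- `(X_0, …, X_{l-1})` is a `C^∞`-structure on `V` for the rank `k` distribution `𝒟` with the
pointwise independent generators `Y_0, …, Y_{k-1}`: here `k + l = m`, and each `X_j` is a
`C^∞`-symmetry of `𝒟 ⊕ ⟨X_0, …, X_{j-1}⟩`. -/
structure IsCInfStructure {k l : ℕ} (V : Set M) (Y : Fin k → VField m M)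
    (X : Fin l → VField m M) : Prop where
  dim : k + l = m
  smooth : ∀ i, (Y i).SmoothOn V
  indep : ∀ p ∈ V, LinearIndependent ℝ fun i => Y i p
  symmetry : ∀ j : Fin l,
    IsCInfSymmetry V (Sum.elim Y fun i : {i : Fin l // i < j} => X i) (X j)

/-! ### Integration by a sequence of Pfaffian equations -/

/-- `I_k` solves on `W` the `k`-th equation of the sequence of Pfaffian equations
`w_{N-1} ≡ 0, …, w_0 ≡ 0`, that is, the equation `w_k ≡ 0` restricted to the common level sets of
`I_{k+1}, …, I_{N-1}`: on the tangent spaces of these level sets, `dI_k ∧ w_k = 0` and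
`dI_k ≠ 0`. -/
structure SolvesPfaff {N : ℕ} (W : Set M) (w : Fin N → OneForm m M) (I : Fin N → M → ℝ)
    (k : Fin N) : Prop where
  smooth : SmoothFunOn (m := m) W (I k)
  wedge : ∀ p ∈ W, ∀ u v : TangentSpace (𝓡 m) p,
    (∀ l, k < l → diff (m := m) (I l) p u = 0) → (∀ l, k < l → diff (m := m) (I l) p v = 0) →
    diff (m := m) (I k) p u * w k p v = diff (m := m) (I k) p v * w k p u
  regular : ∀ p ∈ W, ∃ u : TangentSpace (𝓡 m) p,
    (∀ l, k < l → diff (m := m) (I l) p u = 0) ∧ diff (m := m) (I k) p u ≠ 0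

/-- `S` is a one-dimensional (embedded) integral manifold of `⟨X⟩`: near each of its points it is
an embedded arc of an integral curve of `X`. -/
def IsIntegralManifold (X : VField m M) (S : Set M) : Prop :=
  ∀ p ∈ S, ∃ O : Set M, IsOpen O ∧ p ∈ O ∧ ∃ ε : ℝ, 0 < ε ∧ ∃ γ : ℝ → M, γ 0 = p ∧
    IsMIntegralCurveOn (I := 𝓡 m) γ X (Set.Ioo (-ε) ε) ∧
    Topology.IsEmbedding (fun t : Set.Ioo (-ε) ε => γ t) ∧
    γ '' Set.Ioo (-ε) ε = S ∩ O

/-- The distribution `⟨X⟩` is integrated on `V` by solving successively the `N` completely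
integrable Pfaffian equations `w_{N-1} ≡ 0, …, w_0 ≡ 0`. -/
structure IntegratedByPfaff {N : ℕ} (V : Set M) (X : VField m M)
    (w : Fin N → OneForm m M) : Prop where
  smooth : ∀ i, (w i).SmoothOn V
  indep : ∀ p ∈ V, LinearIndependent ℝ fun i => w i p
  annihilator : ∀ p ∈ V, ∀ v : TangentSpace (𝓡 m) p,
    (∀ i, w i p v = 0) ↔ v ∈ Submodule.span ℝ {X p}
  /-- `dw_i = 0` modulo `⟨w_i, …, w_{N-1}⟩`. -/
  completely_integrable : ∀ i, ∃ θ : Fin N → OneForm m M, (∀ l, (θ l).SmoothOn V) ∧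
    ∀ p ∈ V, ∀ u v : TangentSpace (𝓡 m) p, (w i).extd p u v =
      ∑ l ∈ Finset.Ici i, (θ l p u * w l p v - θ l p v * w l p u)
  /-- Whatever solutions `I_{k+1}, …, I_{N-1}` of the earlier equations have been found, the next
  equation can be solved locally. -/
  solvable : ∀ W : Set M, IsOpen W → W ⊆ V → ∀ (I : Fin N → M → ℝ) (k : Fin N),
    (∀ l, k < l → SolvesPfaff W w I l) → ∀ p ∈ W, ∃ W' : Set M, IsOpen W' ∧ p ∈ W' ∧ W' ⊆ W ∧
      ∃ J : M → ℝ, SolvesPfaff W' w (Function.update I k J) k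
  /-- The common level sets of any full sequence of solutions are integral manifolds of `⟨X⟩`. -/
  integral : ∀ W : Set M, IsOpen W → W ⊆ V → ∀ I : Fin N → M → ℝ,
    (∀ k, SolvesPfaff W w I k) → ∀ c : Fin N → ℝ,
      IsIntegralManifold X {p | p ∈ W ∧ ∀ k, I k p = c k}

/-- The 1-forms `w_i = X_{N-1} ⌟ ⋯ X̂_i ⋯ ⌟ X_0 ⌟ Y ⌟ Ω`, that is,
`w_i(Z) = Ω(Y, X_0, …, X̂_i, …, X_{N-1}, Z)`. The code puts `Z` in the place of `X_i` and corrects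
the sign. -/
def pfaffForm {N : ℕ} {M : Type*} [TopologicalSpace M]
    [ChartedSpace (EuclideanSpace ℝ (Fin (N + 1))) M] (Ω : TopForm (N + 1) M)
    (Y : VField (N + 1) M) (X : Fin N → VField (N + 1) M) (i : Fin N) : OneForm (N + 1) M :=
  fun p => (-1 : ℝ) ^ (N - 1 - (i : ℕ)) •
    (Ω p).toContinuousMultilinearMap.toContinuousLinearMap
      (Fin.cons (α := fun _ => TangentSpace (𝓡 (N + 1)) p) (Y p) fun j => X j p) i.succ

end Forms

/-! ### Contact manifolds and their Jacobi structure -/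

section Contact

variable {m : ℕ} {M : Type*} [TopologicalSpace M] [ChartedSpace (EuclideanSpace ℝ (Fin m)) M]

/-- `η` is a contact form: smooth, nowhere zero, and `dη` is nondegenerate on `ker η` (for
`dim M = 2n+1` this says that `η ∧ (dη)^n` vanishes nowhere). -/
structure IsContactForm (η : OneForm m M) : Prop where
  smooth : η.SmoothOn Set.univ
  ne_zero : ∀ p, η p ≠ 0
  nondegenerate : ∀ (p : M) (v : TangentSpace (𝓡 m) p), η p v = 0 →
    (∀ w : TangentSpace (𝓡 m) p, η p w = 0 → η.extd p v w = 0) → v = 0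

/-- The map `b(v) = v ⌟ dη + η(v) η`, an isomorphism for a contact form. -/
def flat (η : OneForm m M) (p : M) :
    TangentSpace (𝓡 m) p →L[ℝ] (TangentSpace (𝓡 m) p →L[ℝ] ℝ) :=
  η.extd p + (η p).smulRight (η p)

/-- The inverse map `b⁻¹`. -/
def sharp (η : OneForm m M) (p : M) :
    (TangentSpace (𝓡 m) p →L[ℝ] ℝ) →L[ℝ] TangentSpace (𝓡 m) p :=
  (flat η p).inverse

/-- The Reeb vector field `ℛ = b⁻¹(η)`. -/
def reeb (η : OneForm m M) : VField m M := fun p => sharp η p (η p)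

/-- The vector field `E = -ℛ` of the Jacobi structure `(Λ, E)` of a contact manifold. -/
def jacobiE (η : OneForm m M) : VField m M := fun p => -reeb η p

/-- The bivector `Λ(α, β) = -dη(b⁻¹α, b⁻¹β)` of the Jacobi structure of a contact manifold. -/
def bivector (η : OneForm m M) (p : M) (α β : TangentSpace (𝓡 m) p →L[ℝ] ℝ) : ℝ :=
  -η.extd p (sharp η p α) (sharp η p β)

/-- The Jacobi bracket `{f, g} = Λ(df, dg) + f E(g) - g E(f)`. -/
def jacobiBracket (η : OneForm m M) (f g : M → ℝ) (p : M) : ℝ :=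
  bivector η p (diff f p) (diff g p) + f p * diff g p (jacobiE η p) -
    g p * diff f p (jacobiE η p)

/-- The Hamiltonian vector field `X_f`, given by `b(X_f) = df - (ℛ(f) + f) η`. -/
def ham (η : OneForm m M) (f : M → ℝ) : VField m M := fun p =>
  sharp η p (diff f p - (diff f p (reeb η p) + f p) • η p)

end Contact

/-! ### Jacobi `C^∞`-structures on a contact manifold of dimension `2n+1` -/

section Structures

variable {n : ℕ} {M : Type*} [TopologicalSpace M]
  [ChartedSpace (EuclideanSpace ℝ (Fin (2 * n + 1))) M] [IsManifold (𝓡 (2 * n + 1)) ∞ M]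

/-- The family `(f_0, f_1, …, f_{2n-1})` with `f_0 = H`, where `(f_1, …, f_{2n-1})` is `F`. -/
def family (H : C^∞⟮𝓡 (2 * n + 1), M; ℝ⟯) (F : Fin (2 * n - 1) → C^∞⟮𝓡 (2 * n + 1), M; ℝ⟯)
    (j : Fin (2 * n)) : C^∞⟮𝓡 (2 * n + 1), M; ℝ⟯ :=
  if h : (j : ℕ) = 0 then H else F ⟨(j : ℕ) - 1, by omega⟩

/-- The set of points at which `X_{f_0}, …, X_{f_{2n-1}}` are linearly independent. -/
def indepSet (η : OneForm (2 * n + 1) M) (H : C^∞⟮𝓡 (2 * n + 1), M; ℝ⟯)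
    (F : Fin (2 * n - 1) → C^∞⟮𝓡 (2 * n + 1), M; ℝ⟯) : Set M :=
  {p | LinearIndependent ℝ fun j => ham η (family H F j) p}

/-- `F = (f_1, …, f_{2n-1})` is a Jacobi `C^∞`-structure for the Hamiltonian system `(M, H)` on
the `(2n+1)`-dimensional contact manifold `(M, η)`. -/
structure IsJacobiCInfStructure (η : OneForm (2 * n + 1) M) (H : C^∞⟮𝓡 (2 * n + 1), M; ℝ⟯)
    (F : Fin (2 * n - 1) → C^∞⟮𝓡 (2 * n + 1), M; ℝ⟯) : Prop where
  independence : ∃ U : Set M, IsOpen U ∧ Dense U ∧ ∀ p ∈ U,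
    LinearIndependent ℝ fun j => ham η (family H F j) p
  /-- Triangular bracket closure `{f_j, f_i} = F_{ji}(f_0, …, f_j)`, and Reeb compatibility: the
  field `(F_{ji} - ∑ f_k ∂F_{ji}/∂u_k) E` belongs to `⟨X_{f_0}, …, X_{f_j}⟩` locally
  around the points of the set where all the `X_{f_j}` are independent. -/
  closure : ∀ i j : Fin (2 * n), i < j →
    ∃ G : (({k : Fin (2 * n) // k ≤ j} → ℝ) → ℝ), ContDiff ℝ ∞ G ∧
      (∀ p, jacobiBracket η (family H F j) (family H F i) p = G fun k => family H F k p) ∧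
      ∀ p ∈ indepSet η H F, ∃ O : Set M, IsOpen O ∧ p ∈ O ∧
        InModule O (fun k : {k : Fin (2 * n) // k ≤ j} => ham η (family H F k))
          (fun q => (G (fun k => family H F k q) -
            ∑ k : {k : Fin (2 * n) // k ≤ j}, family H F k q *
              fderiv ℝ G (fun k => family H F k q) (Pi.single k 1)) • jacobiE η q)

/-- The family `(X_{f_1}, …, X_{f_{2n-1}}, R)`. -/
def completed (η : OneForm (2 * n + 1) M) (F : Fin (2 * n - 1) → C^∞⟮𝓡 (2 * n + 1), M; ℝ⟯)
    (R : VField (2 * n + 1) M) (j : Fin (2 * n)) : VField (2 * n + 1) M :=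
  if h : (j : ℕ) < 2 * n - 1 then ham η (F ⟨j, h⟩) else R

/-- `R` is smooth on `V` and pointwise independent there of `X_{f_0}, …, X_{f_{2n-1}}`. -/
structure IsComplement (η : OneForm (2 * n + 1) M) (H : C^∞⟮𝓡 (2 * n + 1), M; ℝ⟯)
    (F : Fin (2 * n - 1) → C^∞⟮𝓡 (2 * n + 1), M; ℝ⟯) (V : Set M)
    (R : VField (2 * n + 1) M) : Prop where
  smooth : R.SmoothOn V
  transverse : ∀ p ∈ V, R p ∉ Submodule.span ℝ (Set.range fun j => ham η (family H F j) p)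

end Structures

end ContactPfaff

end

noncomputable section

/-! The map `f ↦ X_f` carries the Jacobi bracket to the Lie bracket (`mlieBracket_ham`), and it is a
first-order operator in `f`, so it obeys the chain rule `X_{G(f_0,…,f_j)} = ∑ ∂_k G X_{f_k} + (G - ∑
f_k ∂_k G) E` (`ham_comp`). Triangular closure therefore writes `[X_{f_j}, X_{f_i}]`, `i < j`, as a
combination of `X_{f_0}, …, X_{f_j}` plus a multiple of `E`, and Reeb compatibility says exactly
that this multiple also lies in the span of `X_{f_0}, …, X_{f_j}`. Hence on `U` every `⟨X_{f_0}, …,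
X_{f_j}⟩` is involutive. Adjoining `R` costs nothing, since then the whole tangent space is spanned,
and yields a frame `e_0 = X_H, e_1, …, e_N`, `N = 2n`, whose initial segments are all involutive
(`isInvolutiveFlag_completedFrame`). The conclusions (A) and (B) follow from this flag alone.

Let `e^c` be the dual coframe. By Cartan's formula `de^c` vanishes on pairs from `e_0, …, e_{c-1}`.
For (A) this kills the components of `[e_j, Z]` beyond `e_j` when `Z` lies in `⟨e_0, …, e_{j-1}⟩`.
For (B), contraction of `Ω` gives, counting from zero, `w_i = g_i e^{i+1}` with `g_i = ±Ω(e_0, …,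
e_N)` (`isScaledDual_pfaffForm`), so `dw_i` lies in the ideal of `w_i, …, w_{N-1}`.

To solve the `k`-th equation, Frobenius is applied to the system `w_k = … = w_{N-1} = 0`, and the
first integral whose differential at the point is `w_k` is kept (`exists_solution`). Whatever
solutions were chosen, the `dI_l`, `l ≥ k`, have the same common kernel as the `w_l`, `l ≥ k`
(`diff_eq_zero_iff`). For `k = 0` it is the line of `X_H`, and so level sets are arcs of integral
curves (`isIntegralManifold_levelSet`).

Frobenius (`exists_first_integral`) is proved directly. The projections onto the kernel of the
system along a fixed complement form a linear family of commuting vector fields; its exponential map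
is smooth by the inverse function theorem in `C([0,1], E)` (`exists_exponential`) and straightens
the system. -/

namespace ContactPfaff

/-! ### Smoothness of superposition operators on `C(K, E)` -/

section Superposition

/-- Pointwise evaluation of operator-valued functions, as a bilinear map on `C(K, E)`. -/
def pointwiseApply (K : Type*) [TopologicalSpace K] [CompactSpace K]
    (E : Type*) [NormedAddCommGroup E] [NormedSpace ℝ E]
    (F : Type*) [NormedAddCommGroup F] [NormedSpace ℝ F] :
    C(K, E →L[ℝ] F) →L[ℝ] C(K, E) →L[ℝ] C(K, F) :=
  LinearMap.mkContinuous₂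
    (LinearMap.mk₂ ℝ (fun (a : C(K, E →L[ℝ] F)) (h : C(K, E)) =>
        (⟨fun t => a t (h t), by fun_prop⟩ : C(K, F)))
      (fun _ _ _ => by ext; simp) (fun _ _ _ => by ext; simp)
      (fun _ _ _ => by ext; simp) (fun _ _ _ => by ext; simp)) 1
    (fun a h => by
      rw [ContinuousMap.norm_le _ (by positivity)]
      intro t
      simp only [LinearMap.mk₂_apply, ContinuousMap.coe_mk, one_mul]
      exact (a t).le_of_opNorm_le_of_le (a.norm_coe_le_norm t) (h.norm_coe_le_norm t))

variable {K : Type*} [TopologicalSpace K] [CompactSpace K]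
  {E : Type*} [NormedAddCommGroup E] [NormedSpace ℝ E]

@[simp] theorem pointwiseApply_apply {F : Type*} [NormedAddCommGroup F] [NormedSpace ℝ F]
    (a : C(K, E →L[ℝ] F)) (h : C(K, E)) (t : K) : pointwiseApply K E F a h t = a t (h t) := rfl

/-- The range of `γ` is compact, so `f'` is uniformly continuous at it, and the mean value
inequality on balls of one radius bounds the remainder uniformly in `t`. -/
theorem hasFDerivAt_superposition {F : Type*} [NormedAddCommGroup F] [NormedSpace ℝ F]
    (f : C(E, F)) (f' : C(E, E →L[ℝ] F)) (hf : ∀ x, HasFDerivAt f (f' x) x) (γ : C(K, E)) :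
    HasFDerivAt (fun γ : C(K, E) => f.comp γ) (pointwiseApply K E F (f'.comp γ)) γ := by
  rw [hasFDerivAt_iff_isLittleO_nhds_zero, Asymptotics.isLittleO_iff]
  intro ε hε
  have hK : IsCompact (Set.range γ) := isCompact_range γ.continuous
  have hu := hK.uniformContinuousAt_of_continuousAt f' (fun x _ => f'.continuous.continuousAt)
    (Metric.dist_mem_uniformity hε)
  obtain ⟨δ, hδ, hδ'⟩ := Metric.mem_uniformity_dist.1 hu
  filter_upwards [Metric.ball_mem_nhds (0 : C(K, E)) hδ] with h hh
  rw [ContinuousMap.norm_le _ (by positivity)]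
  intro t
  have hht : ‖h t‖ < δ := (h.norm_coe_le_norm t).trans_lt (by simpa using hh)
  have key := (convex_ball (γ t) δ).norm_image_sub_le_of_norm_hasFDerivWithin_le'
    (f := f) (f' := f') (φ := f' (γ t)) (C := ε)
    (fun x _ => (hf x).hasFDerivWithinAt)
    (fun x hx => by
      have := hδ' (show dist (γ t) x < δ by rw [dist_comm]; exact hx) ⟨t, rfl⟩
      rw [Set.mem_ofPred_eq, dist_comm, dist_eq_norm] at this
      exact this.le)
    (Metric.mem_ball_self hδ) (y := γ t + h t) (by simpa using hht)
  simp only [add_sub_cancel_left] at key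
  simp only [ContinuousMap.sub_apply, ContinuousMap.comp_apply, ContinuousMap.add_apply,
    pointwiseApply_apply]
  exact key.trans (by gcongr; exact h.norm_coe_le_norm t)

/-- Induction on the order: the derivative is superposition by `f'` followed by the continuous
linear map `pointwiseApply`. The target `F` varies in the induction because `f'` takes values in `E
→L[ℝ] F`; this is why `E` and `F` share a universe. -/
theorem contDiff_superposition.{u} {E : Type u} [NormedAddCommGroup E] [NormedSpace ℝ E]
    (n : ℕ) : ∀ {F : Type u} [NormedAddCommGroup F] [NormedSpace ℝ F] (f : C(E, F)),
    ContDiff ℝ ∞ f → ContDiff ℝ n (fun γ : C(K, E) => f.comp γ) := by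
  induction n with
  | zero =>
    intro F _ _ f _
    exact contDiff_zero.2 (ContinuousMap.continuous_postcomp f)
  | succ n ih =>
    intro F _ _ f hf
    have hd : Differentiable ℝ f := hf.differentiable (by simp)
    have hf' : ContDiff ℝ ∞ (fderiv ℝ f) := hf.fderiv_right (m := ∞) (by simp)
    let f' : C(E, E →L[ℝ] F) := ⟨fderiv ℝ f, hf'.continuous⟩
    rw [show ((n + 1 : ℕ) : WithTop ℕ∞) = (n : WithTop ℕ∞) + 1 by norm_cast,
      contDiff_succ_iff_hasFDerivAt]
    exact ⟨fun γ => pointwiseApply K E F (f'.comp γ), 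
      ContDiff.comp (g := pointwiseApply K E F) (ContinuousLinearMap.contDiff _) (ih f' hf'),
      fun γ => hasFDerivAt_superposition f f' (fun x => (hd x).hasFDerivAt) γ⟩

end Superposition

/-! ### The Volterra operator -/

section Volterra

variable {E : Type*} [NormedAddCommGroup E] [NormedSpace ℝ E]

/-- The primitive `t ↦ ∫₀ᵗ g` of a continuous function on `[0, 1]`. -/
def volterra (E : Type*) [NormedAddCommGroup E] [NormedSpace ℝ E] [CompleteSpace E] :
    C(Set.Icc (0 : ℝ) 1, E) →L[ℝ] C(Set.Icc (0 : ℝ) 1, E) :=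
  LinearMap.mkContinuous
    { toFun := fun g => ⟨fun t => ∫ s in (0 : ℝ)..t, Set.IccExtend zero_le_one g s, by
        have := intervalIntegral.continuous_primitive
          (μ := MeasureTheory.volume) (f := Set.IccExtend zero_le_one g)
          (fun a b => (g.continuous.Icc_extend' (h := zero_le_one)).intervalIntegrable a b) 0
        exact this.comp continuous_subtype_val⟩
      map_add' := fun g h => by
        ext t
        have hg (g : C(Set.Icc (0 : ℝ) 1, E)) : IntervalIntegrable
            (Set.IccExtend zero_le_one g) MeasureTheory.volume 0 t :=
          (g.continuous.Icc_extend' (h := zero_le_one)).intervalIntegrable _ _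
        simp only [ContinuousMap.coe_mk, ContinuousMap.add_apply]
        rw [← intervalIntegral.integral_add (hg g) (hg h)]
        rfl
      map_smul' := fun c g => by
        ext t
        simp only [ContinuousMap.coe_mk, ContinuousMap.smul_apply, RingHom.id_apply]
        rw [← intervalIntegral.integral_smul]
        rfl } 1
    (fun g => by
      rw [ContinuousMap.norm_le _ (by positivity)]
      intro t
      have := intervalIntegral.norm_integral_le_of_norm_le_const (a := 0) (b := t) (C := ‖g‖)
        (f := Set.IccExtend zero_le_one g) (fun s _ => g.norm_coe_le_norm _)
      refine this.trans ?_
      rw [one_mul, sub_zero, abs_of_nonneg t.2.1]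
      exact mul_le_of_le_one_right (norm_nonneg _) t.2.2)

variable [CompleteSpace E]

theorem volterra_apply (g : C(Set.Icc (0 : ℝ) 1, E)) (t : Set.Icc (0 : ℝ) 1) :
    volterra E g t = ∫ s in (0 : ℝ)..t, Set.IccExtend zero_le_one g s := rfl

theorem hasDerivWithinAt_of_eq_volterra {c : E} {g h : C(Set.Icc (0 : ℝ) 1, E)}
    (hh : h = ContinuousMap.const _ c + volterra E g) (t : Set.Icc (0 : ℝ) 1) :
    HasDerivWithinAt (Set.IccExtend zero_le_one h) (g t) (Set.Icc 0 1) t := by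
  have hc : Continuous (Set.IccExtend zero_le_one g) := g.continuous.Icc_extend'
  have hd := intervalIntegral.integral_hasDerivAt_right (hc.intervalIntegrable 0 t)
    (hc.stronglyMeasurableAtFilter _ _) hc.continuousAt
  rw [Set.IccExtend_val] at hd
  refine ((hd.const_add c).hasDerivWithinAt (s := Set.Icc 0 1)).congr (fun s hs => ?_) ?_
  · rw [Set.IccExtend_of_mem _ _ hs, hh]; rfl
  · rw [Set.IccExtend_val, hh]; rfl

end Volterra

/-- `ContDiffAt ℝ ∞` at a single point does not give smoothness on a neighbourhood, so smoothness is
assumed and concluded at all nearby points. Invertibility of the derivative spreads to a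
neighbourhood because invertible operators form an open set. -/
theorem exists_smooth_local_inverse {E F : Type*} [NormedAddCommGroup E] [NormedSpace ℝ E]
    [CompleteSpace E] [NormedAddCommGroup F] [NormedSpace ℝ F] {f : E → F} {f' : E ≃L[ℝ] F} {a : E}
    (hf : ∀ᶠ x in 𝓝 a, ContDiffAt ℝ ∞ f x) (hf' : HasFDerivAt f (f' : E →L[ℝ] F) a) :
    ∃ g : F → E, g (f a) = a ∧ (∀ᶠ y in 𝓝 (f a), ContDiffAt ℝ ∞ g y ∧ f (g y) = y) ∧
      ∀ᶠ x in 𝓝 a, g (f x) = x := by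
  have h0 : ContDiffAt ℝ ∞ f a := hf.self_of_nhds
  have hn : (∞ : WithTop ℕ∞) ≠ 0 := by simp
  let φ := h0.toOpenPartialHomeomorph f hf' hn
  have hφ : (φ : E → F) = f := h0.toOpenPartialHomeomorph_coe hf' hn
  have has : a ∈ φ.source := h0.mem_toOpenPartialHomeomorph_source hf' hn
  have hat : f a ∈ φ.target := h0.image_mem_toOpenPartialHomeomorph_target hf' hn
  have hga : φ.symm (f a) = a := by rw [← hφ]; exact φ.left_inv has
  refine ⟨φ.symm, hga, ?_, ?_⟩
  · have hinv : ∀ᶠ x in 𝓝 a, ∃ L : E ≃L[ℝ] F, HasFDerivAt f (L : E →L[ℝ] F) x := by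
      have hc : ContinuousAt (fderiv ℝ f) a :=
        (h0.fderiv_right (m := 0) (by simp)).continuousAt
      have : Set.range ((↑) : (E ≃L[ℝ] F) → E →L[ℝ] F) ∈ 𝓝 (fderiv ℝ f a) := by
        rw [hf'.fderiv]; exact ContinuousLinearEquiv.nhds f'
      filter_upwards [hc this, hf] with x ⟨L, hL⟩ hx
      exact ⟨L, by rw [hL]; exact (hx.differentiableAt hn).hasFDerivAt⟩
    have hcs : Filter.Tendsto φ.symm (𝓝 (f a)) (𝓝 a) := by
      have := φ.continuousAt_symm hat
      rwa [ContinuousAt, hga] at this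
    filter_upwards [φ.open_target.mem_nhds hat, hcs.eventually hinv, hcs.eventually hf]
      with y hy ⟨L, hL⟩ hs
    refine ⟨φ.contDiffAt_symm (f₀' := L) hy (by rw [hφ]; exact hL) (by rw [hφ]; exact hs), ?_⟩
    rw [← hφ]; exact φ.right_inv hy
  · filter_upwards [φ.open_source.mem_nhds has] with x hx
    rw [← hφ]; exact φ.left_inv hx

/-! ### Exponentials of commuting families of vector fields -/

section Exponential

variable {E : Type*} [NormedAddCommGroup E] [NormedSpace ℝ E]

/-- Constant functions, as a continuous linear map. -/
def constL (K : Type*) [TopologicalSpace K] [CompactSpace K]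
    (E : Type*) [NormedAddCommGroup E] [NormedSpace ℝ E] : E →L[ℝ] C(K, E) where
  toFun := ContinuousMap.const K
  map_add' _ _ := rfl
  map_smul' _ _ := rfl
  cont := ContinuousMap.continuous_const'

@[simp] theorem constL_apply {K : Type*} [TopologicalSpace K] [CompactSpace K] (c : E) (t : K) :
    constL K E c t = c := rfl

/-- The integral equation `γ(t) = c + ∫₀ᵗ f(γ) x`, as a map that vanishes at its solutions. -/
def rayEquation [CompleteSpace E] (f : C(E, E →L[ℝ] E))
    (u : (E × E) × C(Set.Icc (0 : ℝ) 1, E)) : C(Set.Icc (0 : ℝ) 1, E) :=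
  u.2 - (constL _ E u.1.2 +
    volterra E (pointwiseApply _ E E (f.comp u.2) (constL _ E u.1.1)))

/-- The variable is `u = ((x, c), γ)` with direction `x`, initial point `c` and curve `γ`. The
formula for `L` is the linearised integral equation, which is used twice: to invert in `γ` and to
differentiate solutions. -/
theorem hasFDerivAt_rayEquation [CompleteSpace E] (f : C(E, E →L[ℝ] E))
    (f' : C(E, E →L[ℝ] E →L[ℝ] E)) (hf : ∀ x, HasFDerivAt f (f' x) x)
    (u : (E × E) × C(Set.Icc (0 : ℝ) 1, E)) :
    ∃ L : (E × E) × C(Set.Icc (0 : ℝ) 1, E) →L[ℝ] C(Set.Icc (0 : ℝ) 1, E),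
      HasFDerivAt (rayEquation f) L u ∧ ∀ w, L w = w.2 - (constL _ E w.1.2 +
        volterra E (pointwiseApply _ E E (f.comp u.2) (constL _ E w.1.1) +
          pointwiseApply _ E E (pointwiseApply _ E _ (f'.comp u.2) w.2) (constL _ E u.1.1))) := by
  let X := C(Set.Icc (0 : ℝ) 1, E)
  let p2 := ContinuousLinearMap.snd ℝ (E × E) X
  let p11 := (ContinuousLinearMap.fst ℝ E E).comp (ContinuousLinearMap.fst ℝ (E × E) X)
  let p12 := (ContinuousLinearMap.snd ℝ E E).comp (ContinuousLinearMap.fst ℝ (E × E) X)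
  have h1 : HasFDerivAt (fun u : (E × E) × X => f.comp u.2) _ u :=
    (hasFDerivAt_superposition f f' hf u.2).comp u p2.hasFDerivAt
  have h2 : HasFDerivAt (fun u : (E × E) × X => constL (Set.Icc (0 : ℝ) 1) E u.1.1) _ u :=
    ((constL (Set.Icc (0 : ℝ) 1) E).comp p11).hasFDerivAt
  have h3 := (pointwiseApply (Set.Icc (0 : ℝ) 1) E E).hasFDerivAt_of_bilinear h1 h2
  have h4 := (volterra E).hasFDerivAt.comp u h3
  have h5 := p2.hasFDerivAt.sub
    ((((constL (Set.Icc (0 : ℝ) 1) E).comp p12).hasFDerivAt (x := u)).add h4)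
  exact ⟨_, h5, fun w => rfl⟩

theorem contDiff_rayEquation [CompleteSpace E] (f : C(E, E →L[ℝ] E)) (hf : ContDiff ℝ ∞ f) :
    ContDiff ℝ ∞ (rayEquation f) := by
  have h1 : ContDiff ℝ ∞ (fun γ : C(Set.Icc (0 : ℝ) 1, E) => f.comp γ) :=
    contDiff_infty.2 fun n => contDiff_superposition n f hf
  have h2 : ContDiff ℝ ∞ (fun u : (E × E) × C(Set.Icc (0 : ℝ) 1, E) => f.comp u.2) :=
    h1.comp contDiff_snd
  have h3 : ContDiff ℝ ∞ (fun u : (E × E) × C(Set.Icc (0 : ℝ) 1, E) =>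
      pointwiseApply _ E E (f.comp u.2) (constL _ E u.1.1)) :=
    (ContDiff.comp (g := pointwiseApply _ E E) (ContinuousLinearMap.contDiff _) h2).clm_apply
      (ContDiff.comp (g := constL _ E) (ContinuousLinearMap.contDiff _)
        (contDiff_fst.comp contDiff_fst))
  exact contDiff_snd.sub ((ContDiff.comp (g := constL _ E) (ContinuousLinearMap.contDiff _)
    (contDiff_snd.comp contDiff_fst)).add
    (ContDiff.comp (g := volterra E) (ContinuousLinearMap.contDiff _) h3))

/-- A linear family `v ↦ f(·) v` of commuting vector fields has a smooth exponential map. -/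
theorem exists_exponential [CompleteSpace E] {f : E → E →L[ℝ] E} (hf : ContDiff ℝ ∞ f) {z₀ : E}
    (hcomm : ∀ᶠ z in 𝓝 z₀, ∀ v x, fderiv ℝ f z (f z x) v = fderiv ℝ f z (f z v) x) :
    ∃ Φ : E × E → E, (∀ᶠ q in 𝓝 ((0 : E), z₀), ContDiffAt ℝ ∞ Φ q) ∧
      (∀ᶠ c in 𝓝 z₀, Φ (0, c) = c) ∧
      ∀ᶠ q in 𝓝 ((0 : E), z₀), ∀ v, fderiv ℝ Φ q (v, 0) = f (Φ q) v := by
  let X := C(Set.Icc (0 : ℝ) 1, E)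
  let fc : C(E, E →L[ℝ] E) := ⟨f, hf.continuous⟩
  have hf1 : ContDiff ℝ ∞ (fderiv ℝ f) := hf.fderiv_right (m := ∞) (by simp)
  let fc' : C(E, E →L[ℝ] E →L[ℝ] E) := ⟨fderiv ℝ f, hf1.continuous⟩
  have hfc : ∀ x, HasFDerivAt fc (fc' x) x := fun x =>
    (hf.differentiable (by simp) x).hasFDerivAt
  let Θ := rayEquation fc
  have hΘ : ContDiff ℝ ∞ Θ := contDiff_rayEquation fc hf
  let u₀ : (E × E) × X := ((0, z₀), constL _ E z₀)
  have hΘ0 : Θ u₀ = 0 := by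
    simp [Θ, u₀, rayEquation]
  obtain ⟨L₀, hL₀, hL₀'⟩ := hasFDerivAt_rayEquation fc fc' hfc u₀
  -- At `u₀` the direction `x` is zero, so the term with `f'` drops out and the partial derivative
  -- of `Θ` in `γ` is the identity. The derivative of `(u.1, Θ u)` is thus triangular with identity
  -- diagonal.
  let S : ((E × E) × X) ≃L[ℝ] ((E × E) × X) :=
    (ContinuousLinearEquiv.refl ℝ (E × E)).skewProd (ContinuousLinearEquiv.refl ℝ X)
      (L₀.comp (ContinuousLinearMap.inl ℝ (E × E) X))
  let Ψ : (E × E) × X → (E × E) × X := fun u => (u.1, Θ u)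
  have hΨ : ContDiff ℝ ∞ Ψ := contDiff_fst.prodMk hΘ
  have hΨ' : HasFDerivAt Ψ (S : ((E × E) × X) →L[ℝ] ((E × E) × X)) u₀ := by
    have hS : (S : ((E × E) × X) →L[ℝ] ((E × E) × X)) =
        (ContinuousLinearMap.fst ℝ (E × E) X).prod L₀ := by
      refine ContinuousLinearMap.ext fun w => Prod.ext rfl ?_
      change w.2 + L₀ (w.1, 0) = L₀ w
      rw [hL₀', hL₀']
      simp [u₀]
      abel
    rw [hS]
    exact (ContinuousLinearMap.fst ℝ (E × E) X).hasFDerivAt.prodMk hL₀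
  obtain ⟨g, hg0, hg1, -⟩ := exists_smooth_local_inverse
    (Filter.Eventually.of_forall fun u => hΨ.contDiffAt) hΨ'
  have hΨ0 : Ψ u₀ = ((0, z₀), 0) := by simp only [Ψ, hΘ0]; rfl
  rw [hΨ0] at hg0 hg1
  let ι : E × E → (E × E) × X := fun q => (q, 0)
  have hι : Filter.Tendsto ι (𝓝 (0, z₀)) (𝓝 ((0, z₀), 0)) :=
    (Continuous.tendsto (by fun_prop) _)
  let Γ : E × E → X := fun q => (g (q, 0)).2
  have hΓ : ∀ᶠ q in 𝓝 ((0 : E), z₀), ContDiffAt ℝ ∞ Γ q ∧ Θ (q, Γ q) = 0 := by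
    filter_upwards [hι.eventually hg1] with q ⟨hq1, hq2⟩
    refine ⟨contDiffAt_snd.comp q (hq1.comp q (f := ι) (by fun_prop)), ?_⟩
    have h1 : (g (q, 0)).1 = q := congrArg Prod.fst hq2
    have h2 : Θ (g (q, 0)) = 0 := congrArg Prod.snd hq2
    rw [← h2]; congr 1; exact Prod.ext h1.symm rfl
  have hΓ0 : Γ (0, z₀) = constL _ E z₀ := congrArg Prod.snd hg0
  let one : Set.Icc (0 : ℝ) 1 := ⟨1, by simp⟩
  let ev : X →L[ℝ] E := ContinuousMap.evalCLM ℝ one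
  refine ⟨fun q => ev (Γ q), ?_, ?_, ?_⟩
  · filter_upwards [hΓ] with q hq
    exact ev.contDiff.contDiffAt.comp q hq.1
  · have : Filter.Tendsto (fun c : E => ((0 : E), c)) (𝓝 z₀) (𝓝 (0, z₀)) :=
      (Continuous.tendsto (by fun_prop) _)
    filter_upwards [this.eventually hΓ] with c hc
    have h := hc.2
    simp only [Θ, rayEquation, map_zero, add_zero, sub_eq_zero] at h
    rw [h]; rfl
  · have hcont : ContinuousAt Γ (0, z₀) := hΓ.self_of_nhds.1.continuousAt
    obtain ⟨δ, hδ, hball⟩ := Metric.eventually_nhds_iff.1 hcomm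
    -- Commutation is known only near `z₀`; sup-norm closeness to the constant curve keeps the whole
    -- curve `Γ q` there.
    have hnear : ∀ᶠ q in 𝓝 ((0 : E), z₀), dist (Γ q) (constL _ E z₀) < δ := by
      have := hcont (Metric.ball_mem_nhds _ hδ)
      rwa [hΓ0] at this
    filter_upwards [hΓ.eventually_nhds, hnear] with q hq hqn v
    have hqs := hq.self_of_nhds
    have hΓd : HasFDerivAt Γ (fderiv ℝ Γ q) q := (hqs.1.differentiableAt (by simp)).hasFDerivAt
    obtain ⟨L, hL, hL'⟩ := hasFDerivAt_rayEquation fc fc' hfc (q, Γ q)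
    set γ := Γ q with hγ
    set ζ : X := fderiv ℝ Γ q (v, 0) with hζ
    -- The variation `ζ` of the solution curve in the direction `(v, 0)` satisfies the equation
    -- obtained by differentiating `Θ (q, Γ q) = 0`.
    have hζeq : ζ = ContinuousMap.const _ 0 + volterra E
        (pointwiseApply _ E E (fc.comp γ) (constL _ E v) +
          pointwiseApply _ E E (pointwiseApply _ E _ (fc'.comp γ) ζ) (constL _ E q.1)) := by
      have h1 : HasFDerivAt (fun q => Θ (q, Γ q)) _ q :=
        HasFDerivAt.comp (g := rayEquation fc) q hL ((hasFDerivAt_id q).prodMk hΓd)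
      have h2 : HasFDerivAt (fun q => Θ (q, Γ q)) (0 : E × E →L[ℝ] X) q :=
        (hasFDerivAt_const (0 : X) q).congr_of_eventuallyEq (hq.mono fun q' h => h.2)
      have h3 := DFunLike.congr_fun (h1.unique h2) (v, 0)
      have h4 : L ((v, 0), ζ) = 0 := h3
      rw [hL'] at h4
      exact sub_eq_zero.1 h4
    have hγeq : γ = ContinuousMap.const _ q.2 +
        volterra E (pointwiseApply _ E E (fc.comp γ) (constL _ E q.1)) := sub_eq_zero.1 hqs.2
    have hζd := hasDerivWithinAt_of_eq_volterra hζeq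
    have hγd := hasDerivWithinAt_of_eq_volterra hγeq
    let G : ℝ → E := Set.IccExtend zero_le_one γ
    let Z : ℝ → E := Set.IccExtend zero_le_one ζ
    have hpt : ∀ t : Set.Icc (0 : ℝ) 1, ∀ v x,
        fderiv ℝ f (γ t) (f (γ t) x) v = fderiv ℝ f (γ t) (f (γ t) v) x :=
      fun t => hball ((ContinuousMap.dist_apply_le_dist t).trans_lt hqn)
    -- Both `ζ` and `s ↦ s f(γ(s)) v` solve the same inhomogeneous linear equation, the second one
    -- because of commutation. Their difference solves the homogeneous equation with initial value
    -- zero, so by Grönwall it vanishes at `s = 1`.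
    have hU : ∀ t : Set.Icc (0 : ℝ) 1, HasDerivWithinAt (fun s => Z s - s • f (G s) v)
        (fderiv ℝ f (γ t) (Z t - (t : ℝ) • f (G t) v) q.1) (Set.Icc 0 1) t := by
      intro t
      have hGt : G t = γ t := Set.IccExtend_val _ _ t
      have hZt : Z t = ζ t := Set.IccExtend_val _ _ t
      have hfd : HasFDerivAt f (fderiv ℝ f (G t)) (G t) := hfc (G t)
      have h1 : HasDerivWithinAt (fun s => f (G s)) _ (Set.Icc 0 1) (t : ℝ) :=
        hfd.comp_hasDerivWithinAt (t : ℝ) (hγd t)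
      have h2 := h1.clm_apply (hasDerivWithinAt_const (t : ℝ) (Set.Icc 0 1) v)
      have h3 := (hζd t).sub ((hasDerivWithinAt_id (t : ℝ) (Set.Icc 0 1)).smul h2)
      refine h3.congr_deriv (Eq.symm ?_)
      change fderiv ℝ f (γ t) (Z t - (t : ℝ) • f (G t) v) q.1 =
        (f (γ t) v + fderiv ℝ f (γ t) (ζ t) q.1) -
        ((t : ℝ) • (fderiv ℝ f (G t) (f (γ t) q.1) v + f (G t) 0) + (1 : ℝ) • f (G t) v)
      rw [hGt, hZt, hpt t v q.1, map_sub, map_smul, map_zero, one_smul, add_zero]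
      change fderiv ℝ f (γ t) (ζ t) q.1 - (t : ℝ) • fderiv ℝ f (γ t) (f (γ t) v) q.1 = _
      abel
    obtain ⟨C, hC⟩ : ∃ C, ∀ t, ‖fderiv ℝ f (γ t)‖ ≤ C := by
      have hd : Continuous fun t => fderiv ℝ f (γ t) := hf1.continuous.comp γ.continuous
      have hc : Continuous fun t => ‖fderiv ℝ f (γ t)‖ :=
        (continuous_norm (E := E →L[ℝ] E →L[ℝ] E)).comp hd
      obtain ⟨C, hC⟩ := (isCompact_range hc).bddAbove
      exact ⟨C, fun t => hC ⟨t, rfl⟩⟩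
    have hzero := eq_zero_of_abs_deriv_le_mul_abs_self_of_eq_zero_right
      (f := fun s => Z s - s • f (G s) v) (K := C * ‖q.1‖) (a := 0) (b := 1)
      (f' := fun s => fderiv ℝ f (γ (Set.projIcc 0 1 zero_le_one s)) (Z s - s • f (G s) v) q.1)
      (fun s hs => (hU ⟨s, hs⟩).continuousWithinAt)
      (fun s hs => by
        have := hU ⟨s, Set.Ico_subset_Icc_self hs⟩
        rw [Set.projIcc_of_mem _ (Set.Ico_subset_Icc_self hs)]
        exact this.mono_of_mem_nhdsWithin (Icc_mem_nhdsGE_of_mem hs))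
      (by
        have : Z 0 = ζ ⟨0, by simp⟩ := Set.IccExtend_of_mem _ _ _
        simp only [this, zero_smul, sub_zero]
        rw [hζeq, ContinuousMap.add_apply, volterra_apply, intervalIntegral.integral_same]
        exact zero_add _)
      (fun s hs => by
        have h1 := hC (Set.projIcc 0 1 zero_le_one s)
        refine (ContinuousLinearMap.le_opNorm _ _).trans ?_
        have h2 := ContinuousLinearMap.le_of_opNorm_le _ h1 (Z s - s • f (G s) v)
        calc _ ≤ (C * ‖Z s - s • f (G s) v‖) * ‖q.1‖ := by gcongr
          _ = _ := by ring)
      1 (by simp)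
    have h1 : Z 1 = ζ one := Set.IccExtend_of_mem _ _ _
    have h2 : G 1 = γ one := Set.IccExtend_of_mem _ _ _
    simp only [h1, h2, one_smul, sub_eq_zero] at hzero
    have h3 : HasFDerivAt (fun q => ev (Γ q)) (ev.comp (fderiv ℝ Γ q)) q :=
      ev.hasFDerivAt.comp q hΓd
    rw [h3.fderiv]
    exact hzero

end Exponential

/-! ### The Frobenius theorem for vector-valued 1-forms -/

section Frobenius

variable {E : Type*} [NormedAddCommGroup E] [NormedSpace ℝ E]

/-- Multiplication by a bump function supported where `g` is smooth. The exponential map needs a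
globally smooth family, since superposition acts on all of `C([0,1], E)`. -/
theorem exists_contDiff_eventuallyEq [FiniteDimensional ℝ E] {G : Type*} [NormedAddCommGroup G]
    [NormedSpace ℝ G]
    {g : E → G} {z₀ : E} (hg : ∀ᶠ z in 𝓝 z₀, ContDiffAt ℝ ∞ g z) :
    ∃ f : E → G, ContDiff ℝ ∞ f ∧ f =ᶠ[𝓝 z₀] g := by
  obtain ⟨r, hr, hball⟩ := Metric.eventually_nhds_iff.1 hg
  let χ : ContDiffBump z₀ := ⟨r / 4, r / 2, by linarith, by linarith⟩
  refine ⟨fun z => χ z • g z, contDiff_iff_contDiffAt.2 fun x => ?_, ?_⟩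
  · by_cases hx : dist x z₀ < r
    · exact χ.contDiff.contDiffAt.smul (hball hx)
    · have : x ∉ tsupport χ := by
        rw [χ.tsupport_eq, Metric.mem_closedBall]
        change ¬ dist x z₀ ≤ r / 2
        linarith
      refine (contDiffAt_const (c := (0 : G))).congr_of_eventuallyEq ?_
      filter_upwards [notMem_tsupport_iff_eventuallyEq.1 this] with y hy
      rw [hy, Pi.zero_apply, zero_smul]
  · filter_upwards [χ.eventuallyEq_one] with y hy
    rw [hy, Pi.one_apply, one_smul]

/-- The projection onto `ker θ(z)` along the image of `T`, when `θ(z) ∘ T` is invertible. -/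
def kerProj {F : Type*} [NormedAddCommGroup F] [NormedSpace ℝ F] (T : F →L[ℝ] E)
    (θ : E →L[ℝ] F) : E →L[ℝ] E :=
  ContinuousLinearMap.id ℝ E - T.comp ((θ.comp T).inverse.comp θ)

variable {F : Type*} [NormedAddCommGroup F] [NormedSpace ℝ F] {T : F →L[ℝ] E} {θ : E →L[ℝ] F}

theorem kerProj_apply (v : E) : kerProj T θ v = v - T ((θ.comp T).inverse (θ v)) := rfl

theorem apply_kerProj (h : (θ.comp T).IsInvertible) (v : E) : θ (kerProj T θ v) = 0 := by
  have := h.self_apply_inverse (θ v)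
  rw [kerProj_apply, map_sub, sub_eq_zero]
  exact this.symm

theorem kerProj_apply_of_eq_zero {v : E} (hv : θ v = 0) : kerProj T θ v = v := by
  rw [kerProj_apply, hv, map_zero, map_zero, sub_zero]

theorem kerProj_range (h : (θ.comp T).IsInvertible) (y : F) : kerProj T θ (T y) = 0 := by
  have := h.inverse_apply_self y
  rw [kerProj_apply, sub_eq_zero]
  exact (congrArg T this).symm

theorem eventually_contDiffAt_kerProj [FiniteDimensional ℝ F]
    {θ : E → E →L[ℝ] F} {z₀ : E}
    (hθ : ∀ᶠ z in 𝓝 z₀, ContDiffAt ℝ ∞ θ z) (hT : ((θ z₀).comp T).IsInvertible) :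
    ∀ᶠ z in 𝓝 z₀, ((θ z).comp T).IsInvertible ∧
      ContDiffAt ℝ ∞ (fun z => kerProj T (θ z)) z := by
  have hinv : ∀ᶠ z in 𝓝 z₀, ((θ z).comp T).IsInvertible := by
    obtain ⟨L, hL⟩ := hT
    have hc : ContinuousAt (fun z => (θ z).comp T) z₀ :=
      (hθ.self_of_nhds.continuousAt).clm_comp continuousAt_const
    have hn : Set.range ((↑) : (F ≃L[ℝ] F) → F →L[ℝ] F) ∈ 𝓝 ((θ z₀).comp T) := by
      rw [← hL]; exact ContinuousLinearEquiv.nhds L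
    exact hc hn
  filter_upwards [hinv, hθ] with z hz hs
  refine ⟨hz, ?_⟩
  obtain ⟨L, hL⟩ := hz
  have h1 : ContDiffAt ℝ ∞ (fun z => (θ z).comp T) z := hs.clm_comp contDiffAt_const
  have h2 : ContDiffAt ℝ ∞ (fun z => ((θ z).comp T).inverse) z := by
    refine ContDiffAt.comp (g := ContinuousLinearMap.inverse) z ?_ h1
    rw [← hL]; exact contDiffAt_map_inverse L
  exact contDiffAt_const.sub (contDiffAt_const.clm_comp (h2.clm_comp hs))

/-- The Frobenius theorem: an integrable Pfaffian system `θ = 0` has first integrals whose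
differentials at `z₀` are prescribed by `θ`. -/
theorem exists_first_integral [FiniteDimensional ℝ E] [FiniteDimensional ℝ F]
    {θ : E → E →L[ℝ] F} {z₀ : E}
    (hθ : ∀ᶠ z in 𝓝 z₀, ContDiffAt ℝ ∞ θ z) (hsurj : Function.Surjective (θ z₀))
    (hint : ∀ᶠ z in 𝓝 z₀, ∀ u v, θ z u = 0 → θ z v = 0 →
      fderiv ℝ θ z u v = fderiv ℝ θ z v u) :
    ∃ J : E → F, (∀ᶠ z in 𝓝 z₀, ContDiffAt ℝ ∞ J z) ∧ fderiv ℝ J z₀ = θ z₀ ∧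
      ∀ᶠ z in 𝓝 z₀, ∀ w, θ z w = 0 → fderiv ℝ J z w = 0 := by
  have hcE : CompleteSpace E := FiniteDimensional.complete ℝ E
  obtain ⟨T', hT'⟩ := (θ z₀).toLinearMap.exists_rightInverse_of_surjective
    (LinearMap.range_eq_top.2 hsurj)
  -- The image of `T` is a fixed complement of `ker θ(z)` for all `z` near `z₀`. The family `f`
  -- below extends the projections onto `ker θ(z)` along it.
  let T : F →L[ℝ] E := LinearMap.toContinuousLinearMap T'
  have hT : ∀ y, θ z₀ (T y) = y := fun y => LinearMap.congr_fun hT' y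
  have hTid : (θ z₀).comp T = ContinuousLinearMap.id ℝ F := ContinuousLinearMap.ext hT
  have hT0 : ((θ z₀).comp T).IsInvertible := ⟨ContinuousLinearEquiv.refl ℝ F, hTid.symm⟩
  have hP := eventually_contDiffAt_kerProj hθ hT0
  obtain ⟨f, hf, hfeq⟩ := exists_contDiff_eventuallyEq (hP.mono fun z h => h.2)
  let P₀ : E →L[ℝ] E := ContinuousLinearMap.id ℝ E - T.comp (θ z₀)
  have hP₀ : ∀ v, P₀ v = v - T (θ z₀ v) := fun v => rfl
  have hf0 : f z₀ = P₀ := by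
    rw [hfeq.self_of_nhds]
    refine ContinuousLinearMap.ext fun v => ?_
    have h := hT0.inverse_apply_self (θ z₀ v)
    have h' : ((θ z₀).comp T) (θ z₀ v) = θ z₀ v := hT _
    rw [h'] at h
    change v - T (((θ z₀).comp T).inverse (θ z₀ v)) = v - T (θ z₀ v)
    rw [h]
  have hfd : ∀ z, HasFDerivAt f (fderiv ℝ f z) z := fun z =>
    (hf.differentiable (by simp) z).hasFDerivAt
  have hfix : ∀ᶠ z in 𝓝 z₀, (∀ v, θ z (f z v) = 0) ∧ (∀ v, P₀ (f z v) = P₀ v) ∧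
      (∀ v, θ z v = 0 → f z v = v) ∧ ∀ y, f z (T y) = 0 := by
    filter_upwards [hfeq, hP] with z hz hz'
    simp only [hz]
    refine ⟨apply_kerProj hz'.1, fun v => ?_, fun v => kerProj_apply_of_eq_zero,
      kerProj_range hz'.1⟩
    rw [kerProj_apply, map_sub, sub_eq_self, hP₀, hT, sub_self]
  -- The bracket `d` of two of the fields lies in `ker θ(z)` by integrability. It also lies in the
  -- image of `T`, because the components `P₀ (f z v) = P₀ v` are constant. These subspaces meet in
  -- zero.
  have hcomm : ∀ᶠ z in 𝓝 z₀, ∀ v x,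
      fderiv ℝ f z (f z x) v = fderiv ℝ f z (f z v) x := by
    filter_upwards [hfix.eventually_nhds, hP, hθ, hint] with z hz hzP hzθ hzint v x
    have hθd : HasFDerivAt θ (fderiv ℝ θ z) z := (hzθ.differentiableAt (by simp)).hasFDerivAt
    have h1 : ∀ u v, fderiv ℝ θ z u (f z v) + θ z (fderiv ℝ f z u v) = 0 := by
      intro u v
      have e1 := hθd.clm_apply ((hfd z).clm_apply (hasFDerivAt_const v z))
      have e2 : HasFDerivAt (fun z => θ z (f z v)) (0 : E →L[ℝ] F) z :=
        (hasFDerivAt_const (0 : F) z).congr_of_eventuallyEq (hz.mono fun z' h => h.1 v)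
      have e3 : θ z (f z 0 + fderiv ℝ f z u v) + fderiv ℝ θ z u (f z v) = 0 :=
        DFunLike.congr_fun (e1.unique e2) u
      rwa [map_zero, zero_add, add_comm] at e3
    have h2 : ∀ u v, P₀ (fderiv ℝ f z u v) = 0 := by
      intro u v
      have e1 := P₀.hasFDerivAt.comp z ((hfd z).clm_apply (hasFDerivAt_const v z))
      have e2 : HasFDerivAt (fun z => P₀ (f z v)) (0 : E →L[ℝ] E) z :=
        (hasFDerivAt_const (P₀ v) z).congr_of_eventuallyEq (hz.mono fun z' h => h.2.1 v)
      have e3 : P₀ (f z 0 + fderiv ℝ f z u v) = 0 := DFunLike.congr_fun (e1.unique e2) u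
      rwa [map_zero, zero_add] at e3
    have hz0 := hz.self_of_nhds
    rw [← sub_eq_zero]
    set d := fderiv ℝ f z (f z x) v - fderiv ℝ f z (f z v) x with hd
    have h3 : θ z d = 0 := by
      rw [hd, map_sub, eq_neg_of_add_eq_zero_right (h1 _ _), eq_neg_of_add_eq_zero_right (h1 _ _),
        hzint _ _ (hz0.1 x) (hz0.1 v), sub_self]
    have h4 : d = T (θ z₀ d) := by
      have : P₀ d = 0 := by rw [hd, map_sub, h2, h2, sub_zero]
      rwa [hP₀, sub_eq_zero] at this
    have h5 : θ z₀ d = 0 := by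
      have h := hzP.1.inverse_apply_self (θ z₀ d)
      have h' : ((θ z).comp T) (θ z₀ d) = 0 := by
        change θ z (T (θ z₀ d)) = 0
        rw [← h4, h3]
      rw [h', map_zero] at h
      exact h.symm
    rw [h4, h5, map_zero]
  obtain ⟨Φ, hΦ, hΦ0, hΦd⟩ := exists_exponential hf hcomm
  -- A point is split into a direction in `ker θ(z₀)` and a starting point on the transversal `z₀ +
  -- im T`. Then `Φ ∘ A` flows from the transversal and has the identity as derivative at `z₀`.
  let A : E → E × E := fun z => (P₀ (z - z₀), z₀ + T (θ z₀ (z - z₀)))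
  let A' : E →L[ℝ] E × E := P₀.prod (T.comp (θ z₀))
  have hA : ∀ z, HasFDerivAt A A' z := fun z => by
    have h0 : HasFDerivAt (fun z => z - z₀) (ContinuousLinearMap.id ℝ E) z :=
      (hasFDerivAt_id z).sub_const z₀
    exact (P₀.hasFDerivAt.comp z h0).prodMk
      (((T.comp (θ z₀)).hasFDerivAt.comp z h0).const_add z₀)
  have hAs : ContDiff ℝ ∞ A := by
    have h0 : ContDiff ℝ ∞ (fun z : E => z - z₀) := contDiff_id.sub contDiff_const
    exact (P₀.contDiff.comp h0).prodMk
      (contDiff_const.add (ContDiff.comp (g := T.comp (θ z₀))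
        (ContinuousLinearMap.contDiff _) h0))
  have hA0 : A z₀ = (0, z₀) := by simp [A]
  have hAt : Filter.Tendsto A (𝓝 z₀) (𝓝 (0, z₀)) := by
    rw [← hA0]; exact hAs.continuous.continuousAt
  let Φ' : E → E := Φ ∘ A
  have hΦ's : ∀ᶠ z in 𝓝 z₀, ContDiffAt ℝ ∞ Φ' z :=
    (hAt.eventually hΦ).mono fun z h => h.comp z hAs.contDiffAt
  have hΦ'd : ∀ᶠ z in 𝓝 z₀, HasFDerivAt Φ' ((fderiv ℝ Φ (A z)).comp A') z :=
    (hAt.eventually hΦ).mono fun z h =>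
      (h.differentiableAt (by simp)).hasFDerivAt.comp z (hA z)
  have hΦ00 : Φ (0, z₀) = z₀ := hΦ0.self_of_nhds
  have hid : HasFDerivAt Φ' (ContinuousLinearEquiv.refl ℝ E : E →L[ℝ] E) z₀ := by
    refine hΦ'd.self_of_nhds.congr_fderiv (ContinuousLinearMap.ext fun h => ?_)
    change fderiv ℝ Φ (A z₀) (P₀ h, T (θ z₀ h)) = h
    rw [hA0]
    have e1 : fderiv ℝ Φ (0, z₀) (P₀ h, 0) = P₀ h := by
      rw [hΦd.self_of_nhds, hΦ00, hf0, hP₀, hP₀]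
      simp [hT]
    have e2 : fderiv ℝ Φ (0, z₀) (0, T (θ z₀ h)) = T (θ z₀ h) := by
      have c1 : HasFDerivAt (fun c : E => ((0 : E), c)) (ContinuousLinearMap.inr ℝ E E) z₀ :=
        (ContinuousLinearMap.inr ℝ E E).hasFDerivAt
      have c2 := (hΦ.self_of_nhds.differentiableAt (by simp)).hasFDerivAt.comp z₀ c1
      have c3 : HasFDerivAt (Φ ∘ fun c : E => ((0 : E), c)) (ContinuousLinearMap.id ℝ E) z₀ :=
        (hasFDerivAt_id z₀).congr_of_eventuallyEq hΦ0
      exact DFunLike.congr_fun (c2.unique c3) (T (θ z₀ h))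
    have e3 : (P₀ h, T (θ z₀ h)) = (P₀ h, 0) + (0, T (θ z₀ h)) := by simp
    rw [e3, map_add, e1, e2, hP₀, sub_add_cancel]
  obtain ⟨Ψ, hΨ0, hΨs, hΨl⟩ := exists_smooth_local_inverse hΦ's hid
  have hΦ'0 : Φ' z₀ = z₀ := by change Φ (A z₀) = z₀; rw [hA0, hΦ00]
  rw [hΦ'0] at hΨ0 hΨs
  have hΨt : Filter.Tendsto Ψ (𝓝 z₀) (𝓝 z₀) := by
    have := hΨs.self_of_nhds.1.continuousAt
    rwa [ContinuousAt, hΨ0] at this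
  -- In the straightened coordinates `Ψ` the first integral is the transversal component.
  refine ⟨fun z => θ z₀ (Ψ z), ?_, ?_, ?_⟩
  · filter_upwards [hΨs] with z hz
    exact (θ z₀).contDiff.contDiffAt.comp z hz.1
  · have hd := (hΨs.self_of_nhds.1.differentiableAt (by simp)).hasFDerivAt
    have h1 : HasFDerivAt (fun z => θ z₀ (Ψ z)) ((θ z₀).comp (fderiv ℝ Ψ z₀)) z₀ :=
      (θ z₀).hasFDerivAt.comp z₀ hd
    have h2 : HasFDerivAt (Φ' ∘ Ψ) (ContinuousLinearMap.id ℝ E) z₀ :=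
      (hasFDerivAt_id z₀).congr_of_eventuallyEq (hΨs.mono fun z h => h.2)
    have h3 : HasFDerivAt (Φ' ∘ Ψ) _ z₀ := HasFDerivAt.comp z₀ (by rw [hΨ0]; exact hid) hd
    rw [h1.fderiv]
    refine ContinuousLinearMap.ext fun w => ?_
    have h4 : fderiv ℝ Ψ z₀ w = w := DFunLike.congr_fun (h3.unique h2) w
    change θ z₀ (fderiv ℝ Ψ z₀ w) = _
    rw [h4]
  · filter_upwards [hΨs, hΨt.eventually hΨl.eventually_nhds, hΨt.eventually hΦ'd,
      hΨt.eventually (hAt.eventually hΦd), hfix] with z hz hl hd hpd hfx w hw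
    have hΨd := (hz.1.differentiableAt (by simp)).hasFDerivAt
    set s := Ψ z with hs
    have hsz : Φ (A s) = z := hz.2
    have h1 : HasFDerivAt (Ψ ∘ Φ') (ContinuousLinearMap.id ℝ E) s :=
      (hasFDerivAt_id s).congr_of_eventuallyEq hl
    have h2 : HasFDerivAt (Ψ ∘ Φ') ((fderiv ℝ Ψ z).comp ((fderiv ℝ Φ (A s)).comp A')) s :=
      HasFDerivAt.comp s (by change HasFDerivAt Ψ _ (Φ (A s)); rw [hsz]; exact hΨd) hd
    -- For `w` in `ker θ(z)` the straightening carries the constant vector `P₀ w` to `f z (P₀ w) = f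
    -- z w = w`, so `dΨ(w) = P₀ w`, which `θ z₀` kills.
    have h3 : fderiv ℝ Φ (A s) (A' (P₀ w)) = w := by
      have e1 : θ z₀ (P₀ w) = 0 := by rw [hP₀, map_sub, hT, sub_self]
      have e2 : A' (P₀ w) = (P₀ w, 0) := by
        change (P₀ (P₀ w), T (θ z₀ (P₀ w))) = _
        rw [e1, map_zero, hP₀ (P₀ w), e1, map_zero, sub_zero]
      rw [e2, hpd, hsz, hP₀, map_sub, hfx.2.2.2, sub_zero, hfx.2.2.1 w hw]
    have h4 : fderiv ℝ Ψ z (fderiv ℝ Φ (A s) (A' (P₀ w))) = P₀ w :=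
      DFunLike.congr_fun (h2.unique h1) (P₀ w)
    rw [h3] at h4
    have h5 : HasFDerivAt (fun z => θ z₀ (Ψ z)) ((θ z₀).comp (fderiv ℝ Ψ z)) z :=
      (θ z₀).hasFDerivAt.comp z hΨd
    rw [h5.fderiv]
    change θ z₀ (fderiv ℝ Ψ z w) = 0
    rw [h4, hP₀, map_sub, hT, sub_self]

end Frobenius

/-! ### Vector fields and 1-forms in a chart -/

section Charts

variable {m : ℕ} {M : Type*} [TopologicalSpace M] [ChartedSpace (EuclideanSpace ℝ (Fin m)) M]

/-- The derivative at `q` of the chart at `x`. -/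
def chartD (x q : M) : TangentSpace (𝓡 m) q →L[ℝ] EuclideanSpace ℝ (Fin m) :=
  mfderiv (𝓡 m) 𝓘(ℝ, EuclideanSpace ℝ (Fin m)) (extChartAt (𝓡 m) x) q

/-- The derivative of the inverse of the chart at `x`, at the image of `q`. -/
def chartDInv (x q : M) : EuclideanSpace ℝ (Fin m) →L[ℝ] TangentSpace (𝓡 m) q :=
  mfderiv 𝓘(ℝ, EuclideanSpace ℝ (Fin m)) (𝓡 m) (extChartAt (𝓡 m) x).symm (extChartAt (𝓡 m) x q)

/-- The vector field with constant coordinates `v` in the chart at `x`. -/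
def coordField (x : M) (v : EuclideanSpace ℝ (Fin m)) : VField m M := fun q => chartDInv x q v

/-- The coordinates of a vector field in the chart at `x`. -/
def VField.coords (Y : VField m M) (x q : M) : EuclideanSpace ℝ (Fin m) := chartD x q (Y q)

variable {x q : M}

theorem SmoothFunOn.at {f : M → ℝ} {V : Set M} (h : SmoothFunOn (m := m) V f) (hV : IsOpen V)
    {p : M} (hp : p ∈ V) : ContMDiffAt (𝓡 m) 𝓘(ℝ, ℝ) ∞ f p :=
  ContMDiffOn.contMDiffAt h (hV.mem_nhds hp)

theorem OneForm.rep_chart (α : OneForm m M) (hq : q ∈ (extChartAt (𝓡 m) x).source)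
    (v : EuclideanSpace ℝ (Fin m)) :
    α.rep x (extChartAt (𝓡 m) x q) v = α q (coordField x v q) := by
  -- The tangent space depends on the base point, so the equality of points is generalised and then
  -- substituted instead of being rewritten.
  have : ∀ q', q' = q → α q' (mfderiv 𝓘(ℝ, EuclideanSpace ℝ (Fin m)) (𝓡 m)
      (extChartAt (𝓡 m) x).symm (extChartAt (𝓡 m) x q) v) = α q (coordField x v q) := by
    rintro _ rfl; rfl
  exact this _ ((extChartAt (𝓡 m) x).left_inv hq)

theorem OneForm.SmoothOn.rep {α : OneForm m M} {V : Set M} (hα : α.SmoothOn V) (hV : IsOpen V)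
    (hqV : q ∈ V) (hq : q ∈ (extChartAt (𝓡 m) x).source) :
    ContDiffAt ℝ ∞ (α.rep x) (extChartAt (𝓡 m) x q) := by
  refine (hα x).contDiffAt (((continuousOn_extChartAt_symm x).isOpen_inter_preimage
    (isOpen_extChartAt_target x) hV).mem_nhds ⟨(extChartAt (𝓡 m) x).map_source hq, ?_⟩)
  rwa [Set.mem_preimage, (extChartAt (𝓡 m) x).left_inv hq]

variable [IsManifold (𝓡 m) ∞ M]

theorem chartDInv_chartD (hq : q ∈ (extChartAt (𝓡 m) x).source) (v : TangentSpace (𝓡 m) q) :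
    chartDInv x q (chartD x q v) = v := by
  have h := mfderivWithin_extChartAt_symm_comp_mfderiv_extChartAt' (I := 𝓡 m) hq
  rw [ModelWithCorners.range_eq_univ, mfderivWithin_univ] at h
  exact DFunLike.congr_fun h v

theorem chartD_chartDInv (hq : q ∈ (extChartAt (𝓡 m) x).source)
    (v : EuclideanSpace ℝ (Fin m)) : chartD x q (chartDInv x q v) = v := by
  have h := mfderiv_extChartAt_comp_mfderivWithin_extChartAt_symm' (I := 𝓡 m) hq
  rw [ModelWithCorners.range_eq_univ, mfderivWithin_univ] at h
  exact DFunLike.congr_fun h v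

/-- The derivative of the chart at `x`, as an equivalence. -/
def chartEquiv (hq : q ∈ (extChartAt (𝓡 m) x).source) :
    TangentSpace (𝓡 m) q ≃L[ℝ] EuclideanSpace ℝ (Fin m) :=
  ContinuousLinearEquiv.equivOfInverse (chartD x q) (chartDInv x q) (chartDInv_chartD hq)
    (chartD_chartDInv hq)

theorem coordField_coords (Y : VField m M) (hq : q ∈ (extChartAt (𝓡 m) x).source) :
    coordField x (Y.coords x q) q = Y q := chartDInv_chartD hq _

theorem coords_coordField (hq : q ∈ (extChartAt (𝓡 m) x).source)
    (v : EuclideanSpace ℝ (Fin m)) : (coordField x v).coords x q = v := chartD_chartDInv hq _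

/-- Over the chart domain at `x`, the trivialisation of the tangent bundle at `x` is the derivative
of the chart. -/
theorem smoothAt_iff_coords (Y : VField m M) (hq : q ∈ (extChartAt (𝓡 m) x).source) :
    ContMDiffAt (𝓡 m) (𝓡 m).tangent ∞ (fun p => (⟨p, Y p⟩ : TangentBundle (𝓡 m) M)) q ↔
      ContMDiffAt (𝓡 m) 𝓘(ℝ, EuclideanSpace ℝ (Fin m)) ∞ (Y.coords x) q := by
  have hq' : q ∈ (chartAt (EuclideanSpace ℝ (Fin m)) x).source := by
    rwa [extChartAt_source] at hq
  rw [Bundle.Trivialization.contMDiffAt_section_iff (n := ∞)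
    (trivializationAt (EuclideanSpace ℝ (Fin m)) (TangentSpace (𝓡 m)) x) (x₀ := q) (s := Y)
    (by rwa [TangentBundle.trivializationAt_baseSet])]
  refine Filter.EventuallyEq.contMDiffAt_iff ?_
  filter_upwards [(chartAt (EuclideanSpace ℝ (Fin m)) x).open_source.mem_nhds hq'] with p hp
  have h1 := DFunLike.congr_fun
    (TangentBundle.continuousLinearMapAt_trivializationAt (𝕜 := ℝ) (I := 𝓡 m) hp) (Y p)
  refine Eq.trans ?_ h1
  rw [Bundle.Trivialization.continuousLinearMapAt_apply,
    Bundle.Trivialization.linearMapAt_apply, if_pos]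
  rwa [TangentBundle.trivializationAt_baseSet]

theorem smoothOn_coordField (x : M) (v : EuclideanSpace ℝ (Fin m)) :
    (coordField x v).SmoothOn (extChartAt (𝓡 m) x).source := by
  intro q hq
  refine ((smoothAt_iff_coords _ hq).2 ?_).contMDiffWithinAt
  refine (contMDiffAt_const (c := v)).congr_of_eventuallyEq ?_
  filter_upwards [(isOpen_extChartAt_source (I := 𝓡 m) x).mem_nhds hq] with p hp
  exact coords_coordField hp v

theorem VField.SmoothOn.at {Y : VField m M} {V : Set M} (h : Y.SmoothOn V) (hV : IsOpen V)
    {p : M} (hp : p ∈ V) :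
    ContMDiffAt (𝓡 m) (𝓡 m).tangent ∞ (fun p => (⟨p, Y p⟩ : TangentBundle (𝓡 m) M)) p :=
  ContMDiffOn.contMDiffAt h (hV.mem_nhds hp)

theorem VField.SmoothOn.coords {Y : VField m M} {V : Set M} (h : Y.SmoothOn V) (hV : IsOpen V)
    {p : M} (hp : p ∈ V) (hx : p ∈ (extChartAt (𝓡 m) x).source) :
    ContMDiffAt (𝓡 m) 𝓘(ℝ, EuclideanSpace ℝ (Fin m)) ∞ (Y.coords x) p :=
  (smoothAt_iff_coords _ hx).1 (h.at hV hp)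

theorem contMDiffAt_extChartAt_symm {y : EuclideanSpace ℝ (Fin m)}
    (hy : y ∈ (extChartAt (𝓡 m) x).target) :
    ContMDiffAt 𝓘(ℝ, EuclideanSpace ℝ (Fin m)) (𝓡 m) ∞ (extChartAt (𝓡 m) x).symm y :=
  (contMDiffOn_extChartAt_symm x).contMDiffAt ((isOpen_extChartAt_target x).mem_nhds hy)

/-- A map that is smooth at `q` has a smooth local representative in the chart at `x`. -/
theorem contDiffAt_comp_symm {F : Type*} [NormedAddCommGroup F] [NormedSpace ℝ F] {g : M → F}
    (hq : q ∈ (extChartAt (𝓡 m) x).source) (hg : ContMDiffAt (𝓡 m) 𝓘(ℝ, F) ∞ g q) :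
    ContDiffAt ℝ ∞ (g ∘ (extChartAt (𝓡 m) x).symm) (extChartAt (𝓡 m) x q) := by
  rw [← contMDiffAt_iff_contDiffAt]
  refine ContMDiffAt.comp _ ?_
    (contMDiffAt_extChartAt_symm ((extChartAt (𝓡 m) x).map_source hq))
  rwa [(extChartAt (𝓡 m) x).left_inv hq]

theorem contMDiffAt_comp_chart {F : Type*} [NormedAddCommGroup F] [NormedSpace ℝ F]
    {g : EuclideanSpace ℝ (Fin m) → F} (hq : q ∈ (extChartAt (𝓡 m) x).source)
    (hg : ContDiffAt ℝ ∞ g (extChartAt (𝓡 m) x q)) :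
    ContMDiffAt (𝓡 m) 𝓘(ℝ, F) ∞ (g ∘ extChartAt (𝓡 m) x) q :=
  ContMDiffAt.comp q (contMDiffAt_iff_contDiffAt.2 hg)
    (contMDiffAt_extChartAt' (by rwa [extChartAt_source] at hq))

theorem OneForm.rep_coords (α : OneForm m M) (Y : VField m M)
    (hq : q ∈ (extChartAt (𝓡 m) x).source) :
    α.rep x (extChartAt (𝓡 m) x q) (Y.coords x q) = α q (Y q) := by
  rw [α.rep_chart hq, coordField_coords Y hq]

theorem OneForm.SmoothOn.apply {α : OneForm m M} {Y : VField m M} {V : Set M}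
    (hα : α.SmoothOn V) (hY : Y.SmoothOn V) (hV : IsOpen V) :
    SmoothFunOn (m := m) V (fun p => α p (Y p)) := by
  intro p hp
  have hps := mem_extChartAt_source (I := 𝓡 m) p
  have h1 := contMDiffAt_comp_chart hps (hα.rep hV hp hps)
  have h2 := hY.coords hV hp hps
  refine ((h1.clm_apply h2).congr_of_eventuallyEq ?_).contMDiffWithinAt
  filter_upwards [extChartAt_source_mem_nhds (I := 𝓡 m) p] with q hq
  exact (α.rep_coords Y hq).symm

/-- It suffices to test on the constant coordinate fields of each chart. They are smooth only on the
chart domain, hence the quantification over open `W ⊆ V`. -/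
theorem OneForm.smoothOn_of_apply {α : OneForm m M} {V : Set M} (hV : IsOpen V)
    (h : ∀ (Z : VField m M) (W : Set M), IsOpen W → W ⊆ V → Z.SmoothOn W →
      SmoothFunOn (m := m) W (fun p => α p (Z p))) : α.SmoothOn V := by
  intro x
  rw [contDiffOn_clm_apply]
  rintro v y ⟨hy, hyV⟩
  set q := (extChartAt (𝓡 m) x).symm y with hq
  have hqs : q ∈ (extChartAt (𝓡 m) x).source := (extChartAt (𝓡 m) x).map_target hy
  have hyq : extChartAt (𝓡 m) x q = y := (extChartAt (𝓡 m) x).right_inv hy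
  have hopen : IsOpen (V ∩ (extChartAt (𝓡 m) x).source) := hV.inter (isOpen_extChartAt_source x)
  have h1 := (h (coordField x v) _ hopen Set.inter_subset_left
    ((smoothOn_coordField x v).mono Set.inter_subset_right)).at hopen ⟨hyV, hqs⟩
  have h2 := contDiffAt_comp_symm hqs h1
  rw [hyq] at h2
  refine (h2.congr_of_eventuallyEq ?_).contDiffWithinAt
  filter_upwards [(isOpen_extChartAt_target x).mem_nhds hy] with z hz
  have h3 := α.rep_chart ((extChartAt (𝓡 m) x).map_target hz) v
  rwa [(extChartAt (𝓡 m) x).right_inv hz] at h3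

end Charts

/-! ### Lie brackets, differentials and exterior derivatives in a chart -/

section Calculus

variable {m : ℕ} {M : Type*} [TopologicalSpace M] [ChartedSpace (EuclideanSpace ℝ (Fin m)) M]
  {x q : M}

theorem two_le_infty : (2 : WithTop ℕ∞) ≤ ∞ := ENat.LEInfty.out

/-- The coordinates of a vector field in the chart at `x`, as a function on the chart target. -/
def VField.rep (Y : VField m M) (x : M) : EuclideanSpace ℝ (Fin m) → EuclideanSpace ℝ (Fin m) :=
  Y.coords x ∘ (extChartAt (𝓡 m) x).symm

theorem VField.rep_chart (Y : VField m M) (hq : q ∈ (extChartAt (𝓡 m) x).source) :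
    Y.rep x (extChartAt (𝓡 m) x q) = chartD x q (Y q) := by
  rw [VField.rep, Function.comp_apply, (extChartAt (𝓡 m) x).left_inv hq]
  rfl

theorem extd_apply (α : OneForm m M) (p : M) (u v : TangentSpace (𝓡 m) p) :
    α.extd p u v = fderiv ℝ (α.rep p) (extChartAt (𝓡 m) p p) (chartD p p u) (chartD p p v) -
      fderiv ℝ (α.rep p) (extChartAt (𝓡 m) p p) (chartD p p v) (chartD p p u) := rfl

variable [IsManifold (𝓡 m) ∞ M]

theorem isManifold_minSmoothness (k : ℕ) : IsManifold (𝓡 m) (minSmoothness ℝ k) M := by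
  rw [minSmoothness_of_isRCLikeNormedField]
  exact IsManifold.of_le (n := ∞) (by exact_mod_cast le_top)

theorem VField.SmoothOn.rep {Y : VField m M} {V : Set M} (h : Y.SmoothOn V) (hV : IsOpen V)
    {p : M} (hp : p ∈ V) (hx : p ∈ (extChartAt (𝓡 m) x).source) :
    ContDiffAt ℝ ∞ (Y.rep x) (extChartAt (𝓡 m) x p) :=
  contDiffAt_comp_symm hx (h.coords hV hp hx)

theorem OneForm.rep_vrep (α : OneForm m M) (Y : VField m M) {y : EuclideanSpace ℝ (Fin m)}
    (hy : y ∈ (extChartAt (𝓡 m) x).target) :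
    α.rep x y (Y.rep x y) = α ((extChartAt (𝓡 m) x).symm y) (Y ((extChartAt (𝓡 m) x).symm y)) := by
  have h := α.rep_coords Y ((extChartAt (𝓡 m) x).map_target hy)
  rwa [(extChartAt (𝓡 m) x).right_inv hy] at h

/-- Lie brackets are natural under pullback by the inverse chart, which turns each field into its
representative; in the model space the bracket is the usual one. -/
theorem chartD_mlieBracket {X Y : VField m M} {V : Set M} (hV : IsOpen V) (hX : X.SmoothOn V)
    (hY : Y.SmoothOn V) (hqV : q ∈ V) (hq : q ∈ (extChartAt (𝓡 m) x).source) :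
    chartD x q (VectorField.mlieBracket (𝓡 m) X Y q) =
      fderiv ℝ (Y.rep x) (extChartAt (𝓡 m) x q) (X.rep x (extChartAt (𝓡 m) x q)) -
      fderiv ℝ (X.rep x) (extChartAt (𝓡 m) x q) (Y.rep x (extChartAt (𝓡 m) x q)) := by
  have hM : IsManifold (𝓡 m) (minSmoothness ℝ 2) M := isManifold_minSmoothness 2
  set y := extChartAt (𝓡 m) x q with hy
  have hyt : y ∈ (extChartAt (𝓡 m) x).target := (extChartAt (𝓡 m) x).map_source hq
  have hyq : (extChartAt (𝓡 m) x).symm y = q := (extChartAt (𝓡 m) x).left_inv hq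
  have hpull : ∀ Z : VField m M, ∀ z ∈ (extChartAt (𝓡 m) x).target,
      VectorField.mpullback 𝓘(ℝ, EuclideanSpace ℝ (Fin m)) (𝓡 m) (extChartAt (𝓡 m) x).symm Z z =
        Z.rep x z := by
    intro Z z hz
    have h1 := mfderivWithin_extChartAt_symm_comp_mfderiv_extChartAt (I := 𝓡 m) hz
    have h2 := mfderiv_extChartAt_comp_mfderivWithin_extChartAt_symm (I := 𝓡 m) hz
    rw [ModelWithCorners.range_eq_univ, mfderivWithin_univ] at h1 h2
    rw [VectorField.mpullback_apply, ContinuousLinearMap.inverse_eq h1 h2]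
    rfl
  have hdiff : ∀ Z : VField m M, Z.SmoothOn V → MDifferentiableAt (𝓡 m) (𝓡 m).tangent
      (fun p => (⟨p, Z p⟩ : TangentBundle (𝓡 m) M)) ((extChartAt (𝓡 m) x).symm y) := by
    intro Z hZ
    rw [hyq]
    exact (hZ.at hV hqV).mdifferentiableAt (by simp)
  have key := VectorField.mpullback_mlieBracket (n := ∞) (hdiff X hX) (hdiff Y hY)
    (contMDiffAt_extChartAt_symm hyt) (by
      rw [minSmoothness_of_isRCLikeNormedField]; exact two_le_infty)
  rw [hpull _ _ hyt] at key
  have hev : ∀ Z : VField m M, VectorField.mpullback 𝓘(ℝ, EuclideanSpace ℝ (Fin m)) (𝓡 m)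
      (extChartAt (𝓡 m) x).symm Z =ᶠ[𝓝 y] Z.rep x := fun Z => by
    filter_upwards [(isOpen_extChartAt_target x).mem_nhds hyt] with z hz
    exact hpull Z z hz
  have h3 := (hev X).mlieBracket_vectorField_eq (hev Y)
  have h5 : ∀ A B : EuclideanSpace ℝ (Fin m) → EuclideanSpace ℝ (Fin m),
      VectorField.mlieBracket 𝓘(ℝ, EuclideanSpace ℝ (Fin m)) A B =
        VectorField.lieBracket ℝ A B := fun A B =>
    (VectorField.mlieBracketWithin_eq_lieBracketWithin (V := A) (W := B)
      (s := Set.univ)).trans VectorField.lieBracketWithin_univ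
  have h4 := (key.trans h3).trans (congrFun (h5 (X.rep x) (Y.rep x)) y)
  rw [VField.rep_chart _ hq] at h4
  exact h4

theorem VField.SmoothOn.mlieBracket {X Y : VField m M} {V : Set M} (hV : IsOpen V)
    (hX : X.SmoothOn V) (hY : Y.SmoothOn V) :
    VField.SmoothOn V (VectorField.mlieBracket (𝓡 m) X Y) := by
  intro p hp
  have hM : IsManifold (𝓡 m) (minSmoothness ℝ 2) M := isManifold_minSmoothness 2
  have : IsManifold (𝓡 m) ((⊤ : ℕ∞) + 1) M := by
    rw [show (((⊤ : ℕ∞) : WithTop ℕ∞) + 1) = ∞ from rfl]; infer_instance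
  exact (ContMDiffAt.mlieBracket_vectorField (m := ⊤) (n := ⊤) (hX.at hV hp) (hY.at hV hp)
    (by simp)).contMDiffWithinAt

theorem diff_apply_chart {f : M → ℝ} (hf : ContMDiffAt (𝓡 m) 𝓘(ℝ, ℝ) ∞ f q)
    (hq : q ∈ (extChartAt (𝓡 m) x).source) (v : TangentSpace (𝓡 m) q) :
    diff (m := m) f q v =
      fderiv ℝ (f ∘ (extChartAt (𝓡 m) x).symm) (extChartAt (𝓡 m) x q) (chartD x q v) := by
  have h1 := (contDiffAt_comp_symm hq hf).differentiableAt (by simp)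
  have h2 : MDifferentiableAt (𝓡 m) 𝓘(ℝ, EuclideanSpace ℝ (Fin m)) (extChartAt (𝓡 m) x) q :=
    mdifferentiableAt_extChartAt (by rwa [extChartAt_source] at hq)
  have h3 := (h1.hasFDerivAt.hasMFDerivAt).comp q h2.hasMFDerivAt
  have h4 : HasMFDerivAt (𝓡 m) 𝓘(ℝ, ℝ) f q _ := h3.congr_of_eventuallyEq (by
    filter_upwards [(isOpen_extChartAt_source (I := 𝓡 m) x).mem_nhds hq] with p hp
    simp only [Function.comp_apply]
    rw [(extChartAt (𝓡 m) x).left_inv hp])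
  exact DFunLike.congr_fun h4.mfderiv v

theorem diff_rep_eventuallyEq {f : M → ℝ} {V : Set M} (hV : IsOpen V)
    (hf : SmoothFunOn (m := m) V f) (hqV : q ∈ V) (hq : q ∈ (extChartAt (𝓡 m) x).source) :
    (diff f).rep x =ᶠ[𝓝 (extChartAt (𝓡 m) x q)] fderiv ℝ (f ∘ (extChartAt (𝓡 m) x).symm) := by
  have ho : IsOpen ((extChartAt (𝓡 m) x).target ∩ (extChartAt (𝓡 m) x).symm ⁻¹' V) :=
    (continuousOn_extChartAt_symm x).isOpen_inter_preimage (isOpen_extChartAt_target x) hV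
  have hmem : extChartAt (𝓡 m) x q ∈
      (extChartAt (𝓡 m) x).target ∩ (extChartAt (𝓡 m) x).symm ⁻¹' V := by
    refine ⟨(extChartAt (𝓡 m) x).map_source hq, ?_⟩
    rwa [Set.mem_preimage, (extChartAt (𝓡 m) x).left_inv hq]
  filter_upwards [ho.mem_nhds hmem] with y hy
  have hys := (extChartAt (𝓡 m) x).map_target hy.1
  refine ContinuousLinearMap.ext fun v => ?_
  have h1 := (diff f).rep_chart hys v
  have h2 := diff_apply_chart (hf.at hV hy.2) hys (coordField x v _)
  have h3 : chartD x _ (coordField x v ((extChartAt (𝓡 m) x).symm y)) = v :=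
    coords_coordField hys v
  rw [h2, (extChartAt (𝓡 m) x).right_inv hy.1, h3] at h1
  exact h1

theorem SmoothFunOn.diff {f : M → ℝ} {V : Set M} (hV : IsOpen V)
    (hf : SmoothFunOn (m := m) V f) : (diff (m := m) f).SmoothOn V := by
  rintro x y ⟨hy, hyV⟩
  have hys := (extChartAt (𝓡 m) x).map_target hy
  have h1 := diff_rep_eventuallyEq hV hf hyV hys
  have h2 := contDiffAt_comp_symm hys (hf.at hV hyV)
  rw [(extChartAt (𝓡 m) x).right_inv hy] at h1 h2
  exact ((h2.fderiv_right (m := ∞) (by simp)).congr_of_eventuallyEq h1).contDiffWithinAt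

/-- The invariant formula `dα(X, Y) = X(α(Y)) - Y(α(X)) - α([X, Y])`. -/
theorem extd_eq {α : OneForm m M} {X Y : VField m M} {V : Set M} (hV : IsOpen V)
    (hα : α.SmoothOn V) (hX : X.SmoothOn V) (hY : Y.SmoothOn V) {p : M} (hp : p ∈ V) :
    α.extd p (X p) (Y p) = diff (m := m) (fun q => α q (Y q)) p (X p) -
      diff (m := m) (fun q => α q (X q)) p (Y p) - α p (VectorField.mlieBracket (𝓡 m) X Y p) := by
  have hps := mem_extChartAt_source (I := 𝓡 m) p
  set y := extChartAt (𝓡 m) p p with hy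
  have hyt : y ∈ (extChartAt (𝓡 m) p).target := (extChartAt (𝓡 m) p).map_source hps
  have hd : ∀ Y Z : VField m M, Y.SmoothOn V → diff (m := m) (fun q => α q (Y q)) p (Z p) =
      fderiv ℝ (α.rep p) y (Z.rep p y) (Y.rep p y) +
        α.rep p y (fderiv ℝ (Y.rep p) y (Z.rep p y)) := by
    intro Y Z hY
    rw [diff_apply_chart ((hα.apply hY hV).at hV hp) hps, ← hy]
    have h1 : (fun q => α q (Y q)) ∘ (extChartAt (𝓡 m) p).symm =ᶠ[𝓝 y]
        fun z => α.rep p z (Y.rep p z) := by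
      filter_upwards [(isOpen_extChartAt_target p).mem_nhds hyt] with z hz
      exact (α.rep_vrep Y hz).symm
    have h2 := ((hα.rep hV hp hps).differentiableAt (by simp)).hasFDerivAt.clm_apply
      ((hY.rep hV hp hps).differentiableAt (by simp)).hasFDerivAt
    rw [h1.fderiv_eq, h2.fderiv, Z.rep_chart hps, add_comm]
    rfl
  have hb : α p (VectorField.mlieBracket (𝓡 m) X Y p) =
      α.rep p y (chartD p p (VectorField.mlieBracket (𝓡 m) X Y p)) :=
    (α.rep_coords _ hps).symm
  rw [hd Y X hY, hd X Y hX, hb, chartD_mlieBracket hV hX hY hp hps, map_sub, extd_apply,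
    ← VField.rep_chart _ hps, ← VField.rep_chart _ hps]
  abel

theorem extd_diff {f : M → ℝ} {V : Set M} (hV : IsOpen V) (hf : SmoothFunOn (m := m) V f)
    {p : M} (hp : p ∈ V) (u v : TangentSpace (𝓡 m) p) : (diff (m := m) f).extd p u v = 0 := by
  have hps := mem_extChartAt_source (I := 𝓡 m) p
  rw [extd_apply, (diff_rep_eventuallyEq hV hf hp hps).fderiv_eq, sub_eq_zero]
  have h := (contDiffAt_comp_symm hps (hf.at hV hp)).isSymmSndFDerivAt (by
    rw [minSmoothness_of_isRCLikeNormedField]; exact two_le_infty)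
  exact h _ _

theorem diff_mlieBracket {f : M → ℝ} {X Y : VField m M} {V : Set M} (hV : IsOpen V)
    (hf : SmoothFunOn (m := m) V f) (hX : X.SmoothOn V) (hY : Y.SmoothOn V) {p : M} (hp : p ∈ V) :
    diff (m := m) f p (VectorField.mlieBracket (𝓡 m) X Y p) =
      diff (m := m) (fun q => diff (m := m) f q (Y q)) p (X p) -
      diff (m := m) (fun q => diff (m := m) f q (X q)) p (Y p) := by
  have h := extd_eq hV (hf.diff hV) hX hY hp
  rw [extd_diff hV hf hp] at h
  linarith

end Calculus

/-! ### Frames, coframes and top-degree forms -/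

section Frames

variable {m : ℕ} {M : Type*} [TopologicalSpace M] [ChartedSpace (EuclideanSpace ℝ (Fin m)) M]
  {x q : M}

instance (p : M) : T2Space (TangentSpace (𝓡 m) p) :=
  inferInstanceAs (T2Space (EuclideanSpace ℝ (Fin m)))

instance (p : M) : FiniteDimensional ℝ (TangentSpace (𝓡 m) p) :=
  inferInstanceAs (FiniteDimensional ℝ (EuclideanSpace ℝ (Fin m)))

theorem finrank_tangentSpace (p : M) : Module.finrank ℝ (TangentSpace (𝓡 m) p) = m :=
  finrank_euclideanSpace_fin (𝕜 := ℝ) (n := m)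

/-- The linear combinations of the fields `e i` at `p`, as a linear map. -/
def frameMap (e : Fin m → VField m M) (p : M) : (Fin m → ℝ) →L[ℝ] TangentSpace (𝓡 m) p :=
  ∑ i, (ContinuousLinearMap.proj (R := ℝ) (φ := fun _ : Fin m => ℝ) i).smulRight (e i p)

theorem frameMap_apply (e : Fin m → VField m M) (p : M) (a : Fin m → ℝ) :
    frameMap e p a = ∑ i, a i • e i p := by
  simp [frameMap]

/-- The coframe dual to the frame `e`. -/
def dualForm (e : Fin m → VField m M) (i : Fin m) : OneForm m M := fun p =>
  (ContinuousLinearMap.proj (R := ℝ) (φ := fun _ : Fin m => ℝ) i).comp (frameMap e p).inverse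

theorem isInvertible_of_injective {E F : Type*} [AddCommGroup E] [Module ℝ E]
    [TopologicalSpace E] [IsTopologicalAddGroup E] [ContinuousSMul ℝ E] [T2Space E]
    [FiniteDimensional ℝ E] [AddCommGroup F] [Module ℝ F] [TopologicalSpace F]
    [IsTopologicalAddGroup F] [ContinuousSMul ℝ F] [T2Space F] [FiniteDimensional ℝ F]
    {L : E →L[ℝ] F} (hL : Function.Injective L)
    (h : Module.finrank ℝ E = Module.finrank ℝ F) : L.IsInvertible :=
  ⟨(L.toLinearMap.linearEquivOfInjective hL h).toContinuousLinearEquiv,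
    ContinuousLinearMap.ext fun _ => rfl⟩

theorem frameMap_injective {e : Fin m → VField m M} {p : M}
    (he : LinearIndependent ℝ fun i => e i p) : Function.Injective (frameMap e p) := by
  rw [injective_iff_map_eq_zero]
  intro a ha
  rw [frameMap_apply] at ha
  exact funext (Fintype.linearIndependent_iff.1 he a ha)

theorem frameMap_isInvertible {e : Fin m → VField m M} {p : M}
    (he : LinearIndependent ℝ fun i => e i p) : (frameMap e p).IsInvertible :=
  isInvertible_of_injective (frameMap_injective he) (by
    rw [finrank_tangentSpace, Module.finrank_fin_fun])

theorem sum_dualForm {e : Fin m → VField m M} {p : M}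
    (he : LinearIndependent ℝ fun i => e i p) (v : TangentSpace (𝓡 m) p) :
    ∑ i, dualForm e i p v • e i p = v := by
  have h := (frameMap_isInvertible he).self_apply_inverse v
  rwa [frameMap_apply] at h

theorem dualForm_apply {e : Fin m → VField m M} {p : M}
    (he : LinearIndependent ℝ fun i => e i p) (i j : Fin m) :
    dualForm e i p (e j p) = if i = j then 1 else 0 := by
  have h1 : frameMap e p (Pi.single j 1) = e j p := by
    rw [frameMap_apply, Finset.sum_eq_single j]
    · simp
    · intro k _ hk; simp [hk]
    · simp
  have h := (frameMap_isInvertible he).inverse_apply_self (Pi.single j 1)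
  rw [h1] at h
  change (frameMap e p).inverse (e j p) i = _
  rw [h, Pi.single_apply]

theorem TopForm.rep_chart (Ω : TopForm m M) (hq : q ∈ (extChartAt (𝓡 m) x).source)
    (v : Fin m → EuclideanSpace ℝ (Fin m)) :
    Ω.rep x (extChartAt (𝓡 m) x q) v = Ω q fun i => coordField x (v i) q := by
  have : ∀ q', q' = q → Ω q' (fun i => mfderiv 𝓘(ℝ, EuclideanSpace ℝ (Fin m)) (𝓡 m)
      (extChartAt (𝓡 m) x).symm (extChartAt (𝓡 m) x q) (v i)) =
        Ω q fun i => coordField x (v i) q := by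
    rintro _ rfl; rfl
  exact this _ ((extChartAt (𝓡 m) x).left_inv hq)

variable [IsManifold (𝓡 m) ∞ M]

theorem smoothOn_of_rep {Z : VField m M} {V : Set M}
    (h : ∀ p ∈ V, ContDiffAt ℝ ∞ (Z.rep p) (extChartAt (𝓡 m) p p)) : Z.SmoothOn V := by
  intro p hp
  have hps := mem_extChartAt_source (I := 𝓡 m) p
  refine ((smoothAt_iff_coords _ hps).2 ?_).contMDiffWithinAt
  refine (contMDiffAt_comp_chart hps (h p hp)).congr_of_eventuallyEq ?_
  filter_upwards [extChartAt_source_mem_nhds (I := 𝓡 m) p] with q hq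
  exact (Z.rep_chart hq).symm

/-- A vector field with smooth coefficients against a smooth coframe is smooth. -/
theorem smoothOn_of_coframe {β : Fin m → OneForm m M} {Z : VField m M} {V : Set M}
    (hV : IsOpen V) (hβ : ∀ i, (β i).SmoothOn V)
    (hinj : ∀ p ∈ V, ∀ v, (∀ i, β i p v = 0) → v = 0)
    (hZ : ∀ i, SmoothFunOn (m := m) V fun p => β i p (Z p)) : Z.SmoothOn V := by
  refine smoothOn_of_rep fun p hp => ?_
  have hps := mem_extChartAt_source (I := 𝓡 m) p
  set y₀ := extChartAt (𝓡 m) p p with hy₀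
  -- The coframe in the chart is assembled into one invertible operator `L y`; the field is `(L
  -- y)⁻¹` applied to its smooth coefficients, and operator inversion is smooth.
  let L : EuclideanSpace ℝ (Fin m) → EuclideanSpace ℝ (Fin m) →L[ℝ] (Fin m → ℝ) := fun y =>
    ∑ i, (ContinuousLinearMap.single ℝ (fun _ : Fin m => ℝ) i).comp ((β i).rep p y)
  have hL : ∀ y v i, L y v i = (β i).rep p y v := by
    intro y v i
    simp only [L, sum_apply, Finset.sum_apply]
    rw [Finset.sum_eq_single i]
    · simp
    · intro j _ hj; simp [hj.symm]
    · simp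
  have hLs : ContDiffAt ℝ ∞ L y₀ :=
    ContDiffAt.sum fun i _ => contDiffAt_const.clm_comp ((hβ i).rep hV hp hps)
  have hopen : IsOpen ((extChartAt (𝓡 m) p).target ∩ (extChartAt (𝓡 m) p).symm ⁻¹' V) :=
    (continuousOn_extChartAt_symm p).isOpen_inter_preimage (isOpen_extChartAt_target p) hV
  have hmem : y₀ ∈ (extChartAt (𝓡 m) p).target ∩ (extChartAt (𝓡 m) p).symm ⁻¹' V := by
    refine ⟨(extChartAt (𝓡 m) p).map_source hps, ?_⟩
    rwa [Set.mem_preimage, (extChartAt (𝓡 m) p).left_inv hps]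
  have hinv : ∀ y ∈ (extChartAt (𝓡 m) p).target ∩ (extChartAt (𝓡 m) p).symm ⁻¹' V,
      (L y).IsInvertible := by
    intro y hy
    refine isInvertible_of_injective ?_ (by simp)
    rw [injective_iff_map_eq_zero]
    intro v hv
    have hs := (extChartAt (𝓡 m) p).map_target hy.1
    have h1 := hinj _ hy.2 (coordField p v _) fun i => by
      rw [← (β i).rep_chart hs, (extChartAt (𝓡 m) p).right_inv hy.1, ← hL, hv]
      rfl
    have h2 := chartD_chartDInv hs v
    rw [← h2]
    change chartD p _ (coordField p v _) = 0
    rw [h1, map_zero]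
  let g : EuclideanSpace ℝ (Fin m) → Fin m → ℝ := fun y i =>
    ((fun p => β i p (Z p)) ∘ (extChartAt (𝓡 m) p).symm) y
  have hg : ContDiffAt ℝ ∞ g y₀ := contDiffAt_pi.2 fun i =>
    contDiffAt_comp_symm hps ((hZ i).at hV hp)
  have hLinv : ContDiffAt ℝ ∞ (fun y => (L y).inverse) y₀ := by
    obtain ⟨A, hA⟩ := hinv y₀ hmem
    refine ContDiffAt.comp (g := ContinuousLinearMap.inverse) y₀ ?_ hLs
    rw [← hA]; exact contDiffAt_map_inverse A
  refine (hLinv.clm_apply hg).congr_of_eventuallyEq ?_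
  filter_upwards [hopen.mem_nhds hmem] with y hy
  have h1 : L y (Z.rep p y) = g y := funext fun i => by
    rw [hL, (β i).rep_vrep Z hy.1]; rfl
  rw [← h1, (hinv y hy).inverse_apply_self]

/-- In a chart the dual coframe is the inverse of the frame operator, and inversion is smooth at
invertible operators. -/
theorem smoothOn_dualForm {e : Fin m → VField m M} {V : Set M} (hV : IsOpen V)
    (he : ∀ i, (e i).SmoothOn V) (hind : ∀ p ∈ V, LinearIndependent ℝ fun i => e i p)
    (i : Fin m) : (dualForm e i).SmoothOn V := by
  refine OneForm.smoothOn_of_apply hV fun Z W hW hWV hZ p hp => ?_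
  have hps := mem_extChartAt_source (I := 𝓡 m) p
  set y₀ := extChartAt (𝓡 m) p p with hy₀
  let A : EuclideanSpace ℝ (Fin m) → (Fin m → ℝ) →L[ℝ] EuclideanSpace ℝ (Fin m) := fun y =>
    ∑ i, (ContinuousLinearMap.proj (R := ℝ) (φ := fun _ : Fin m => ℝ) i).smulRight
      ((e i).rep p y)
  have hAs : ContDiffAt ℝ ∞ A y₀ :=
    ContDiffAt.sum fun i _ => contDiffAt_const.smulRight ((he i).rep hV (hWV hp) hps)
  have hAe : ∀ q ∈ (extChartAt (𝓡 m) p).source,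
      A (extChartAt (𝓡 m) p q) = (chartD p q).comp (frameMap e q) := by
    intro q hq
    refine ContinuousLinearMap.ext fun a => ?_
    simp only [A, sum_apply, ContinuousLinearMap.smulRight_apply,
      ContinuousLinearMap.proj_apply, VField.rep_chart _ hq, ContinuousLinearMap.comp_apply,
      frameMap_apply, map_sum, map_smul]
  have hinv : ∀ q ∈ V ∩ (extChartAt (𝓡 m) p).source,
      (A (extChartAt (𝓡 m) p q)).IsInvertible := by
    intro q hq
    rw [hAe q hq.2]
    exact ContinuousLinearMap.IsInvertible.comp ⟨chartEquiv hq.2, rfl⟩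
      (frameMap_isInvertible (hind q hq.1))
  have hAinv : ContDiffAt ℝ ∞ (fun y => (A y).inverse) y₀ := by
    obtain ⟨B, hB⟩ := hinv p ⟨hWV hp, hps⟩
    refine ContDiffAt.comp (g := ContinuousLinearMap.inverse) y₀ ?_ hAs
    rw [← hB]; exact contDiffAt_map_inverse B
  have h1 : ContDiffAt ℝ ∞ (fun y => (A y).inverse (Z.rep p y) i) y₀ :=
    contDiffAt_pi.1 (hAinv.clm_apply (hZ.rep hW hp hps)) i
  refine ((contMDiffAt_comp_chart hps h1).congr_of_eventuallyEq ?_).contMDiffWithinAt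
  filter_upwards [extChartAt_source_mem_nhds (I := 𝓡 m) p, hV.mem_nhds (hWV hp)] with q hq hqV
  change (frameMap e q).inverse (Z q) i =
    (A (extChartAt (𝓡 m) p q)).inverse (Z.rep p (extChartAt (𝓡 m) p q)) i
  have h2 : A (extChartAt (𝓡 m) p q) ((frameMap e q).inverse (Z q)) =
      Z.rep p (extChartAt (𝓡 m) p q) := by
    rw [hAe q hq, Z.rep_chart hq, ContinuousLinearMap.comp_apply,
      (frameMap_isInvertible (hind q hqV)).self_apply_inverse]
  rw [← h2, (hinv q ⟨hqV, hq⟩).inverse_apply_self]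

theorem contDiffAt_basis_det {y₀ : EuclideanSpace ℝ (Fin m)}
    {v : Fin m → EuclideanSpace ℝ (Fin m) → EuclideanSpace ℝ (Fin m)}
    (hv : ∀ i, ContDiffAt ℝ ∞ (v i) y₀) :
    ContDiffAt ℝ ∞ (fun y => (EuclideanSpace.basisFun (Fin m) ℝ).toBasis.det fun i => v i y)
      y₀ := by
  simp only [Module.Basis.det_apply, Matrix.det_apply]
  refine ContDiffAt.sum fun σ _ => ContDiffAt.const_smul _ (contDiffAt_prod fun i _ => ?_)
  exact (EuclideanSpace.proj (𝕜 := ℝ) (σ i)).contDiff.contDiffAt.comp y₀ (hv i)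

/-- A top-degree form is its value on a basis times the determinant, so only smooth functions and a
polynomial in the components of the fields occur. -/
theorem TopForm.IsVolumeOn.apply {Ω : TopForm m M} {V : Set M} (hV : IsOpen V)
    (hΩ : Ω.IsVolumeOn V) {Y : Fin m → VField m M} (hY : ∀ i, (Y i).SmoothOn V) :
    SmoothFunOn (m := m) V fun p => Ω p fun i => Y i p := by
  intro p hp
  have hps := mem_extChartAt_source (I := 𝓡 m) p
  set y₀ := extChartAt (𝓡 m) p p with hy₀
  let b := (EuclideanSpace.basisFun (Fin m) ℝ).toBasis
  have hrep : ContDiffAt ℝ ∞ (Ω.rep p) y₀ := by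
    refine (hΩ.smooth p).contDiffAt (((continuousOn_extChartAt_symm p).isOpen_inter_preimage
      (isOpen_extChartAt_target p) hV).mem_nhds ⟨(extChartAt (𝓡 m) p).map_source hps, ?_⟩)
    rwa [Set.mem_preimage, (extChartAt (𝓡 m) p).left_inv hps]
  have h1 : ContDiffAt ℝ ∞ (fun y => Ω.rep p y b) y₀ :=
    (ContinuousAlternatingMap.apply ℝ (EuclideanSpace ℝ (Fin m)) ℝ b).contDiff.contDiffAt.comp
      y₀ hrep
  have h2 := h1.mul (contDiffAt_basis_det fun i => (hY i).rep hV hp hps)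
  refine ((contMDiffAt_comp_chart hps h2).congr_of_eventuallyEq ?_).contMDiffWithinAt
  filter_upwards [extChartAt_source_mem_nhds (I := 𝓡 m) p] with q hq
  have h3 := Ω.rep_chart hq fun i => (Y i).rep p (extChartAt (𝓡 m) p q)
  have h4 : ∀ i, coordField p ((Y i).rep p (extChartAt (𝓡 m) p q)) q = Y i q := fun i => by
    rw [VField.rep_chart _ hq]; exact chartDInv_chartD hq _
  simp only [h4] at h3
  rw [← h3]
  have h5 := DFunLike.congr_fun ((Ω.rep p (extChartAt (𝓡 m) p q)).toAlternatingMap.eq_smul_basis_det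
    b) fun i => (Y i).rep p (extChartAt (𝓡 m) p q)
  exact h5

end Frames

/-! ### Flags of involutive distributions spanned by a frame -/

section Flags

theorem bilinear_sum {E F ι κ : Type*} [AddCommGroup E] [Module ℝ E]
    [AddCommGroup F] [Module ℝ F] [Fintype ι] [Fintype κ] (L : E →ₗ[ℝ] E →ₗ[ℝ] F)
    (x : ι → E) (y : κ → E) (α : ι → ℝ) (β : κ → ℝ) :
    L (∑ a, α a • x a) (∑ b, β b • y b) = ∑ a, ∑ b, (α a * β b) • L (x a) (y b) := by
  simp only [map_sum, LinearMap.sum_apply, map_smul, LinearMap.smul_apply, Finset.smul_sum,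
    smul_smul]
  rw [Finset.sum_comm]
  simp only [mul_comm]

variable {m : ℕ} {M : Type*} [TopologicalSpace M] [ChartedSpace (EuclideanSpace ℝ (Fin m)) M]

theorem diff_eq_zero_of_eqOn {f : M → ℝ} {V : Set M} (hV : IsOpen V) {c : ℝ}
    (hf : ∀ q ∈ V, f q = c) {p : M} (hp : p ∈ V) (v : TangentSpace (𝓡 m) p) :
    diff (m := m) f p v = 0 := by
  have h : f =ᶠ[𝓝 p] fun _ => c := by
    filter_upwards [hV.mem_nhds hp] with q hq using hf q hq
  rw [diff, h.mfderiv_eq, mfderiv_const]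
  rfl

theorem diff_congr {f g : M → ℝ} {V : Set M} (hV : IsOpen V)
    (hfg : ∀ q ∈ V, f q = g q) {p : M} (hp : p ∈ V) :
    diff (m := m) f p = diff (m := m) g p := by
  have h : f =ᶠ[𝓝 p] g := by
    filter_upwards [hV.mem_nhds hp] with q hq using hfg q hq
  exact h.mfderiv_eq

theorem dualForm_eq_zero_of_mem_span {e : Fin m → VField m M} {p : M}
    (he : LinearIndependent ℝ fun i => e i p) {ι : Type*} {Y : ι → TangentSpace (𝓡 m) p}
    {c : Fin m} (hY : ∀ i, ∃ a, a ≠ c ∧ Y i = e a p) {v : TangentSpace (𝓡 m) p}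
    (hv : v ∈ Submodule.span ℝ (Set.range Y)) : dualForm e c p v = 0 := by
  have h : Submodule.span ℝ (Set.range Y) ≤ LinearMap.ker (dualForm e c p).toLinearMap := by
    rw [Submodule.span_le]
    rintro _ ⟨i, rfl⟩
    obtain ⟨a, hac, ha⟩ := hY i
    change dualForm e c p (Y i) = 0
    rw [ha, dualForm_apply he, if_neg hac.symm]
  exact h hv

variable [IsManifold (𝓡 m) ∞ M]

/-- A smooth frame on the open set `V` such that every `⟨e_0, …, e_{c-1}⟩` is involutive. -/
structure IsInvolutiveFlag (V : Set M) (e : Fin m → VField m M) : Prop where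
  isOpen : IsOpen V
  smooth : ∀ i, (e i).SmoothOn V
  indep : ∀ p ∈ V, LinearIndependent ℝ fun i => e i p
  bracket : ∀ p ∈ V, ∀ a b c, a < c → b < c →
    dualForm e c p (VectorField.mlieBracket (𝓡 m) (e a) (e b) p) = 0

theorem isInvolutiveFlag_of_mem_span {V : Set M} (hV : IsOpen V) {e : Fin m → VField m M}
    (hs : ∀ i, (e i).SmoothOn V) (hind : ∀ p ∈ V, LinearIndependent ℝ fun i => e i p)
    (hbr : ∀ p ∈ V, ∀ a b, a < b → VectorField.mlieBracket (𝓡 m) (e b) (e a) p ∈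
      Submodule.span ℝ (Set.range fun k : {k : Fin m // k ≤ b} => e k p)) :
    IsInvolutiveFlag V e := by
  refine ⟨hV, hs, hind, fun p hp => ?_⟩
  have key : ∀ a b c, a < b → b < c →
      dualForm e c p (VectorField.mlieBracket (𝓡 m) (e b) (e a) p) = 0 :=
    fun a b c hab hbc => dualForm_eq_zero_of_mem_span (hind p hp)
      (ι := {k : Fin m // k ≤ b}) (Y := fun k => e k p)
      (fun k : {k : Fin m // k ≤ b} => ⟨k, (lt_of_le_of_lt k.2 hbc).ne, rfl⟩) (hbr p hp a b hab)
  intro a b c hac hbc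
  rcases lt_trichotomy a b with hab | rfl | hab
  · rw [VectorField.mlieBracket_swap_apply, map_neg, key a b c hab hbc, neg_zero]
  · rw [VectorField.mlieBracket_self]
    exact map_zero _
  · exact key b a c hab hac

variable {V : Set M} {e : Fin m → VField m M}

theorem IsInvolutiveFlag.smooth_dualForm (he : IsInvolutiveFlag V e) (i : Fin m) :
    (dualForm e i).SmoothOn V := smoothOn_dualForm he.isOpen he.smooth he.indep i

/-- In Cartan's formula `w` vanishes identically on `e_a` and `e_b`, so only `-w([e_a, e_b])`
remains, and involutivity kills it. The factor `g` is never differentiated. -/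
theorem IsInvolutiveFlag.extd_eq_zero (he : IsInvolutiveFlag V e) {w : OneForm m M}
    (hws : w.SmoothOn V) {g : M → ℝ} {c : Fin m}
    (hw : ∀ q ∈ V, ∀ v, w q v = g q * dualForm e c q v) {p : M} (hp : p ∈ V) {a b : Fin m}
    (ha : a < c) (hb : b < c) : w.extd p (e a p) (e b p) = 0 := by
  have h0 : ∀ a, a < c → ∀ q ∈ V, w q (e a q) = 0 := fun a ha q hq => by
    rw [hw q hq, dualForm_apply (he.indep q hq), if_neg ha.ne', mul_zero]
  rw [extd_eq he.isOpen hws (he.smooth a) (he.smooth b) hp,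
    diff_eq_zero_of_eqOn he.isOpen (h0 b hb) hp, diff_eq_zero_of_eqOn he.isOpen (h0 a ha) hp,
    hw p hp, he.bracket p hp a b c ha hb, mul_zero, sub_zero, sub_zero]

/-- `extd` is computed at each point in that point's own chart, so its smoothness is read off from
the invariant formula. -/
theorem smoothOn_extd {w : OneForm m M} {X Y : VField m M} (hV : IsOpen V) (hw : w.SmoothOn V)
    (hX : X.SmoothOn V) (hY : Y.SmoothOn V) :
    SmoothFunOn (m := m) V fun p => w.extd p (X p) (Y p) := by
  have h1 := (SmoothFunOn.diff hV (hw.apply hY hV)).apply hX hV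
  have h2 := (SmoothFunOn.diff hV (hw.apply hX hV)).apply hY hV
  have h3 := hw.apply (VField.SmoothOn.mlieBracket hV hX hY) hV
  refine ContMDiffOn.congr ((ContMDiffOn.sub h1 h2).sub h3) fun p hp => ?_
  rw [extd_eq hV hw hX hY hp]

/-- Cartan's formula reduces the component to `-de^c(e_j, Z)`. This is tensorial, so `Z` may be
expanded in the frame pointwise, with no derivatives of its coefficients. -/
theorem IsInvolutiveFlag.dualForm_mlieBracket (he : IsInvolutiveFlag V e) {Z : VField m M}
    (hZ : Z.SmoothOn V) {j c : Fin m} (hjc : j < c)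
    (hZ0 : ∀ a, j ≤ a → ∀ q ∈ V, dualForm e a q (Z q) = 0) {p : M} (hp : p ∈ V) :
    dualForm e c p (VectorField.mlieBracket (𝓡 m) (e j) Z p) = 0 := by
  have h1 := extd_eq he.isOpen (he.smooth_dualForm c) (he.smooth j) hZ hp
  rw [diff_eq_zero_of_eqOn he.isOpen (hZ0 c hjc.le) hp,
    diff_eq_zero_of_eqOn he.isOpen (c := 0) (fun q hq => by
      rw [dualForm_apply (he.indep q hq), if_neg hjc.ne']) hp] at h1
  have h2 : (dualForm e c).extd p (e j p) (Z p) = 0 := by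
    rw [← sum_dualForm (he.indep p hp) (Z p), map_sum]
    refine Finset.sum_eq_zero fun a _ => ?_
    rw [map_smul]
    rcases lt_or_ge a c with hac | hca
    · rw [he.extd_eq_zero (he.smooth_dualForm c) (g := fun _ => 1) (fun _ _ _ => (one_mul _).symm)
        hp hjc hac, smul_zero]
    · rw [hZ0 a (hjc.le.trans hca) p hp, zero_smul]
  rw [h2] at h1
  linarith

end Flags

/-! ### The `C^∞`-structure given by an involutive flag. -/

section Structure

variable {N : ℕ} {M : Type*} [TopologicalSpace M]
  [ChartedSpace (EuclideanSpace ℝ (Fin (N + 1))) M] [IsManifold (𝓡 (N + 1)) ∞ M]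
  {V : Set M} {e : Fin (N + 1) → VField (N + 1) M}

/-- The fields of an involutive flag form a `C^∞`-structure for the first of them. -/
theorem IsInvolutiveFlag.isCInfStructure (he : IsInvolutiveFlag V e) :
    IsCInfStructure V (fun _ : Fin 1 => e 0) (fun j : Fin N => e j.succ) where
  dim := Nat.add_comm 1 N
  smooth _ := he.smooth 0
  indep p hp := linearIndependent_unique_iff.2 ((he.indep p hp).ne_zero 0)
  symmetry j := by
    have hgen : ∀ (q : M) (i : Fin 1 ⊕ {i : Fin N // i < j}), ∃ a, a < j.succ ∧
        Sum.elim (fun _ : Fin 1 => e 0) (fun i : {i : Fin N // i < j} => e (i : Fin N).succ) i q =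
          e a q := by
      rintro q (i | i)
      · exact ⟨0, j.succ_pos, rfl⟩
      · exact ⟨(i : Fin N).succ, Fin.succ_lt_succ_iff.2 i.2, rfl⟩
    refine ⟨he.smooth _, fun p hp hmem => ?_, fun Z hZ hZm => ?_⟩
    · have h := dualForm_eq_zero_of_mem_span (he.indep p hp) (c := j.succ)
        (fun i => (hgen p i).imp fun a h => ⟨h.1.ne, h.2⟩) hmem
      rw [dualForm_apply (he.indep p hp), if_pos rfl] at h
      exact one_ne_zero h
    · obtain ⟨c, -, hc⟩ := hZm
      have hZ0 : ∀ a, j.succ ≤ a → ∀ q ∈ V, dualForm e a q (Z q) = 0 := fun a ha q hq => by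
        rw [hc q hq, map_sum]
        refine Finset.sum_eq_zero fun i _ => ?_
        obtain ⟨b, hb, hbe⟩ := hgen q i
        rw [hbe, map_smul, dualForm_apply (he.indep q hq), if_neg (hb.trans_le ha).ne', smul_zero]
      have hB := VField.SmoothOn.mlieBracket he.isOpen (he.smooth j.succ) hZ
      have hs := fun a => (he.smooth_dualForm a).apply hB he.isOpen
      -- The coefficients are the components of the bracket in the dual coframe, which are smooth;
      -- those beyond `e_{j+1}` vanish by `dualForm_mlieBracket`.
      refine ⟨fun o q => dualForm e (o.elim j.succ (Sum.elim (fun _ : Fin 1 => 0)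
        fun i : {i : Fin N // i < j} => (i : Fin N).succ)) q
          (VectorField.mlieBracket (𝓡 (N + 1)) (e j.succ) Z q), fun o => hs _, fun p hp => ?_⟩
      set B := VectorField.mlieBracket (𝓡 (N + 1)) (e j.succ) Z p with hBdef
      have hsum := sum_dualForm (he.indep p hp) B
      have hvan : ∀ i : Fin N, j < i → dualForm e i.succ p B = 0 := fun i hi =>
        he.dualForm_mlieBracket hZ (Fin.succ_lt_succ_iff.2 hi) hZ0 hp
      have hsplit : ∑ i : Fin N, dualForm e i.succ p B • e i.succ p =
          dualForm e j.succ p B • e j.succ p +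
            ∑ i : {i : Fin N // i < j}, dualForm e (i : Fin N).succ p B • e (i : Fin N).succ p := by
        have h1 : ∑ i : {i : Fin N // i < j},
            dualForm e (i : Fin N).succ p B • e (i : Fin N).succ p =
              ∑ i ∈ Finset.univ.filter (· < j), dualForm e i.succ p B • e i.succ p :=
          (Finset.sum_subtype _ (by simp) fun i : Fin N =>
            dualForm e i.succ p B • e i.succ p).symm
        have h2 : ∑ i ∈ insert j (Finset.univ.filter (· < j)),
            dualForm e i.succ p B • e i.succ p = _ :=
          Finset.sum_insert (f := fun i : Fin N => dualForm e i.succ p B • e i.succ p) (by simp)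
        rw [h1, ← h2]
        refine (Finset.sum_subset (Finset.subset_univ _) fun i _ hi => ?_).symm
        rw [hvan i, zero_smul]
        simp only [Finset.mem_insert, Finset.mem_filter, Finset.mem_univ, true_and, not_or,
          not_lt] at hi
        exact lt_of_le_of_ne hi.2 (Ne.symm hi.1)
      rw [Fin.sum_univ_succ, hsplit] at hsum
      rw [Fintype.sum_option, Fintype.sum_sum_type]
      simp only [Option.elim, Sum.elim_inl, Sum.elim_inr, Fintype.sum_unique]
      rw [← hsum]
      simp only [← hBdef]
      abel

end Structure

/-! ### First integrals of involutive families of 1-forms -/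

section FirstIntegrals

variable {m : ℕ} {M : Type*} [TopologicalSpace M] [ChartedSpace (EuclideanSpace ℝ (Fin m)) M]
  [IsManifold (𝓡 m) ∞ M] {x q : M}

/-- The exterior derivative of a 1-form can be computed in every chart. -/
theorem extd_chart {α : OneForm m M} {V : Set M} (hV : IsOpen V) (hα : α.SmoothOn V)
    (hqV : q ∈ V) (hq : q ∈ (extChartAt (𝓡 m) x).source) (u v : TangentSpace (𝓡 m) q) :
    α.extd q u v =
      fderiv ℝ (α.rep x) (extChartAt (𝓡 m) x q) (chartD x q u) (chartD x q v) -
      fderiv ℝ (α.rep x) (extChartAt (𝓡 m) x q) (chartD x q v) (chartD x q u) := by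
  set y := extChartAt (𝓡 m) x q with hy
  have hyt : y ∈ (extChartAt (𝓡 m) x).target := (extChartAt (𝓡 m) x).map_source hq
  have hW : IsOpen (V ∩ (extChartAt (𝓡 m) x).source) := hV.inter (isOpen_extChartAt_source x)
  have hqW : q ∈ V ∩ (extChartAt (𝓡 m) x).source := ⟨hqV, hq⟩
  have hαW : α.SmoothOn (V ∩ (extChartAt (𝓡 m) x).source) := fun z =>
    (hα z).mono fun _ h => ⟨h.1, h.2.1⟩
  have hs := fun v => (smoothOn_coordField (m := m) x v).mono
    (Set.inter_subset_right (s := V) (t := (extChartAt (𝓡 m) x).source))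
  have hrep : ∀ v, (coordField (m := m) x v).rep x =ᶠ[𝓝 y] fun _ => v := fun v => by
    filter_upwards [(isOpen_extChartAt_target x).mem_nhds hyt] with z hz
    exact coords_coordField ((extChartAt (𝓡 m) x).map_target hz) v
  have hd : ∀ a b : TangentSpace (𝓡 m) q,
      diff (m := m) (fun p => α p (coordField x (chartD x q b) p)) q a =
        fderiv ℝ (α.rep x) y (chartD x q a) (chartD x q b) := by
    intro a b
    rw [diff_apply_chart ((hαW.apply (hs _) hW).at hW hqW) hq, ← hy]
    have h1 : (fun p => α p (coordField x (chartD x q b) p)) ∘ (extChartAt (𝓡 m) x).symm =ᶠ[𝓝 y]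
        fun z => α.rep x z (chartD x q b) := by
      filter_upwards [(isOpen_extChartAt_target x).mem_nhds hyt, hrep (chartD x q b)] with z hz hz'
      exact (α.rep_vrep _ hz).symm.trans (congrArg (α.rep x z) hz')
    have h2 := (((hα.rep hV hqV hq).differentiableAt (by simp)).hasFDerivAt).clm_apply
      (hasFDerivAt_const (chartD x q b) y)
    rw [h1.fderiv_eq, h2.fderiv, ContinuousLinearMap.comp_zero, zero_add]
    rfl
  -- Fields with constant coordinates commute, so Cartan's formula for them leaves only the two
  -- derivative terms.
  have hbr : VectorField.mlieBracket (𝓡 m) (coordField x (chartD x q u))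
      (coordField x (chartD x q v)) q = 0 := by
    have h := chartD_mlieBracket hW (hs (chartD x q u)) (hs (chartD x q v)) hqW hq
    rw [(hrep _).fderiv_eq, (hrep _).fderiv_eq] at h
    rw [← chartDInv_chartD hq (VectorField.mlieBracket (𝓡 m) _ _ q), h]
    simp
  have h := extd_eq hW hαW (hs (chartD x q u)) (hs (chartD x q v)) hqW
  have hc : ∀ a, coordField x (chartD x q a) q = a := fun a => chartDInv_chartD hq a
  rw [hbr, map_zero, sub_zero, hc, hc, hd, hd] at h
  exact h

/-- Frobenius in the chart at `p`, applied to the single `ℝ^ι`-valued form with components `β i`.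
The vanishing of `dβ_i` on the common kernel is its integrability condition. -/
theorem exists_first_integrals {ι : Type*} [Finite ι] {β : ι → OneForm m M} {V : Set M}
    (hV : IsOpen V) (hβ : ∀ i, (β i).SmoothOn V)
    (hint : ∀ q ∈ V, ∀ u v, (∀ i, β i q u = 0) → (∀ i, β i q v = 0) →
      ∀ i, (β i).extd q u v = 0) {p : M} (hp : p ∈ V)
    (hsurj : Function.Surjective fun v i => β i p v) :
    ∃ J : ι → M → ℝ, (∀ i, diff (m := m) (J i) p = β i p) ∧
      ∃ W, IsOpen W ∧ p ∈ W ∧ W ⊆ V ∧ (∀ i, SmoothFunOn (m := m) W (J i)) ∧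
        ∀ q ∈ W, ∀ v, (∀ i, β i q v = 0) → ∀ i, diff (m := m) (J i) q v = 0 := by
  have := Fintype.ofFinite ι
  classical
  have hps := mem_extChartAt_source (I := 𝓡 m) p
  set y₀ := extChartAt (𝓡 m) p p with hy₀
  let θ : EuclideanSpace ℝ (Fin m) → EuclideanSpace ℝ (Fin m) →L[ℝ] (ι → ℝ) := fun y =>
    ContinuousLinearMap.pi fun i => (β i).rep p y
  have hθs : ∀ q ∈ V ∩ (extChartAt (𝓡 m) p).source,
      ContDiffAt ℝ ∞ θ (extChartAt (𝓡 m) p q) := fun q hq => by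
    have h : θ = fun y => ∑ i, (ContinuousLinearMap.single ℝ (fun _ : ι => ℝ) i).comp
        ((β i).rep p y) := by
      funext y
      refine ContinuousLinearMap.ext fun v => funext fun i => ?_
      simp only [sum_apply, Finset.sum_apply]
      rw [Finset.sum_eq_single i]
      · simp [θ]
      · intro j _ hj; simp [hj.symm]
      · simp
    rw [h]
    exact ContDiffAt.sum fun i _ => contDiffAt_const.clm_comp ((hβ i).rep hV hq.1 hq.2)
  have hθ : ∀ q ∈ (extChartAt (𝓡 m) p).source, ∀ v i,
      θ (extChartAt (𝓡 m) p q) (chartD p q v) i = β i q v := fun q hq v i =>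
    ((β i).rep_chart hq _).trans (congrArg (β i q) (chartDInv_chartD hq v))
  have hθd : ∀ q ∈ V ∩ (extChartAt (𝓡 m) p).source, ∀ u v i,
      fderiv ℝ θ (extChartAt (𝓡 m) p q) u v i =
        fderiv ℝ ((β i).rep p) (extChartAt (𝓡 m) p q) u v := fun q hq u v i => by
    have h1 := (((hθs q hq).differentiableAt (by simp)).hasFDerivAt).clm_apply
      (hasFDerivAt_const v _)
    have h2 := (((hβ i).rep hV hq.1 hq.2).differentiableAt (by simp)).hasFDerivAt.clm_apply
      (hasFDerivAt_const v _)
    have h3 := congrArg (fun L => L u) ((hasFDerivAt_pi'.1 h1 i).unique h2)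
    simpa using h3
  have hmem : ∀ᶠ y in 𝓝 y₀, ∃ q ∈ V ∩ (extChartAt (𝓡 m) p).source,
      extChartAt (𝓡 m) p q = y := by
    have ho : IsOpen ((extChartAt (𝓡 m) p).target ∩ (extChartAt (𝓡 m) p).symm ⁻¹' V) :=
      (continuousOn_extChartAt_symm p).isOpen_inter_preimage (isOpen_extChartAt_target p) hV
    filter_upwards [ho.mem_nhds ⟨(extChartAt (𝓡 m) p).map_source hps, by
      rwa [Set.mem_preimage, (extChartAt (𝓡 m) p).left_inv hps]⟩] with y hy
    exact ⟨_, ⟨hy.2, (extChartAt (𝓡 m) p).map_target hy.1⟩, (extChartAt (𝓡 m) p).right_inv hy.1⟩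
  obtain ⟨J, hJs, hJ0, hJ⟩ := exists_first_integral (θ := θ) (z₀ := y₀)
    (by filter_upwards [hmem] with y ⟨q, hq, hqy⟩; rw [← hqy]; exact hθs q hq)
    (fun c => by
      obtain ⟨v, hv⟩ := hsurj c
      exact ⟨chartD p p v, funext fun i => (hθ p hps v i).trans (congrFun hv i)⟩)
    (by
      filter_upwards [hmem] with y ⟨q, hq, hqy⟩ u v hu hv
      subst hqy
      have hk : ∀ u, θ (extChartAt (𝓡 m) p q) u = 0 → ∀ i, β i q (chartDInv p q u) = 0 :=
        fun u hu i => by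
          rw [← hθ q hq.2, chartD_chartDInv hq.2, hu]; rfl
      refine funext fun i => ?_
      have h := hint q hq.1 _ _ (hk u hu) (hk v hv) i
      rw [extd_chart hV (hβ i) hq.1 hq.2, chartD_chartDInv hq.2, chartD_chartDInv hq.2,
        sub_eq_zero] at h
      rw [hθd q hq, hθd q hq, h])
  have hcont : Filter.Tendsto (extChartAt (𝓡 m) p) (𝓝 p) (𝓝 y₀) :=
    continuousAt_extChartAt (I := 𝓡 m) p
  obtain ⟨W, hWm, hWo, hpW⟩ := eventually_nhds_iff.1 ((hcont.eventually (hJs.and hJ)).and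
    ((hV.eventually_mem hp).and ((isOpen_extChartAt_source (I := 𝓡 m) p).eventually_mem hps)))
  have hJi : ∀ q ∈ W, ∀ i, ContDiffAt ℝ ∞ (fun y => J y i) (extChartAt (𝓡 m) p q) :=
    fun q hq i => contDiffAt_pi.1 (hWm q hq).1.1 i
  have hsm : ∀ q ∈ W, ∀ i, ContMDiffAt (𝓡 m) 𝓘(ℝ, ℝ) ∞ (fun q => J (extChartAt (𝓡 m) p q) i) q :=
    fun q hq i => contMDiffAt_comp_chart (hWm q hq).2.2 (hJi q hq i)
  have hdiff : ∀ q ∈ W, ∀ i v, diff (m := m) (fun q => J (extChartAt (𝓡 m) p q) i) q v =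
      fderiv ℝ J (extChartAt (𝓡 m) p q) (chartD p q v) i := fun q hq i v => by
    have hqs := (hWm q hq).2.2
    have h1 : (fun q => J (extChartAt (𝓡 m) p q) i) ∘ (extChartAt (𝓡 m) p).symm
        =ᶠ[𝓝 (extChartAt (𝓡 m) p q)] fun y => J y i := by
      filter_upwards [(isOpen_extChartAt_target p).mem_nhds
        ((extChartAt (𝓡 m) p).map_source hqs)] with y hy
      simp only [Function.comp_apply]
      rw [(extChartAt (𝓡 m) p).right_inv hy]
    rw [diff_apply_chart (hsm q hq i) hqs, h1.fderiv_eq]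
    have h2 := ((hWm q hq).1.1.differentiableAt (by simp)).hasFDerivAt
    rw [(hasFDerivAt_pi'.1 h2 i).fderiv]
    rfl
  refine ⟨fun i q => J (extChartAt (𝓡 m) p q) i, fun i => ContinuousLinearMap.ext fun v => ?_, W,
    hWo, hpW, fun q hq => (hWm q hq).2.1, fun i q hq => (hsm q hq i).contMDiffWithinAt,
    fun q hq v hv i => ?_⟩
  · rw [hdiff p hpW, ← hy₀, hJ0]
    exact hθ p hps v i
  · rw [hdiff q hq, (hWm q hq).1.2 _ (funext fun i => (hθ q (hWm q hq).2.2 v i).trans (hv i))]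
    rfl

end FirstIntegrals

/-! ### The Pfaffian equations of an involutive flag -/

section Pfaff

/-- Each unordered pair of indices is assigned to its larger member, which is nonzero and hence a
successor. This writes a 2-form as `∑ θ_l ∧ e^{l+1}` with `θ_l` in the span of the `e^a`, `a ≤ l`.
-/
theorem sum_skew {N : ℕ} {D : Fin (N + 1) → Fin (N + 1) → ℝ} (hD : ∀ a b, D a b = -D b a)
    (x y : Fin (N + 1) → ℝ) :
    ∑ a, ∑ b, (x a * y b) * D a b = ∑ l : Fin N,
      ((∑ a, if a < l.succ then D a l.succ * x a else 0) * y l.succ -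
        (∑ a, if a < l.succ then D a l.succ * y a else 0) * x l.succ) := by
  have h1 : ∀ a b, (x a * y b) * D a b = (if a < b then D a b * x a else 0) * y b -
      (if b < a then D b a * y b else 0) * x a := by
    intro a b
    rcases lt_trichotomy a b with h | rfl | h
    · rw [if_pos h, if_neg h.not_gt]; ring
    · have : D a a = 0 := by linarith [hD a a]
      simp [this]
    · rw [if_neg h.not_gt, if_pos h, hD a b]; ring
  have h2 : ∀ x y : Fin (N + 1) → ℝ, ∑ b, ∑ a, (if a < b then D a b * x a else 0) * y b =
      ∑ l : Fin N, (∑ a, if a < l.succ then D a l.succ * x a else 0) * y l.succ := by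
    intro x y
    rw [Fin.sum_univ_succ]
    simp [Finset.sum_mul]
  simp only [h1, Finset.sum_sub_distrib]
  rw [Finset.sum_comm, h2 x y, h2 y x]

variable {N : ℕ} {M : Type*} [TopologicalSpace M]
  [ChartedSpace (EuclideanSpace ℝ (Fin (N + 1))) M] [IsManifold (𝓡 (N + 1)) ∞ M]

/-- The forms `w_i` are multiples `g_i e^{i+1}`, with smooth nowhere zero factors, of the forms
dual to an involutive flag `e_0, …, e_N`. -/
structure IsScaledDual (V : Set M) (e : Fin (N + 1) → VField (N + 1) M) (g : Fin N → M → ℝ)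
    (w : Fin N → OneForm (N + 1) M) : Prop where
  flag : IsInvolutiveFlag V e
  smooth : ∀ i, SmoothFunOn (m := N + 1) V (g i)
  ne_zero : ∀ p ∈ V, ∀ i, g i p ≠ 0
  eq : ∀ p ∈ V, ∀ i v, w i p v = g i p * dualForm e i.succ p v

variable {V : Set M} {e : Fin (N + 1) → VField (N + 1) M} {g : Fin N → M → ℝ}
  {w : Fin N → OneForm (N + 1) M}

namespace IsScaledDual

theorem apply_frame (h : IsScaledDual V e g w) {p : M} (hp : p ∈ V) (i : Fin N)
    (a : Fin (N + 1)) : w i p (e a p) = if i.succ = a then g i p else 0 := by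
  rw [h.eq p hp, dualForm_apply (h.flag.indep p hp), mul_ite, mul_one, mul_zero]

theorem smoothOn (h : IsScaledDual V e g w) (i : Fin N) : (w i).SmoothOn V := by
  refine OneForm.smoothOn_of_apply h.flag.isOpen fun Z W hW hWV hZ => ?_
  have hd : (dualForm e i.succ).SmoothOn W := fun x =>
    (h.flag.smooth_dualForm i.succ x).mono fun _ hy => ⟨hy.1, hWV hy.2⟩
  refine (((h.smooth i).mono hWV).mul (hd.apply hZ hW)).congr fun p hp => ?_
  exact h.eq p (hWV hp) i _

theorem linearIndependent (h : IsScaledDual V e g w) {p : M} (hp : p ∈ V) :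
    LinearIndependent ℝ fun i => w i p := by
  rw [Fintype.linearIndependent_iff]
  intro c hc i
  have h1 := congrArg (fun L => L (e i.succ p)) hc
  simp only [sum_apply, smul_apply, smul_eq_mul, h.apply_frame hp, Fin.succ_inj] at h1
  have h2 : c i * g i p = 0 := by
    rw [Finset.sum_eq_single i] at h1
    · simpa using h1
    · intro j _ hj; simp [hj]
    · simp
  exact (mul_eq_zero.1 h2).resolve_right (h.ne_zero p hp i)

theorem eq_zero_iff (h : IsScaledDual V e g w) {p : M} (hp : p ∈ V) (i : Fin N)
    (v : TangentSpace (𝓡 (N + 1)) p) : w i p v = 0 ↔ dualForm e i.succ p v = 0 := by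
  rw [h.eq p hp, mul_eq_zero, or_iff_right (h.ne_zero p hp i)]

theorem annihilator (h : IsScaledDual V e g w) {p : M} (hp : p ∈ V)
    (v : TangentSpace (𝓡 (N + 1)) p) :
    (∀ i, w i p v = 0) ↔ v ∈ Submodule.span ℝ {e 0 p} := by
  rw [Submodule.mem_span_singleton]
  constructor
  · intro hv
    refine ⟨dualForm e 0 p v, ?_⟩
    have h1 := sum_dualForm (h.flag.indep p hp) v
    rw [Fin.sum_univ_succ, Finset.sum_eq_zero, add_zero] at h1
    · exact h1
    · intro i _
      rw [(h.eq_zero_iff hp i v).1 (hv i), zero_smul]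
  · rintro ⟨c, rfl⟩ i
    rw [map_smul, h.apply_frame hp, if_neg i.succ_ne_zero, smul_zero]

theorem extd_eq_zero (h : IsScaledDual V e g w) {p : M} (hp : p ∈ V) (i : Fin N)
    {a b : Fin (N + 1)} (ha : a < i.succ) (hb : b < i.succ) :
    (w i).extd p (e a p) (e b p) = 0 :=
  h.flag.extd_eq_zero (h.smoothOn i) (g := g i) (fun q hq v => h.eq q hq i v) hp ha hb

theorem extd_eq_sum (h : IsScaledDual V e g w) {p : M} (hp : p ∈ V) (i : Fin N)
    (u v : TangentSpace (𝓡 (N + 1)) p) : (w i).extd p u v =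
      ∑ a, ∑ b, (dualForm e a p u * dualForm e b p v) * (w i).extd p (e a p) (e b p) := by
  have h1 := bilinear_sum (LinearMap.mk₂ ℝ (fun u v => (w i).extd p u v)
    (fun _ _ _ => by simp only [map_add, add_apply])
    (fun _ _ _ => by simp only [map_smul, smul_apply])
    (fun _ _ _ => map_add _ _ _) (fun _ _ _ => map_smul _ _ _))
    (fun a => e a p) (fun a => e a p) (fun a => dualForm e a p u) (fun a => dualForm e a p v)
  rw [sum_dualForm (h.flag.indep p hp), sum_dualForm (h.flag.indep p hp)] at h1
  exact h1

/-- This is the Frobenius condition for the system `w_i = … = w_{N-1} = 0`: vectors in its kernel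
have components only along `e_0, …, e_i`. -/
theorem extd_eq_zero_of_forall (h : IsScaledDual V e g w) {p : M} (hp : p ∈ V) {i : Fin N}
    {u v : TangentSpace (𝓡 (N + 1)) p} (hu : ∀ l, i ≤ l → w l p u = 0)
    (hv : ∀ l, i ≤ l → w l p v = 0) : (w i).extd p u v = 0 := by
  have key : ∀ u, (∀ l, i ≤ l → w l p u = 0) → ∀ a, i.succ ≤ a → dualForm e a p u = 0 := by
    intro u hu a ha
    obtain ⟨l, rfl⟩ := Fin.exists_succ_eq.2 (ne_bot_of_gt (i.succ_pos.trans_le ha))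
    exact (h.eq_zero_iff hp l u).1 (hu l (Fin.succ_le_succ_iff.1 ha))
  rw [h.extd_eq_sum hp]
  refine Finset.sum_eq_zero fun a _ => Finset.sum_eq_zero fun b _ => ?_
  rcases lt_or_ge a i.succ with ha | ha
  · rcases lt_or_ge b i.succ with hb | hb
    · rw [h.extd_eq_zero hp i ha hb, mul_zero]
    · rw [key v hv b hb, mul_zero, zero_mul]
  · rw [key u hu a ha, zero_mul, zero_mul]

theorem completely_integrable (h : IsScaledDual V e g w) (i : Fin N) :
    ∃ θ : Fin N → OneForm (N + 1) M, (∀ l, (θ l).SmoothOn V) ∧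
      ∀ p ∈ V, ∀ u v : TangentSpace (𝓡 (N + 1)) p, (w i).extd p u v =
        ∑ l ∈ Finset.Ici i, (θ l p u * w l p v - θ l p v * w l p u) := by
  have hV := h.flag.isOpen
  -- The choice is dictated by `sum_skew` applied to `D a b = dw_i(e_a, e_b)`, with `e^{l+1} = g_l⁻¹
  -- w_l`. For `l < i` all the coefficients vanish, so `θ_l = 0`.
  refine ⟨fun l p => (g l p)⁻¹ • ∑ a, if a < l.succ then
    (w i).extd p (e a p) (e l.succ p) • dualForm e a p else 0, fun l => ?_, fun p hp u v => ?_⟩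
  · refine OneForm.smoothOn_of_apply hV fun Z W hW hWV hZ => ?_
    have hd : ∀ a, (dualForm e a).SmoothOn W := fun a x =>
      (h.flag.smooth_dualForm a x).mono fun _ hy => ⟨hy.1, hWV hy.2⟩
    have h1 : SmoothFunOn (m := N + 1) W fun p => ∑ a : Fin (N + 1), if a < l.succ then
        (w i).extd p (e a p) (e l.succ p) * dualForm e a p (Z p) else 0 := by
      refine contMDiffOn_finsetSum fun a _ => ?_
      by_cases ha : a < l.succ
      · simp only [if_pos ha]
        exact ((smoothOn_extd hV (h.smoothOn i) (h.flag.smooth a)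
          (h.flag.smooth l.succ)).mono hWV).mul ((hd a).apply hZ hW)
      · simp only [if_neg ha]
        exact contMDiffOn_const
    have h2 : SmoothFunOn (m := N + 1) W fun p => (g l p)⁻¹ :=
      ContMDiffOn.inv₀ ((h.smooth l).mono hWV) fun p hp => h.ne_zero p (hWV hp) l
    refine (ContMDiffOn.mul h2 h1).congr fun p hp => ?_
    simp only [smul_apply, sum_apply, smul_eq_mul, apply_ite (fun L : _ →L[ℝ] ℝ => L (Z p)),
      zero_apply]
    rfl
  · rw [h.extd_eq_sum hp, sum_skew fun a b => OneForm.extd_skew _ _ _ _]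
    symm
    refine (Finset.sum_subset (Finset.subset_univ _) fun l _ hl => ?_).trans
      (Finset.sum_congr rfl fun l _ => ?_)
    · have hli : l < i := not_le.1 fun hil => hl (Finset.mem_Ici.2 hil)
      have h0 : ∀ a, (if a < l.succ then
          (w i).extd p (e a p) (e l.succ p) • dualForm e a p else 0) = 0 := by
        intro a
        split_ifs with ha
        · have hs := Fin.succ_lt_succ_iff.2 hli
          rw [h.extd_eq_zero hp i (ha.trans hs) hs, zero_smul]
        · rfl
      simp [h0]
    · have hg := h.ne_zero p hp l
      simp only [smul_apply, sum_apply, smul_eq_mul, h.eq p hp l,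
        apply_ite (fun L : _ →L[ℝ] ℝ => L u), apply_ite (fun L : _ →L[ℝ] ℝ => L v), zero_apply]
      field_simp

/-- The common kernel of the differentials of solutions is that of the forms. -/
theorem diff_eq_zero_iff (h : IsScaledDual V e g w) {W : Set M} (hWV : W ⊆ V) {I : Fin N → M → ℝ}
    {p : M} (hp : p ∈ W) (d k : ℕ) (hd : N ≤ k + d)
    (hI : ∀ l : Fin N, k ≤ l → SolvesPfaff W w I l) (u : TangentSpace (𝓡 (N + 1)) p) :
    (∀ l : Fin N, k ≤ l → diff (m := N + 1) (I l) p u = 0) ↔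
      ∀ l : Fin N, k ≤ l → w l p u = 0 := by
  -- Descending induction on `k`, with `d` bounding the number of remaining indices; `k` is a
  -- natural number so that the empty range `k = N` can be the start.
  induction d generalizing k u with
  | zero => exact ⟨fun _ l hl => absurd l.2 (by omega), fun _ l hl => absurd l.2 (by omega)⟩
  | succ d ih =>
    have ih' := fun u => ih (k + 1) (by omega) (fun l hl => hI l (by omega)) u
    by_cases hk : k < N
    swap
    · exact ⟨fun _ l hl => absurd l.2 (by omega), fun _ l hl => absurd l.2 (by omega)⟩
    set k' : Fin N := ⟨k, hk⟩ with hk'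
    have hS := hI k' le_rfl
    have hsplit : ∀ P : Fin N → Prop, (∀ l : Fin N, k ≤ l → P l) ↔
        P k' ∧ ∀ l : Fin N, k + 1 ≤ l → P l := by
      refine fun P => ⟨fun hP => ⟨hP k' le_rfl, fun l hl => hP l (by omega)⟩, fun hP l hl => ?_⟩
      rcases eq_or_lt_of_le hl with hl | hl
      · exact (Fin.ext hl : k' = l) ▸ hP.1
      · exact hP.2 l hl
    have hw : w k' p (e k'.succ p) ≠ 0 := by
      rw [h.apply_frame (hWV hp), if_pos rfl]
      exact h.ne_zero p (hWV hp) k'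
    -- The frame vector `e_{k+1}` is killed by all later `w_l`, hence by all later `dI_l`, while
    -- `w_k` does not vanish on it. It plays for `w_k` the role that `u₀` plays for `dI_k` in the
    -- wedge condition.
    have he := (ih' (e k'.succ p)).2 fun l hl => by
      rw [h.apply_frame (hWV hp), if_neg]
      intro hl'
      have := congrArg Fin.val (Fin.succ_injective _ hl')
      simp only [hk'] at this
      omega
    obtain ⟨u₀, hu₀, hu₀'⟩ := hS.regular p hp
    rw [hsplit, hsplit, ← ih' u]
    refine and_congr_left fun hu => ?_
    have hu' : ∀ l, k' < l → diff (m := N + 1) (I l) p u = 0 := fun l hl => hu l hl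
    constructor
    · intro h0
      have h1 := hS.wedge p hp u u₀ hu' hu₀
      rw [h0, zero_mul] at h1
      exact (mul_eq_zero.1 h1.symm).resolve_left hu₀'
    · intro h0
      have h1 := hS.wedge p hp u _ hu' fun l hl => he l hl
      rw [h0, mul_zero] at h1
      exact (mul_eq_zero.1 h1).resolve_right hw

end IsScaledDual

end Pfaff

/-! ### Existence of solutions, their level sets, and the forms obtained from a volume form. -/

section Solutions

variable {N : ℕ} {M : Type*} [TopologicalSpace M]
  [ChartedSpace (EuclideanSpace ℝ (Fin (N + 1))) M] [IsManifold (𝓡 (N + 1)) ∞ M]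
  {V : Set M} {e : Fin (N + 1) → VField (N + 1) M} {g : Fin N → M → ℝ}
  {w : Fin N → OneForm (N + 1) M}

/-- Supplies the rank hypothesis of Frobenius for the subsystem of the `w_l` with `l ≥ k`. -/
theorem IsScaledDual.surjective (h : IsScaledDual V e g w) {p : M} (hp : p ∈ V)
    (P : Fin N → Prop) : Function.Surjective fun v (i : {i // P i}) => w i p v := by
  classical
  intro c
  refine ⟨∑ l, (if hl : P l then c ⟨l, hl⟩ * (g l p)⁻¹ else 0) • e l.succ p,
    funext fun i => ?_⟩
  simp only [map_sum, map_smul, h.apply_frame hp, Fin.succ_inj, smul_eq_mul]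
  rw [Finset.sum_eq_single (i : Fin N)]
  · rw [dif_pos i.2, if_pos rfl, inv_mul_cancel_right₀ (h.ne_zero p hp i)]
  · intro j _ hj; rw [if_neg hj.symm, mul_zero]
  · simp

/-- Frobenius for `w_k, …, w_{N-1}` gives `J_k` with `dJ_k = w_k` at `p` and `dJ_k = 0` on the
common kernel. On the level sets of the given `I_l`, tangent vectors are those killed by the later
`w_l`, so there `dJ_k` is a multiple of `w_k`. -/
theorem IsScaledDual.exists_solution (h : IsScaledDual V e g w) {W : Set M} (hW : IsOpen W)
    (hWV : W ⊆ V) {I : Fin N → M → ℝ} {k : Fin N} (hI : ∀ l, k < l → SolvesPfaff W w I l)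
    {p : M} (hp : p ∈ W) : ∃ W' : Set M, IsOpen W' ∧ p ∈ W' ∧ W' ⊆ W ∧
      ∃ J : M → ℝ, SolvesPfaff W' w (Function.update I k J) k := by
  have hws : ∀ l : {l // k ≤ l}, (w l).SmoothOn W := fun l x =>
    (h.smoothOn l x).mono fun _ hy => ⟨hy.1, hWV hy.2⟩
  obtain ⟨J, hJ0, W₁, hW₁, hpW₁, hW₁W, hJs, hJ⟩ := exists_first_integrals hW hws
    (fun q hq u v hu hv i => h.extd_eq_zero_of_forall (hWV hq)
      (fun l hl => hu ⟨l, i.2.trans hl⟩) fun l hl => hv ⟨l, i.2.trans hl⟩) hp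
    (h.surjective (hWV hp) fun l => k ≤ l)
  let k' : {l // k ≤ l} := ⟨k, le_rfl⟩
  have hcont : ContinuousOn (fun q => diff (m := N + 1) (J k') q (e k.succ q)) W₁ :=
    (((hJs k').diff hW₁).apply ((h.flag.smooth k.succ).mono (hW₁W.trans hWV)) hW₁).continuousOn
  have hup : ∀ l, k < l → Function.update I k (J k') l = I l := fun l hl =>
    Function.update_of_ne hl.ne' _ _
  -- At `p` the value `dJ_k(e_{k+1})` is `g_k(p) ≠ 0`; the neighbourhood is where it stays nonzero,
  -- and `e_{k+1}` witnesses regularity there.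
  refine ⟨W₁ ∩ (fun q => diff (m := N + 1) (J k') q (e k.succ q)) ⁻¹' {0}ᶜ,
    hcont.isOpen_inter_preimage hW₁ isOpen_compl_singleton, ⟨hpW₁, ?_⟩,
    fun q hq => hW₁W hq.1, J k', ?_, fun q hq u v hu hv => ?_, fun q hq => ⟨e k.succ q, ?_, ?_⟩⟩
  · change diff (m := N + 1) (J k') p (e k.succ p) ≠ 0
    rw [hJ0, h.apply_frame (hWV hp), if_pos rfl]
    exact h.ne_zero p (hWV hp) k
  · rw [Function.update_self]
    exact (hJs k').mono Set.inter_subset_left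
  · have hqW := hW₁W hq.1
    have hker := fun u => h.diff_eq_zero_iff hWV hqW N (k + 1) (by omega)
      (fun l hl => hI l hl) u
    have hw : w k q (e k.succ q) ≠ 0 := by
      rw [h.apply_frame (hWV hqW), if_pos rfl]
      exact h.ne_zero q (hWV hqW) k
    have key : ∀ u, (∀ l, k < l → diff (m := N + 1) (Function.update I k (J k') l) q u = 0) →
        diff (m := N + 1) (J k') q u =
          w k q u / w k q (e k.succ q) * diff (m := N + 1) (J k') q (e k.succ q) := by
      intro u hu
      have hu' := (hker u).1 fun l hl => by rw [← hup l hl]; exact hu l hl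
      -- Subtracting a multiple of `e_{k+1}` kills `w_k` and leaves the later `w_l` at zero, so
      -- `dJ_k` vanishes on the difference.
      have h1 := hJ q hq.1 (u - (w k q u / w k q (e k.succ q)) • e k.succ q) (fun l => by
        rw [map_sub, map_smul, smul_eq_mul]
        rcases eq_or_lt_of_le l.2 with hl | hl
        · rw [← hl, div_mul_cancel₀ _ hw, sub_self]
        · rw [hu' l hl, h.apply_frame (hWV hqW) l, if_neg, mul_zero, sub_zero]
          exact fun hl' => hl.ne' (Fin.succ_injective _ hl')) k'
      rw [map_sub, map_smul, smul_eq_mul, sub_eq_zero] at h1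
      exact h1
    rw [Function.update_self, key u hu, key v hv]
    ring
  · have hqW := hW₁W hq.1
    intro l hl
    rw [hup l hl]
    refine (h.diff_eq_zero_iff hWV hqW N (k + 1) (by omega)
      (fun l hl => hI l hl) _).2 (fun j hj => ?_) l hl
    rw [h.apply_frame (hWV hqW), if_neg]
    exact fun hj' => (ne_of_gt hj) (congrArg Fin.val (Fin.succ_injective _ hj'))
  · rw [Function.update_self]
    exact hq.2

/-- A function with injective derivative and smooth near `p` is injective near `p`. -/
theorem exists_injOn_of_diff_injective {ι : Type*} [Fintype ι] (hι : Fintype.card ι = N + 1)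
    {G : ι → M → ℝ} {W : Set M} (hW : IsOpen W) (hG : ∀ i, SmoothFunOn (m := N + 1) W (G i))
    {p : M} (hp : p ∈ W) (hinj : ∀ u, (∀ i, diff (m := N + 1) (G i) p u = 0) → u = 0) :
    ∃ O, IsOpen O ∧ p ∈ O ∧ O ⊆ W ∧ ∀ q ∈ O, ∀ q' ∈ O, (∀ i, G i q = G i q') → q = q' := by
  have hps := mem_extChartAt_source (I := 𝓡 (N + 1)) p
  set y₀ := extChartAt (𝓡 (N + 1)) p p with hy₀
  let Φ : EuclideanSpace ℝ (Fin (N + 1)) → ι → ℝ := fun y i =>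
    (G i ∘ (extChartAt (𝓡 (N + 1)) p).symm) y
  have ho : IsOpen ((extChartAt (𝓡 (N + 1)) p).target ∩
      (extChartAt (𝓡 (N + 1)) p).symm ⁻¹' W) :=
    (continuousOn_extChartAt_symm p).isOpen_inter_preimage (isOpen_extChartAt_target p) hW
  have hΦ : ∀ᶠ y in 𝓝 y₀, ContDiffAt ℝ ∞ Φ y := by
    filter_upwards [ho.mem_nhds ⟨(extChartAt (𝓡 (N + 1)) p).map_source hps, by
      rwa [Set.mem_preimage, (extChartAt (𝓡 (N + 1)) p).left_inv hps]⟩] with y hy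
    refine contDiffAt_pi.2 fun i => ?_
    have h1 := contDiffAt_comp_symm ((extChartAt (𝓡 (N + 1)) p).map_target hy.1)
      ((hG i).at hW hy.2)
    rwa [(extChartAt (𝓡 (N + 1)) p).right_inv hy.1] at h1
  have hd := (hΦ.self_of_nhds.differentiableAt (by simp)).hasFDerivAt
  have hinv : (fderiv ℝ Φ y₀).IsInvertible := by
    refine isInvertible_of_injective ?_ (by simp [hι])
    rw [injective_iff_map_eq_zero]
    intro u hu
    have h1 := hinj (chartDInv p p u) fun i => by
      rw [diff_apply_chart ((hG i).at hW hp) hps, chartD_chartDInv hps]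
      have h2 := (hasFDerivAt_pi'.1 hd i).fderiv
      exact (congrArg (fun L => L u) h2).trans (congrFun hu i)
    rw [← chartD_chartDInv hps u, h1, map_zero]
  obtain ⟨A, hA⟩ := hinv
  rw [← hA] at hd
  obtain ⟨k, -, -, hk⟩ := exists_smooth_local_inverse hΦ hd
  have hcont : Filter.Tendsto (extChartAt (𝓡 (N + 1)) p) (𝓝 p) (𝓝 y₀) :=
    continuousAt_extChartAt (I := 𝓡 (N + 1)) p
  obtain ⟨O, hOm, hO, hpO⟩ := eventually_nhds_iff.1 ((hcont.eventually hk).and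
    ((hW.eventually_mem hp).and
      ((isOpen_extChartAt_source (I := 𝓡 (N + 1)) p).eventually_mem hps)))
  refine ⟨O, hO, hpO, fun q hq => (hOm q hq).2.1, fun q hq q' hq' hqq => ?_⟩
  refine (extChartAt (𝓡 (N + 1)) p).injOn (hOm q hq).2.2 (hOm q' hq').2.2 ?_
  rw [← (hOm q hq).1, ← (hOm q' hq').1]
  congr 1
  refine funext fun i => ?_
  simp only [Φ, Function.comp_apply]
  rw [(extChartAt (𝓡 (N + 1)) p).left_inv (hOm q hq).2.2,
    (extChartAt (𝓡 (N + 1)) p).left_inv (hOm q' hq').2.2]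
  exact hqq i

theorem hasDerivAt_comp_integralCurve {m : ℕ} {M : Type*} [TopologicalSpace M]
    [ChartedSpace (EuclideanSpace ℝ (Fin m)) M] {X : VField m M} {γ : ℝ → M}
    {f : M → ℝ} {t : ℝ}
    (hγ : HasMFDerivAt 𝓘(ℝ, ℝ) (𝓡 m) γ t ((1 : ℝ →L[ℝ] ℝ).smulRight (X (γ t))))
    (hf : ContMDiffAt (𝓡 m) 𝓘(ℝ, ℝ) ∞ f (γ t)) :
    HasDerivAt (f ∘ γ) (diff (m := m) f (γ t) (X (γ t))) t := by
  have h1 : HasFDerivAt (f ∘ γ) ((diff (m := m) f (γ t)).comp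
      ((1 : ℝ →L[ℝ] ℝ).smulRight (X (γ t)))) t :=
    ((hf.mdifferentiableAt (by simp)).hasMFDerivAt.comp t hγ).hasFDerivAt
  refine h1.hasDerivAt.congr_deriv ?_
  change diff (m := m) f (γ t) ((1 : ℝ) • X (γ t)) = _
  rw [one_smul]

/-- Common level sets of `N` functions whose differentials have the common kernel `⟨X⟩` on an
`(N+1)`-dimensional manifold are integral manifolds of `⟨X⟩`. -/
theorem isIntegralManifold_levelSet {X : VField (N + 1) M} {W : Set M} (hW : IsOpen W)
    (hX : X.SmoothOn W) (hX0 : ∀ p ∈ W, X p ≠ 0) {I : Fin N → M → ℝ}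
    (hI : ∀ i, SmoothFunOn (m := N + 1) W (I i))
    (hker : ∀ p ∈ W, ∀ u, (∀ i, diff (m := N + 1) (I i) p u = 0) ↔
      u ∈ Submodule.span ℝ {X p}) (c : Fin N → ℝ) :
    IsIntegralManifold X {p | p ∈ W ∧ ∀ k, I k p = c k} := by
  rintro p ⟨hp, hpc⟩
  have hps := mem_extChartAt_source (I := 𝓡 (N + 1)) p
  -- a function that increases along `X`
  let z : EuclideanSpace ℝ (Fin (N + 1)) := chartD p p (X p)
  have hz : z ≠ 0 := fun h0 => hX0 p hp <|
    (chartDInv_chartD hps (X p)).symm.trans ((congrArg (chartDInv p p) h0).trans (map_zero _))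
  let ℓ : EuclideanSpace ℝ (Fin (N + 1)) →L[ℝ] ℝ := innerSL ℝ z
  let f : M → ℝ := ℓ ∘ extChartAt (𝓡 (N + 1)) p
  have hW₁ : IsOpen (W ∩ (extChartAt (𝓡 (N + 1)) p).source) :=
    hW.inter (isOpen_extChartAt_source p)
  have hf : SmoothFunOn (m := N + 1) (W ∩ (extChartAt (𝓡 (N + 1)) p).source) f := fun q hq =>
    (contMDiffAt_comp_chart hq.2 ℓ.contDiff.contDiffAt).contMDiffWithinAt
  have hfX : 0 < diff (m := N + 1) f p (X p) := by
    rw [diff_apply_chart (hf.at hW₁ ⟨hp, hps⟩) hps]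
    have h1 : f ∘ (extChartAt (𝓡 (N + 1)) p).symm =ᶠ[𝓝 (extChartAt (𝓡 (N + 1)) p p)] ℓ := by
      filter_upwards [extChartAt_target_mem_nhds (I := 𝓡 (N + 1)) p] with y hy
      exact congrArg ℓ ((extChartAt (𝓡 (N + 1)) p).right_inv hy)
    rw [h1.fderiv_eq, ContinuousLinearMap.fderiv]
    exact real_inner_self_pos.2 hz
  have hfXs : ContinuousOn (fun q => diff (m := N + 1) f q (X q))
      (W ∩ (extChartAt (𝓡 (N + 1)) p).source) :=
    ((hf.diff hW₁).apply (hX.mono Set.inter_subset_left) hW₁).continuousOn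
  -- local injectivity of `(f, I)`
  obtain ⟨O, hO, hpO, hOW, hOinj⟩ := exists_injOn_of_diff_injective (N := N) (ι := Option (Fin N))
    (G := fun o => o.elim f I) (by simp) hW₁
    (fun o => by
      cases o with
      | none => exact hf
      | some i => exact (hI i).mono Set.inter_subset_left) ⟨hp, hps⟩
    (fun u hu => by
      obtain ⟨a, rfl⟩ := Submodule.mem_span_singleton.1 ((hker p hp u).1 fun i => hu (some i))
      have h1 : diff (m := N + 1) f p (a • X p) = 0 := hu none
      rw [map_smul, smul_eq_mul] at h1
      rw [(mul_eq_zero.1 h1).resolve_right hfX.ne', zero_smul])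
  let O₁ := O ∩ (fun q => diff (m := N + 1) f q (X q)) ⁻¹' Set.Ioi 0
  have hO₁ : IsOpen O₁ := (hfXs.mono hOW).isOpen_inter_preimage hO isOpen_Ioi
  have hpO₁ : p ∈ O₁ := ⟨hpO, hfX⟩
  have hO₁W : O₁ ⊆ W := fun q hq => (hOW hq.1).1
  have hfO₁ : ContinuousOn f O₁ := hf.continuousOn.mono fun q hq => hOW hq.1
  -- the integral curve through `p`
  obtain ⟨γ, hγ0, hγ⟩ := exists_isMIntegralCurveAt_of_contMDiffAt_boundaryless (I := 𝓡 (N + 1))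
    (x₀ := p) 0 ((hX.at hW hp).of_le (by simp))
  have hγc : ContinuousAt γ 0 := hγ.self_of_nhds.continuousAt
  have hev : ∀ᶠ t in 𝓝 (0 : ℝ), γ t ∈ O₁ :=
    hγc.eventually_mem (hO₁.mem_nhds (by rwa [hγ0]))
  obtain ⟨δ, hδ, hball⟩ := Metric.eventually_nhds_iff_ball.1 (hγ.and hev)
  rw [Real.ball_eq_Ioo, zero_sub, zero_add] at hball
  have hγcont : ContinuousOn γ (Set.Ioo (-δ) δ) := fun t ht =>
    (hball t ht).1.continuousAt.continuousWithinAt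
  have hderf : ∀ t ∈ Set.Ioo (-δ) δ, HasDerivAt (f ∘ γ) (diff (m := N + 1) f (γ t) (X (γ t))) t :=
    fun t ht => hasDerivAt_comp_integralCurve (hball t ht).1
      (hf.at hW₁ (hOW (hball t ht).2.1))
  have hmono : StrictMonoOn (f ∘ γ) (Set.Ioo (-δ) δ) := by
    refine strictMonoOn_of_deriv_pos (convex_Ioo _ _) (fun t ht =>
      (hderf t ht).continuousAt.continuousWithinAt) fun t ht => ?_
    rw [interior_Ioo] at ht
    rw [(hderf t ht).deriv]
    exact (hball t ht).2.2
  have hIγ : ∀ t ∈ Set.Ioo (-δ) δ, ∀ k, I k (γ t) = c k := by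
    intro t ht k
    have hder : ∀ t ∈ Set.Ioo (-δ) δ, HasDerivAt (I k ∘ γ) 0 t := fun t ht => by
      have h1 := hasDerivAt_comp_integralCurve (f := I k) (hball t ht).1
        ((hI k).at hW (hO₁W (hball t ht).2))
      rwa [(hker _ (hO₁W (hball t ht).2) _).2 (Submodule.mem_span_singleton_self _) k] at h1
    have h1 := isOpen_Ioo.is_const_of_deriv_eq_zero isPreconnected_Ioo
      (fun t ht => (hder t ht).differentiableAt.differentiableWithinAt)
      (fun t ht => (hder t ht).deriv) ht (y := 0) (by simp [hδ])
    simp only [Function.comp_apply, hγ0] at h1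
    rw [h1, hpc k]
  -- shrink
  have hsub : Set.Ioo (-(δ / 2)) (δ / 2) ⊆ Set.Ioo (-δ) δ :=
    Set.Ioo_subset_Ioo (by linarith) (by linarith)
  have hsub' : Set.Icc (-(δ / 2)) (δ / 2) ⊆ Set.Ioo (-δ) δ :=
    Set.Icc_subset_Ioo (by linarith) (by linarith)
  have ha : -(δ / 2) ∈ Set.Icc (-(δ / 2)) (δ / 2) := ⟨le_rfl, by linarith⟩
  have hb : δ / 2 ∈ Set.Icc (-(δ / 2)) (δ / 2) := ⟨by linarith, le_rfl⟩
  have h0 : (0 : ℝ) ∈ Set.Ioo (-(δ / 2)) (δ / 2) := ⟨by linarith, by linarith⟩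
  have himg : ∀ t ∈ Set.Ioo (-(δ / 2)) (δ / 2),
      γ t ∈ O₁ ∩ f ⁻¹' Set.Ioo (f (γ (-(δ / 2)))) (f (γ (δ / 2))) := fun t ht =>
    ⟨(hball t (hsub ht)).2, hmono (hsub' ha) (hsub ht) ht.1, hmono (hsub ht) (hsub' hb) ht.2⟩
  -- The neighbourhood is cut to the slab of `f`-values strictly between those at the two ends of
  -- the arc. Each point of the level set in it shares its `f`-value with some `γ t`, by the
  -- intermediate value theorem, and local injectivity of `(f, I)` identifies the two points.
  refine ⟨O₁ ∩ f ⁻¹' Set.Ioo (f (γ (-(δ / 2)))) (f (γ (δ / 2))),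
    hfO₁.isOpen_inter_preimage hO₁ isOpen_Ioo, hγ0 ▸ himg 0 h0, δ / 2, by linarith, γ, hγ0,
    fun t ht => (hball t (hsub ht)).1.hasMFDerivWithinAt, ?_, ?_⟩
  -- `f ∘ γ` is continuous and strictly increasing with order-connected range, hence an embedding;
  -- so its first factor `γ'` is one.
  · let γ' : Set.Ioo (-(δ / 2)) (δ / 2) → O₁ := fun t => ⟨γ t, (hball t (hsub t.2)).2⟩
    have hγ' : Continuous γ' :=
      (continuousOn_iff_continuous_domRestrict.1 (hγcont.mono hsub)).subtype_mk _
    have hmono' : StrictMono (O₁.domRestrict f ∘ γ') := fun s t hst =>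
      hmono (hsub s.2) (hsub t.2) hst
    have hfr : Continuous (O₁.domRestrict f) := continuousOn_iff_continuous_domRestrict.1 hfO₁
    have : PreconnectedSpace (Set.Ioo (-(δ / 2)) (δ / 2)) :=
      Subtype.preconnectedSpace isPreconnected_Ioo
    have hord : Set.OrdConnected (Set.range (O₁.domRestrict f ∘ γ')) :=
      (isPreconnected_range (hfr.comp hγ')).ordConnected
    exact Topology.IsEmbedding.subtypeVal.comp
      (Topology.IsEmbedding.of_comp hγ' hfr (hmono'.isEmbedding_of_ordConnected hord))
  · apply Set.Subset.antisymm
    · rintro _ ⟨t, ht, rfl⟩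
      exact ⟨⟨hO₁W (hball t (hsub ht)).2, hIγ t (hsub ht)⟩, himg t ht⟩
    · rintro q ⟨⟨hqW, hqc⟩, hqO, hq1, hq2⟩
      obtain ⟨t, ht, htq⟩ := intermediate_value_Ioo (by linarith : -(δ / 2) ≤ δ / 2)
        (f := f ∘ γ) (fun t ht => (hderf t (hsub' ht)).continuousAt.continuousWithinAt)
        ⟨hq1, hq2⟩
      refine ⟨t, ht, hOinj _ (hball t (hsub ht)).2.1 _ hqO.1 fun o => ?_⟩
      cases o with
      | none => exact htq
      | some k => exact (hIγ t (hsub ht) k).trans (hqc k).symm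

theorem IsScaledDual.integratedByPfaff (h : IsScaledDual V e g w) :
    IntegratedByPfaff V (e 0) w where
  smooth := h.smoothOn
  indep _ hp := h.linearIndependent hp
  annihilator _ hp := h.annihilator hp
  completely_integrable := h.completely_integrable
  solvable W hW hWV I k hI p hp := h.exists_solution hW hWV hI hp
  integral W hW hWV I hI c := by
    refine isIntegralManifold_levelSet hW ((h.flag.smooth 0).mono hWV)
      (fun p hp => (h.flag.indep p (hWV hp)).ne_zero 0) (fun i => (hI i).smooth)
      (fun p hp u => ?_) c
    rw [← h.annihilator (hWV hp)]
    have h1 := h.diff_eq_zero_iff hWV hp N 0 (by omega) (fun l _ => hI l) u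
    simpa using h1

/-- Placing `v` in slot `i + 1` of `Ω(e_0, …, e_N)` keeps only its `e_{i+1}` component, since any
other one repeats an argument. The factor is nonzero because a nonzero top-degree form does not
vanish on a basis. -/
theorem isScaledDual_pfaffForm (he : IsInvolutiveFlag V e) {Ω : TopForm (N + 1) M}
    (hΩ : Ω.IsVolumeOn V) :
    IsScaledDual V e (fun i p => (-1 : ℝ) ^ (N - 1 - (i : ℕ)) * Ω p fun c => e c p)
      (pfaffForm Ω (e 0) fun j => e j.succ) where
  flag := he
  smooth i := ContMDiffOn.mul contMDiffOn_const (hΩ.apply he.isOpen he.smooth)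
  ne_zero p hp i := by
    refine mul_ne_zero (pow_ne_zero _ (by norm_num)) ?_
    let b := basisOfLinearIndependentOfCardEqFinrank (he.indep p hp)
      (by rw [finrank_tangentSpace, Fintype.card_fin])
    have hb : (b : Fin (N + 1) → TangentSpace (𝓡 (N + 1)) p) = fun c => e c p :=
      coe_basisOfLinearIndependentOfCardEqFinrank _ _
    have h1 := (AlternatingMap.map_basis_ne_zero_iff b (Ω p).toAlternatingMap).2 fun h0 =>
      hΩ.ne_zero p hp (ContinuousAlternatingMap.ext fun v => DFunLike.congr_fun h0 v)
    rw [hb] at h1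
    exact h1
  eq p hp i v := by
    have hcons : (Fin.cons (α := fun _ => TangentSpace (𝓡 (N + 1)) p) (e 0 p)
        fun j => e j.succ p) = fun c => e c p := by
      funext c
      refine Fin.cases ?_ (fun j => ?_) c <;> rfl
    have hL : ∀ a, (Ω p).toContinuousMultilinearMap.toContinuousLinearMap
        (fun c => e c p) i.succ (e a p) = if a = i.succ then Ω p (fun c => e c p) else 0 := by
      intro a
      change Ω p (Function.update (fun c => e c p) i.succ (e a p)) = _
      split_ifs with ha
      · rw [ha, Function.update_eq_self]
      · refine (Ω p).map_eq_zero_of_eq _ (i := a) (j := i.succ) ?_ ha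
        rw [Function.update_of_ne ha, Function.update_self]
    change (-1 : ℝ) ^ (N - 1 - (i : ℕ)) * (Ω p).toContinuousMultilinearMap.toContinuousLinearMap
      (Fin.cons (α := fun _ => TangentSpace (𝓡 (N + 1)) p) (e 0 p) fun j => e j.succ p)
      i.succ v = _
    rw [hcons, ← sum_dualForm (he.indep p hp) v]
    simp only [map_sum, map_smul, hL, smul_eq_mul, mul_ite, mul_zero, Finset.sum_ite_eq',
      Finset.mem_univ, if_true, dualForm_apply (he.indep p hp), mul_one, Finset.sum_ite_eq]
    ring

end Solutions

/-! ### Hamiltonian vector fields on a contact manifold -/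

section ContactAlgebra

variable {m : ℕ} {M : Type*} [TopologicalSpace M] [ChartedSpace (EuclideanSpace ℝ (Fin m)) M]

theorem OneForm.SmoothOn.mono {α : OneForm m M} {V W : Set M} (hα : α.SmoothOn V) (h : W ⊆ V) :
    α.SmoothOn W := fun x => (hα x).mono fun _ hy => ⟨hy.1, h hy.2⟩

theorem diff_mul {f g : M → ℝ} {p : M} (hf : ContMDiffAt (𝓡 m) 𝓘(ℝ, ℝ) ∞ f p)
    (hg : ContMDiffAt (𝓡 m) 𝓘(ℝ, ℝ) ∞ g p) (v : TangentSpace (𝓡 m) p) :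
    diff (m := m) (fun q => f q * g q) p v =
      f p * diff (m := m) g p v + g p * diff (m := m) f p v :=
  congrArg (fun L : TangentSpace (𝓡 m) p →L[ℝ] ℝ => L v)
    ((hf.mdifferentiableAt (by simp)).hasMFDerivAt.mul
      (hg.mdifferentiableAt (by simp)).hasMFDerivAt).mfderiv

theorem diff_add {f g : M → ℝ} {p : M} (hf : ContMDiffAt (𝓡 m) 𝓘(ℝ, ℝ) ∞ f p)
    (hg : ContMDiffAt (𝓡 m) 𝓘(ℝ, ℝ) ∞ g p) (v : TangentSpace (𝓡 m) p) :
    diff (m := m) (fun q => f q + g q) p v =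
      diff (m := m) f p v + diff (m := m) g p v :=
  congrArg (fun L : TangentSpace (𝓡 m) p →L[ℝ] ℝ => L v)
    ((hf.mdifferentiableAt (by simp)).hasMFDerivAt.add
      (hg.mdifferentiableAt (by simp)).hasMFDerivAt).mfderiv

theorem diff_neg (f : M → ℝ) (p : M) (v : TangentSpace (𝓡 m) p) :
    diff (m := m) (fun q => -f q) p v = -diff (m := m) f p v :=
  congrArg (fun L : TangentSpace (𝓡 m) p →L[ℝ] ℝ => L v) mfderiv_neg

theorem diff_comp {ι : Type*} [Fintype ι] [DecidableEq ι] {f : ι → M → ℝ} {G : (ι → ℝ) → ℝ}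
    {p : M} (hf : ∀ k, ContMDiffAt (𝓡 m) 𝓘(ℝ, ℝ) ∞ (f k) p) (hG : ContDiff ℝ ∞ G)
    (v : TangentSpace (𝓡 m) p) :
    diff (m := m) (fun q => G fun k => f k q) p v =
      ∑ k, fderiv ℝ G (fun k => f k p) (Pi.single k 1) * diff (m := m) (f k) p v := by
  have hF : ContMDiffAt (𝓡 m) 𝓘(ℝ, ι → ℝ) ∞ (fun q k => f k q) p := contMDiffAt_pi_space.2 hf
  have h1 := ((hG.contMDiff.contMDiffAt (x := fun k => f k p)).mdifferentiableAt
    (by simp)).hasMFDerivAt.comp p (hF.mdifferentiableAt (by simp)).hasMFDerivAt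
  have h2 : ∀ k, diff (m := m) (f k) p v =
      (mfderiv (𝓡 m) 𝓘(ℝ, ι → ℝ) (fun q k => f k q) p v : ι → ℝ) k := fun k => by
    have h3 := ((ContinuousLinearMap.proj (R := ℝ) (φ := fun _ : ι => ℝ) k).hasMFDerivAt
      (x := fun k => f k p)).comp p (hF.mdifferentiableAt (by simp)).hasMFDerivAt
    exact congrArg (fun L : TangentSpace (𝓡 m) p →L[ℝ] ℝ => L v) h3.mfderiv
  have h4 := congrArg (fun L : TangentSpace (𝓡 m) p →L[ℝ] ℝ => L v) h1.mfderiv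
  refine h4.trans ?_
  change mfderiv 𝓘(ℝ, ι → ℝ) 𝓘(ℝ, ℝ) G (fun k => f k p) _ = _
  rw [mfderiv_eq_fderiv]
  simp only [h2]
  set z : ι → ℝ := mfderiv (𝓡 m) 𝓘(ℝ, ι → ℝ) (fun q k => f k q) p v
  have h5 : z = ∑ k, z k • Pi.single k (1 : ℝ) := by
    funext i
    simp [Finset.sum_apply, Pi.single_apply]
  change fderiv ℝ G (fun k => f k p) z = _
  conv_lhs => rw [h5]
  simp only [map_sum, map_smul, smul_eq_mul, mul_comm]

theorem flat_apply (η : OneForm m M) {p : M} (v u : TangentSpace (𝓡 m) p) :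
    flat η p v u = η.extd p v u + η p v * η p u := rfl

theorem sharp_diff (η : OneForm m M) (f : M → ℝ) (p : M) :
    sharp η p (diff f p) = ham η f p + (diff f p (reeb η p) + f p) • reeb η p := by
  rw [ham, map_sub, map_smul]
  exact (sub_add_cancel _ _).symm

variable [IsManifold (𝓡 m) ∞ M] {η : OneForm m M}

theorem extd_self (α : OneForm m M) {p : M} (v : TangentSpace (𝓡 m) p) : α.extd p v v = 0 := by
  linarith [α.extd_skew p v v]

namespace IsContactForm

/-- Evaluating `b(v) = 0` at `v` itself gives `η(v)² = 0`; then `dη(v, ·) = 0`, and nondegeneracy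
applies. -/
theorem flat_injective (hη : IsContactForm η) (p : M) : Function.Injective (flat η p) := by
  rw [injective_iff_map_eq_zero]
  intro v hv
  have h : ∀ u, η.extd p v u + η p v * η p u = 0 := fun u =>
    congrArg (fun L : TangentSpace (𝓡 m) p →L[ℝ] ℝ => L u) hv
  have h0 : η p v = 0 := by
    have := h v
    rw [extd_self, zero_add] at this
    exact mul_self_eq_zero.1 this
  refine hη.nondegenerate p v h0 fun u _ => ?_
  have := h u
  rwa [h0, zero_mul, add_zero] at this

theorem flat_isInvertible (hη : IsContactForm η) (p : M) : (flat η p).IsInvertible := by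
  have : FiniteDimensional ℝ (TangentSpace (𝓡 m) p →L[ℝ] ℝ) :=
    inferInstanceAs (FiniteDimensional ℝ (EuclideanSpace ℝ (Fin m) →L[ℝ] ℝ))
  refine isInvertible_of_injective (hη.flat_injective p) ?_
  have h1 := (LinearMap.toContinuousLinearMap (𝕜 := ℝ) (E := TangentSpace (𝓡 m) p)
    (F' := ℝ)).finrank_eq
  rw [← h1]
  exact (Subspace.dual_finrank_eq).symm

theorem flat_sharp (hη : IsContactForm η) (p : M) (α : TangentSpace (𝓡 m) p →L[ℝ] ℝ) :
    flat η p (sharp η p α) = α := (hη.flat_isInvertible p).self_apply_inverse α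

/-- Evaluating `b(ℛ) = η` at `ℛ` gives `η(ℛ)² = η(ℛ)`. The value `0` would force `ℛ = 0` by
nondegeneracy, hence `η = 0`. -/
theorem apply_reeb_and_extd_reeb (hη : IsContactForm η) (p : M) :
    η p (reeb η p) = 1 ∧ ∀ u, η.extd p (reeb η p) u = 0 := by
  have h : ∀ u, η.extd p (reeb η p) u + η p (reeb η p) * η p u = η p u := fun u =>
    congrArg (fun L : TangentSpace (𝓡 m) p →L[ℝ] ℝ => L u) (hη.flat_sharp p (η p))
  have h1 : η p (reeb η p) = 1 := by
    have h2 := h (reeb η p)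
    rw [extd_self, zero_add] at h2
    by_contra h1
    have h0 : η p (reeb η p) = 0 := by
      have : η p (reeb η p) * (η p (reeb η p) - 1) = 0 := by linarith
      exact (mul_eq_zero.1 this).resolve_right (sub_ne_zero.2 h1)
    have h3 := hη.nondegenerate p (reeb η p) h0 fun u hu => by
      have := h u
      rwa [hu, mul_zero, add_zero] at this
    refine hη.ne_zero p (ContinuousLinearMap.ext fun u => ?_)
    rw [← h u, h3]
    simp
  refine ⟨h1, fun u => ?_⟩
  have := h u
  rw [h1] at this
  linarith

theorem apply_reeb (hη : IsContactForm η) (p : M) : η p (reeb η p) = 1 :=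
  (hη.apply_reeb_and_extd_reeb p).1

theorem extd_reeb (hη : IsContactForm η) {p : M} (u : TangentSpace (𝓡 m) p) :
    η.extd p (reeb η p) u = 0 := (hη.apply_reeb_and_extd_reeb p).2 u

theorem flat_ham (hη : IsContactForm η) (f : M → ℝ) (p : M) :
    flat η p (ham η f p) = diff f p - (diff f p (reeb η p) + f p) • η p := hη.flat_sharp p _

theorem apply_ham (hη : IsContactForm η) (f : M → ℝ) (p : M) : η p (ham η f p) = -f p := by
  have h := congrArg (fun L : TangentSpace (𝓡 m) p →L[ℝ] ℝ => L (reeb η p)) (hη.flat_ham f p)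
  change η.extd p (ham η f p) (reeb η p) + η p (ham η f p) * η p (reeb η p) =
    diff f p (reeb η p) - (diff f p (reeb η p) + f p) * η p (reeb η p) at h
  rw [η.extd_skew, hη.extd_reeb, hη.apply_reeb] at h
  linarith

theorem extd_ham (hη : IsContactForm η) (f : M → ℝ) {p : M} (u : TangentSpace (𝓡 m) p) :
    η.extd p (ham η f p) u = diff f p u - diff f p (reeb η p) * η p u := by
  have h := congrArg (fun L : TangentSpace (𝓡 m) p →L[ℝ] ℝ => L u) (hη.flat_ham f p)
  change η.extd p (ham η f p) u + η p (ham η f p) * η p u =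
    diff f p u - (diff f p (reeb η p) + f p) * η p u at h
  rw [hη.apply_ham] at h
  linarith

/-- Identities between Hamiltonian fields are proved through this: `η(X_f)` and `dη(X_f, ·)` have
simple formulas. -/
theorem eq_of_apply_of_extd (hη : IsContactForm η) {p : M} {v v' : TangentSpace (𝓡 m) p}
    (h : η p v = η p v') (hd : ∀ u, η.extd p v u = η.extd p v' u) : v = v' := by
  refine hη.flat_injective p (ContinuousLinearMap.ext fun u => ?_)
  rw [flat_apply, flat_apply, h, hd]

/-- `b⁻¹(df)` differs from `X_f` by a multiple of `ℛ`, which lies in the kernel of `dη`; so `Λ(df,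
dg) = -dη(X_f, X_g)`. -/
theorem jacobiBracket_eq (hη : IsContactForm η) (f g : M → ℝ) (p : M) :
    jacobiBracket η f g p = diff g p (ham η f p) + g p * diff f p (reeb η p) := by
  have h1 : η.extd p (sharp η p (diff f p)) (sharp η p (diff g p)) =
      -η.extd p (ham η g p) (ham η f p) := by
    have hr : ∀ u, η.extd p u (reeb η p) = 0 := fun u => by
      rw [η.extd_skew, hη.extd_reeb, neg_zero]
    simp only [sharp_diff, map_add, map_smul, add_apply, smul_apply, hη.extd_reeb, hr,
      smul_zero, add_zero]
    exact η.extd_skew p _ _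
  rw [jacobiBracket, bivector, h1, hη.extd_ham, hη.apply_ham, jacobiE, map_neg, map_neg]
  ring

end IsContactForm

end ContactAlgebra

section ContactCalculus

variable {m : ℕ} {M : Type*} [TopologicalSpace M] [ChartedSpace (EuclideanSpace ℝ (Fin m)) M]
  [IsManifold (𝓡 m) ∞ M] {η : OneForm m M}

theorem eq_zero_of_coordField {x q : M} (hq : q ∈ (extChartAt (𝓡 m) x).source)
    {α : TangentSpace (𝓡 m) q →L[ℝ] ℝ}
    (h : ∀ i, α (coordField x (EuclideanSpace.basisFun (Fin m) ℝ i) q) = 0) : α = 0 := by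
  have h1 : α.comp (chartDInv x q) = 0 :=
    ContinuousLinearMap.coe_injective ((EuclideanSpace.basisFun (Fin m) ℝ).toBasis.ext fun i => by
      rw [OrthonormalBasis.coe_toBasis]; exact h i)
  refine ContinuousLinearMap.ext fun v => ?_
  have h2 := congrArg (fun L : EuclideanSpace ℝ (Fin m) →L[ℝ] ℝ => L (chartD x q v)) h1
  rw [← chartDInv_chartD hq v]
  exact h2

namespace IsContactForm

/-- The numbers `b(Z)(e_i)`, for coordinate fields `e_i`, are the values on `Z` of the transposed
forms `-dη(e_i, ·) + η(e_i) η`. These form a smooth coframe because `b` is injective. -/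
theorem smoothOn_of_flat (hη : IsContactForm η) {Z : VField m M}
    (h : OneForm.SmoothOn Set.univ fun p => flat η p (Z p)) : Z.SmoothOn Set.univ := by
  intro x _
  let W := (extChartAt (𝓡 m) x).source
  have hW : IsOpen W := isOpen_extChartAt_source x
  let e : Fin m → VField m M := fun i => coordField x (EuclideanSpace.basisFun (Fin m) ℝ i)
  have he : ∀ i, (e i).SmoothOn W := fun i => smoothOn_coordField x _
  have hβ : ∀ i p v, (-η.extd p (e i p) + η p (e i p) • η p) v = flat η p v (e i p) :=
    fun i p v => by
      rw [flat_apply, add_apply, neg_apply, smul_apply, smul_eq_mul, η.extd_skew p v, mul_comm]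
  refine (VField.SmoothOn.at (V := W) (smoothOn_of_coframe
    (β := fun i p => -η.extd p (e i p) + η p (e i p) • η p) hW (fun i => ?_)
    (fun p hp v hv => ?_) fun i => ?_) hW
    (mem_extChartAt_source (I := 𝓡 m) x)).contMDiffWithinAt
  · refine OneForm.smoothOn_of_apply hW fun Y W' hW' hWW' hY => ?_
    have hηW := hη.smooth.mono (Set.subset_univ W')
    have hei := (he i).mono hWW'
    simp only [hβ]
    exact ContMDiffOn.add (smoothOn_extd hW' hηW hY hei)
      (ContMDiffOn.mul (hηW.apply hY hW') (hηW.apply hei hW'))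
  · simp only [hβ] at hv
    exact (injective_iff_map_eq_zero _).1 (hη.flat_injective p) v (eq_zero_of_coordField hp hv)
  · simp only [hβ]
    exact (h.mono (Set.subset_univ W)).apply (he i) hW

theorem smoothOn_reeb (hη : IsContactForm η) : (reeb η).SmoothOn Set.univ := by
  refine hη.smoothOn_of_flat ?_
  have : (fun p => flat η p (reeb η p)) = η := funext fun p => hη.flat_sharp p (η p)
  rw [this]
  exact hη.smooth

theorem smooth_diff_reeb (hη : IsContactForm η) {f : M → ℝ}
    (hf : SmoothFunOn (m := m) Set.univ f) :
    SmoothFunOn (m := m) Set.univ fun p => diff f p (reeb η p) :=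
  (hf.diff isOpen_univ).apply hη.smoothOn_reeb isOpen_univ

theorem smoothOn_ham (hη : IsContactForm η) {f : M → ℝ} (hf : SmoothFunOn (m := m) Set.univ f) :
    (ham η f).SmoothOn Set.univ := by
  refine hη.smoothOn_of_flat ?_
  have : (fun p => flat η p (ham η f p)) =
      fun p => diff f p - (diff f p (reeb η p) + f p) • η p := funext fun p => hη.flat_ham f p
  rw [this]
  refine OneForm.smoothOn_of_apply isOpen_univ fun Z W hW _ hZ => ?_
  have hWu := Set.subset_univ W
  exact ContMDiffOn.sub (((hf.diff isOpen_univ).mono hWu).apply hZ hW)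
    (ContMDiffOn.mul (((hη.smooth_diff_reeb hf).mono hWu).add (hf.mono hWu))
      ((hη.smooth.mono hWu).apply hZ hW))

end IsContactForm

namespace IsContactForm

variable {V : Set M}

/-- This is `L_{X_f} η = -ℛ(f) η`: Hamiltonian fields are infinitesimal contact transformations. -/
theorem apply_mlieBracket_ham (hη : IsContactForm η) {f : M → ℝ}
    (hf : SmoothFunOn (m := m) Set.univ f) (hV : IsOpen V) {Z : VField m M} (hZ : Z.SmoothOn V)
    {p : M} (hp : p ∈ V) :
    η p (VectorField.mlieBracket (𝓡 m) (ham η f) Z p) =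
      diff (m := m) (fun q => η q (Z q)) p (ham η f p) +
        diff (m := m) f p (reeb η p) * η p (Z p) := by
  have h := extd_eq hV (hη.smooth.mono (Set.subset_univ V))
    ((hη.smoothOn_ham hf).mono (Set.subset_univ V)) hZ hp
  rw [hη.extd_ham] at h
  have h1 : (fun q => η q (ham η f q)) = fun q => -f q := funext fun q => hη.apply_ham f q
  rw [h1, diff_neg] at h
  linarith

/-- The map `f ↦ X_f` is a homomorphism from the Jacobi bracket to the Lie bracket. -/
theorem mlieBracket_ham (hη : IsContactForm η) {f g : M → ℝ}
    (hf : SmoothFunOn (m := m) Set.univ f) (hg : SmoothFunOn (m := m) Set.univ g) (p : M) :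
    VectorField.mlieBracket (𝓡 m) (ham η f) (ham η g) p = ham η (jacobiBracket η f g) p := by
  have hXf := hη.smoothOn_ham hf
  have hXg := hη.smoothOn_ham hg
  set B : VField m M := VectorField.mlieBracket (𝓡 m) (ham η f) (ham η g) with hB
  have hBs : B.SmoothOn Set.univ := VField.SmoothOn.mlieBracket isOpen_univ hXf hXg
  have hηB : ∀ q, η q (B q) = -jacobiBracket η f g q := fun q => by
    rw [hη.jacobiBracket_eq, hB, hη.apply_mlieBracket_ham hf isOpen_univ hXg (Set.mem_univ q)]
    have h1 : (fun q => η q (ham η g q)) = fun q => -g q := funext fun q => hη.apply_ham g q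
    rw [h1, diff_neg, hη.apply_ham]
    ring
  -- This determines `dη(B, ·)` up to the coefficient of `η`, which is identified afterwards by
  -- inserting `ℛ`. Local fields `Z` are allowed because an arbitrary tangent vector is extended by
  -- a coordinate field of a chart.
  have hext : ∀ {V : Set M} (_ : IsOpen V) {Z : VField m M} (_ : Z.SmoothOn V) {q : M}
      (_ : q ∈ V), η.extd q (B q) (Z q) = diff (m := m) (jacobiBracket η f g) q (Z q) -
        (diff (m := m) (fun q => diff (m := m) g q (reeb η q)) q (ham η f q) -
          diff (m := m) (fun q => diff (m := m) f q (reeb η q)) q (ham η g q)) * η q (Z q) := by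
    intro V hV Z hZ q hq
    have hVu := Set.subset_univ V
    have hηV := hη.smooth.mono hVu
    have hηZ := hηV.apply hZ hV
    -- Two applications of `L_{X_f} η = -ℛ(f) η`. By the Jacobi identity, `η([B, Z])` is the
    -- antisymmetrisation of this expression in `f` and `g`.
    have key : ∀ {f g : M → ℝ}, SmoothFunOn (m := m) Set.univ f →
        SmoothFunOn (m := m) Set.univ g →
        η q (VectorField.mlieBracket (𝓡 m) (ham η f)
          (VectorField.mlieBracket (𝓡 m) (ham η g) Z) q) =
        diff (m := m) (fun q => diff (m := m) (fun q => η q (Z q)) q (ham η g q)) q (ham η f q) +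
          (diff (m := m) g q (reeb η q) * diff (m := m) (fun q => η q (Z q)) q (ham η f q) +
          η q (Z q) * diff (m := m) (fun q => diff (m := m) g q (reeb η q)) q (ham η f q)) +
          diff (m := m) f q (reeb η q) * (diff (m := m) (fun q => η q (Z q)) q (ham η g q) +
            diff (m := m) g q (reeb η q) * η q (Z q)) := by
      intro f g hf hg
      have hXgV := (hη.smoothOn_ham hg).mono hVu
      have hgV := (hη.smooth_diff_reeb hg).mono hVu
      rw [hη.apply_mlieBracket_ham hf hV (VField.SmoothOn.mlieBracket hV hXgV hZ) hq,
        diff_congr hV (fun q hq => hη.apply_mlieBracket_ham hg hV hZ hq) hq,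
        diff_add (f := fun q => diff (m := m) (fun q => η q (Z q)) q (ham η g q))
          (g := fun q => diff (m := m) g q (reeb η q) * η q (Z q)) (((hηZ.diff hV).apply hXgV hV).at hV hq)
          (SmoothFunOn.at (ContMDiffOn.mul hgV hηZ) hV hq),
        diff_mul (SmoothFunOn.at hgV hV hq) (hηZ.at hV hq),
        hη.apply_mlieBracket_ham hg hV hZ hq]
    have h1 := extd_eq hV hηV (hBs.mono hVu) hZ hq
    have h2 : (fun q => η q (B q)) = fun q => -jacobiBracket η f g q := funext hηB
    have h3 : VectorField.mlieBracket (𝓡 m) B Z q =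
        VectorField.mlieBracket (𝓡 m) (ham η f) (VectorField.mlieBracket (𝓡 m) (ham η g) Z) q -
        VectorField.mlieBracket (𝓡 m) (ham η g) (VectorField.mlieBracket (𝓡 m) (ham η f) Z) q := by
      have := isManifold_minSmoothness (m := m) (M := M) 3
      have hle : minSmoothness ℝ 2 ≤ ∞ := by
        rw [minSmoothness_of_isRCLikeNormedField]; exact two_le_infty
      have h4 := VectorField.leibniz_identity_mlieBracket_apply (I := 𝓡 m) (x := q)
        ((hXf.at isOpen_univ (Set.mem_univ q)).of_le hle)
        ((hXg.at isOpen_univ (Set.mem_univ q)).of_le hle) ((hZ.at hV hq).of_le hle)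
      rw [h4]
      exact (add_sub_cancel_right _ _).symm
    rw [h2, diff_neg, h3, map_sub, key hf hg, key hg hf, hB,
      diff_mlieBracket hV hηZ (hXf.mono hVu) (hXg.mono hVu) hq] at h1
    rw [h1]
    ring
  -- Since `dη(B, ℛ) = 0`, the unknown coefficient equals `ℛ({f, g})`, as required of the
  -- Hamiltonian field of `{f, g}`.
  have hreeb := hext isOpen_univ hη.smoothOn_reeb (Set.mem_univ p)
  rw [η.extd_skew, hη.extd_reeb, hη.apply_reeb] at hreeb
  refine hη.eq_of_apply_of_extd ((hηB p).trans (hη.apply_ham _ p).symm) fun u => ?_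
  have hps := mem_extChartAt_source (I := 𝓡 m) p
  have h1 := hext (isOpen_extChartAt_source (I := 𝓡 m) p)
    (smoothOn_coordField p (chartD p p u)) hps
  have h2 : coordField p (chartD p p u) p = u := chartDInv_chartD hps u
  rw [h2] at h1
  rw [h1, hη.extd_ham]
  linear_combination (-η p u) * hreeb

/-- The `dη`-parts obey the chain rule and do not see `E`. The `η`-parts involve the functions
themselves, and their defect `G - ∑ f_k ∂_k G` is what the multiple of `E` repairs; it vanishes when
Euler's relation of degree one holds. -/
theorem ham_comp (hη : IsContactForm η) {ι : Type*} [Fintype ι] [DecidableEq ι]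
    {f : ι → M → ℝ} {G : (ι → ℝ) → ℝ} {p : M}
    (hf : ∀ k, ContMDiffAt (𝓡 m) 𝓘(ℝ, ℝ) ∞ (f k) p) (hG : ContDiff ℝ ∞ G) :
    ham η (fun q => G fun k => f k q) p =
      ∑ k, fderiv ℝ G (fun k => f k p) (Pi.single k 1) • ham η (f k) p +
        (G (fun k => f k p) - ∑ k, f k p * fderiv ℝ G (fun k => f k p) (Pi.single k 1)) •
          jacobiE η p := by
  refine hη.eq_of_apply_of_extd ?_ fun u => ?_
  · simp only [hη.apply_ham, map_add, map_sum, map_smul, jacobiE, map_neg, hη.apply_reeb,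
      smul_eq_mul, mul_neg, mul_one, Finset.sum_neg_distrib]
    have : ∑ k, fderiv ℝ G (fun k => f k p) (Pi.single k 1) * f k p =
      ∑ k, f k p * fderiv ℝ G (fun k => f k p) (Pi.single k 1) := by simp only [mul_comm]
    rw [this]
    ring
  · simp only [hη.extd_ham, map_add, map_sum, map_smul, jacobiE, map_neg, add_apply, sum_apply,
      smul_apply, neg_apply, hη.extd_reeb, diff_comp hf hG, smul_eq_mul, mul_sub,
      Finset.sum_sub_distrib, Finset.sum_mul, neg_zero, mul_zero, add_zero, mul_assoc]

end IsContactForm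

end ContactCalculus

/-! ### Local complements and volume forms, and the main theorem -/

section Local

variable {m : ℕ} {M : Type*} [TopologicalSpace M] [ChartedSpace (EuclideanSpace ℝ (Fin m)) M]
  [IsManifold (𝓡 m) ∞ M]

theorem isOpen_setOf_linearIndependent_fields {ι : Type*} [Finite ι] {Y : ι → VField m M}
    {V : Set M} (hV : IsOpen V) (hY : ∀ i, (Y i).SmoothOn V) :
    IsOpen (V ∩ {p | LinearIndependent ℝ fun i => Y i p}) := by
  have := Fintype.ofFinite ι
  refine isOpen_iff_mem_nhds.2 fun p hp => ?_
  have hps := mem_extChartAt_source (I := 𝓡 m) p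
  have hc : ContinuousAt (fun q i => (Y i).coords p q) p :=
    continuousAt_pi.2 fun i => ((hY i).coords hV hp.1 hps).continuousAt
  have hiff : ∀ q ∈ (extChartAt (𝓡 m) p).source,
      LinearIndependent ℝ (fun i => (Y i).coords p q) ↔ LinearIndependent ℝ fun i => Y i q :=
    fun q hq => LinearMap.linearIndependent_iff (v := fun i => Y i q)
      (chartEquiv hq).toLinearEquiv.toLinearMap (chartEquiv hq).toLinearEquiv.ker
  have hopen : IsOpen {f : ι → EuclideanSpace ℝ (Fin m) | LinearIndependent ℝ f} :=
    isOpen_setOfPred_linearIndependent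
  filter_upwards [hV.mem_nhds hp.1, extChartAt_source_mem_nhds (I := 𝓡 m) p,
    hc.eventually_mem (hopen.mem_nhds ((hiff p hps).2 hp.2))] with q hqV hqs hq
  exact ⟨hqV, (hiff q hqs).1 hq⟩

/-- The determinant on `ℝ^m`, as a continuous alternating map. -/
def detForm (m : ℕ) : EuclideanSpace ℝ (Fin m) [⋀^Fin m]→L[ℝ] ℝ where
  toMultilinearMap := (EuclideanSpace.basisFun (Fin m) ℝ).toBasis.det.toMultilinearMap
  cont := by
    change Continuous fun v => (EuclideanSpace.basisFun (Fin m) ℝ).toBasis.det v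
    simp only [Module.Basis.det_apply]
    exact Continuous.matrix_det (continuous_matrix fun i j =>
      (EuclideanSpace.proj (𝕜 := ℝ) i).continuous.comp (continuous_apply j))
  map_eq_zero_of_eq' v i j h hij :=
    (EuclideanSpace.basisFun (Fin m) ℝ).toBasis.det.map_eq_zero_of_eq v h hij

/-- In another chart this form is the standard determinant times the Jacobian determinant of the
transition map, a smooth function. -/
theorem isVolumeOn_chart (p : M) :
    TopForm.IsVolumeOn (m := m) (extChartAt (𝓡 m) p).source
      fun q => (detForm m).compContinuousLinearMap (chartD p q) where
  smooth x := by
    rintro y ⟨hy, hyp⟩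
    set Ω : TopForm m M := fun q => (detForm m).compContinuousLinearMap (chartD p q) with hΩ
    let b := (EuclideanSpace.basisFun (Fin m) ℝ).toBasis
    have hys := (extChartAt (𝓡 m) x).map_target hy
    have h1 : ∀ i, ContDiffAt ℝ ∞
        ((coordField x (b i)).coords p ∘ (extChartAt (𝓡 m) x).symm) y := fun i => by
      have h := contDiffAt_comp_symm hys
        ((smoothOn_coordField x (b i)).coords (isOpen_extChartAt_source x) hys hyp)
      rwa [(extChartAt (𝓡 m) x).right_inv hy] at h
    refine (((contDiffAt_basis_det h1).smul
      (contDiffAt_const (c := detForm m))).congr_of_eventuallyEq ?_).contDiffWithinAt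
    filter_upwards [(isOpen_extChartAt_target x).mem_nhds hy] with z hz
    have hzs := (extChartAt (𝓡 m) x).map_target hz
    refine ContinuousAlternatingMap.ext fun v => ?_
    have h2 := DFunLike.congr_fun ((Ω.rep x z).toAlternatingMap.eq_smul_basis_det b) v
    have h3 := Ω.rep_chart hzs b
    rw [(extChartAt (𝓡 m) x).right_inv hz] at h3
    refine h2.trans ?_
    change Ω.rep x z b * b.det v = _
    rw [h3]
    rfl
  ne_zero q hq h := by
    have h1 := DFunLike.congr_fun h fun i =>
      chartDInv p q ((EuclideanSpace.basisFun (Fin m) ℝ).toBasis i)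
    have h2 : (detForm m) (fun i => chartD p q
        (chartDInv p q ((EuclideanSpace.basisFun (Fin m) ℝ).toBasis i))) = 0 := h1
    simp only [chartD_chartDInv hq] at h2
    exact one_ne_zero (((EuclideanSpace.basisFun (Fin m) ℝ).toBasis.det_self).symm.trans h2)

end Local

/-! ### The frame of a Jacobi `C^∞`-structure and its involutivity. -/

section Main

variable {n : ℕ} {M : Type*} [TopologicalSpace M]
  [ChartedSpace (EuclideanSpace ℝ (Fin (2 * n + 1))) M]
  {η : OneForm (2 * n + 1) M} {H : C^∞⟮𝓡 (2 * n + 1), M; ℝ⟯}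
  {F : Fin (2 * n - 1) → C^∞⟮𝓡 (2 * n + 1), M; ℝ⟯} {R : VField (2 * n + 1) M} {V : Set M}

/-- The frame `(X_H, X_{f_1}, …, X_{f_{2n-1}}, R)`. -/
def completedFrame (η : OneForm (2 * n + 1) M) (H : C^∞⟮𝓡 (2 * n + 1), M; ℝ⟯)
    (F : Fin (2 * n - 1) → C^∞⟮𝓡 (2 * n + 1), M; ℝ⟯) (R : VField (2 * n + 1) M) :
    Fin (2 * n + 1) → VField (2 * n + 1) M :=
  Fin.cons (α := fun _ => VField (2 * n + 1) M) (ham η H) (completed η F R)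

/-- The same frame read from the other end: split off at the start it is `X_H` and the structure
`completed`, split off at the end it is the Hamiltonian fields and `R`. The Pfaffian forms use the
first reading, independence and brackets the second. -/
theorem completedFrame_castSucc (η : OneForm (2 * n + 1) M) (H : C^∞⟮𝓡 (2 * n + 1), M; ℝ⟯)
    (F : Fin (2 * n - 1) → C^∞⟮𝓡 (2 * n + 1), M; ℝ⟯) (R : VField (2 * n + 1) M)
    (j : Fin (2 * n)) : completedFrame η H F R j.castSucc = ham η (family H F j) := by
  obtain ⟨_ | v, hv⟩ := j
  · rfl
  · have h1 : (⟨v + 1, hv⟩ : Fin (2 * n)).castSucc = (⟨v, by omega⟩ : Fin (2 * n)).succ := rfl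
    rw [h1]
    change completed η F R ⟨v, _⟩ = _
    rw [completed, dif_pos (show v < 2 * n - 1 by omega), family, dif_neg (Nat.succ_ne_zero v)]
    rfl

/-- For `n ≥ 1` the truncated difference `2 * n - 1` is an index of `completed`, and it is the one
that selects `R`. -/
theorem completedFrame_last (hn : 1 ≤ n) (η : OneForm (2 * n + 1) M)
    (H : C^∞⟮𝓡 (2 * n + 1), M; ℝ⟯) (F : Fin (2 * n - 1) → C^∞⟮𝓡 (2 * n + 1), M; ℝ⟯)
    (R : VField (2 * n + 1) M) : completedFrame η H F R (Fin.last (2 * n)) = R := by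
  have h1 : Fin.last (2 * n) = (⟨2 * n - 1, by omega⟩ : Fin (2 * n)).succ :=
    Fin.ext (by simp only [Fin.val_last, Fin.val_succ]; omega)
  rw [h1]
  change completed η F R ⟨2 * n - 1, _⟩ = _
  rw [completed, dif_neg (lt_irrefl _)]

theorem linearIndependent_completedFrame_iff (hn : 1 ≤ n) {p : M} :
    (LinearIndependent ℝ fun i => completedFrame η H F R i p) ↔ p ∈ indepSet η H F ∧
      R p ∉ Submodule.span ℝ (Set.range fun j => ham η (family H F j) p) := by
  have h1 : Fin.init (fun i => completedFrame η H F R i p) =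
      fun j => ham η (family H F j) p := funext fun j =>
    congrFun (completedFrame_castSucc η H F R j) p
  rw [linearIndependent_finSucc', h1, completedFrame_last hn]
  rfl

theorem smooth_of_contMDiffMap (f : C^∞⟮𝓡 (2 * n + 1), M; ℝ⟯) :
    SmoothFunOn (m := 2 * n + 1) Set.univ f := f.contMDiff.contMDiffOn

variable [IsManifold (𝓡 (2 * n + 1)) ∞ M]

theorem smoothOn_completedFrame (hn : 1 ≤ n) (hη : IsContactForm η) (hR : R.SmoothOn V)
    (i : Fin (2 * n + 1)) : (completedFrame η H F R i).SmoothOn V := by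
  refine Fin.lastCases ?_ (fun j => ?_) i
  · rwa [completedFrame_last hn]
  · rw [completedFrame_castSucc]
    exact (hη.smoothOn_ham (smooth_of_contMDiffMap _)).mono (Set.subset_univ V)

theorem isOpen_indepSet (hη : IsContactForm η) : IsOpen (indepSet η H F) := by
  have h := isOpen_setOf_linearIndependent_fields (Y := fun j => ham η (family H F j)) isOpen_univ
    fun j => hη.smoothOn_ham (smooth_of_contMDiffMap _)
  rwa [Set.univ_inter] at h

/-- A vector outside the `2n`-dimensional span exists at `p`. It is extended with constant
coordinates in the chart at `p`, and independence persists nearby because it is an open condition.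
-/
theorem exists_isComplement (hn : 1 ≤ n) (hη : IsContactForm η) {p : M}
    (hp : p ∈ indepSet η H F) : ∃ V : Set M, IsOpen V ∧ p ∈ V ∧ V ⊆ indepSet η H F ∧
      (∃ R : VField (2 * n + 1) M, IsComplement η H F V R) ∧
      ∃ Ω : TopForm (2 * n + 1) M, Ω.IsVolumeOn V := by
  have hps := mem_extChartAt_source (I := 𝓡 (2 * n + 1)) p
  obtain ⟨v, hv⟩ : ∃ v, v ∉ Submodule.span ℝ (Set.range fun j => ham η (family H F j) p) := by
    by_contra! h
    have h1 := finrank_span_eq_card (R := ℝ) hp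
    rw [Submodule.eq_top_iff'.2 h, finrank_top, finrank_tangentSpace, Fintype.card_fin] at h1
    omega
  set R : VField (2 * n + 1) M := coordField p (chartD p p v) with hR
  have hRp : R p = v := chartDInv_chartD hps v
  have hRs : R.SmoothOn (extChartAt (𝓡 (2 * n + 1)) p).source := smoothOn_coordField p _
  have hiff : ∀ q, (LinearIndependent ℝ fun i => completedFrame η H F R i q) ↔ _ := fun q =>
    linearIndependent_completedFrame_iff hn
  refine ⟨(extChartAt (𝓡 (2 * n + 1)) p).source ∩
    {q | LinearIndependent ℝ fun i => completedFrame η H F R i q},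
    isOpen_setOf_linearIndependent_fields (isOpen_extChartAt_source p)
      (smoothOn_completedFrame hn hη hRs), ⟨hps, (hiff p).2 ⟨hp, by rwa [hRp]⟩⟩,
    fun q hq => ((hiff q).1 hq.2).1, ⟨R, hRs.mono Set.inter_subset_left,
      fun q hq => ((hiff q).1 hq.2).2⟩, _, fun x => ((isVolumeOn_chart p).smooth x).mono
        fun y hy => ⟨hy.1, hy.2.1⟩, fun q hq => (isVolumeOn_chart p).ne_zero q hq.1⟩

/-- The bracket is the Hamiltonian field of `G(f_0, …, f_j)`; `ham_comp` expands it and Reeb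
compatibility absorbs the `E` term. Membership at the point suffices here: smooth coefficients come
later from the dual coframe. -/
theorem mlieBracket_ham_family_mem_span (hη : IsContactForm η)
    (hF : IsJacobiCInfStructure η H F) {i j : Fin (2 * n)} (hij : i < j) {p : M}
    (hp : p ∈ indepSet η H F) :
    VectorField.mlieBracket (𝓡 (2 * n + 1)) (ham η (family H F j)) (ham η (family H F i)) p ∈
      Submodule.span ℝ (Set.range fun k : {k : Fin (2 * n) // k ≤ j} =>
        ham η (family H F k) p) := by
  obtain ⟨G, hG, hGeq, hE⟩ := hF.closure i j hij
  obtain ⟨O, -, hpO, c, -, hc⟩ := hE p hp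
  have hcp := hc p hpO
  beta_reduce at hcp
  rw [hη.mlieBracket_ham (smooth_of_contMDiffMap _) (smooth_of_contMDiffMap _), funext hGeq,
    hη.ham_comp (f := fun k : {k : Fin (2 * n) // k ≤ j} => family H F k)
      (fun k => (smooth_of_contMDiffMap _).at isOpen_univ (Set.mem_univ p)) hG, hcp]
  exact Submodule.add_mem _
    (Submodule.sum_mem _ fun k _ => Submodule.smul_mem _ _ (Submodule.subset_span ⟨k, rfl⟩))
    (Submodule.sum_mem _ fun k _ => Submodule.smul_mem _ _ (Submodule.subset_span ⟨k, rfl⟩))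

theorem isInvolutiveFlag_completedFrame (hn : 1 ≤ n) (hη : IsContactForm η)
    (hF : IsJacobiCInfStructure η H F) (hV : IsOpen V) (hVU : V ⊆ indepSet η H F)
    (hR : IsComplement η H F V R) : IsInvolutiveFlag V (completedFrame η H F R) := by
  have hind : ∀ p ∈ V, LinearIndependent ℝ fun i => completedFrame η H F R i p := fun p hp =>
    (linearIndependent_completedFrame_iff hn).2 ⟨hVU hp, hR.transverse p hp⟩
  refine isInvolutiveFlag_of_mem_span hV (smoothOn_completedFrame hn hη hR.smooth) hind
    fun p hp a b => ?_
  refine Fin.lastCases (fun _ => ?_) (fun j => ?_) b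
  -- Brackets with `R` impose no condition: `R` is the last field, and the full frame spans the
  -- tangent space.
  · rw [← sum_dualForm (hind p hp) (VectorField.mlieBracket _ _ _ p)]
    exact Submodule.sum_mem _ fun k _ => Submodule.smul_mem _ _
      (Submodule.subset_span ⟨⟨k, k.le_last⟩, rfl⟩)
  · refine Fin.lastCases (fun h => absurd h (Fin.le_last _).not_gt) (fun i hij => ?_) a
    rw [completedFrame_castSucc, completedFrame_castSucc]
    refine Submodule.span_mono ?_
      (mlieBracket_ham_family_mem_span hη hF (Fin.castSucc_lt_castSucc_iff.1 hij) (hVU hp))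
    rintro _ ⟨k, rfl⟩
    exact ⟨⟨(k : Fin (2 * n)).castSucc, Fin.castSucc_le_castSucc_iff.2 k.2⟩,
      congrFun (completedFrame_castSucc η H F R k) p⟩

end Main

end ContactPfaff

end

theorem mainTheorem6 (n : ℕ) (hn : 1 ≤ n) (M : Type*) [TopologicalSpace M] [T2Space M]
    [SecondCountableTopology M] [ChartedSpace (EuclideanSpace ℝ (Fin (2 * n + 1))) M]
    [IsManifold (𝓡 (2 * n + 1)) ∞ M]
    (η : ContactPfaff.OneForm (2 * n + 1) M) (hη : ContactPfaff.IsContactForm η)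
    (H : C^∞⟮𝓡 (2 * n + 1), M; ℝ⟯) (F : Fin (2 * n - 1) → C^∞⟮𝓡 (2 * n + 1), M; ℝ⟯)
    (hF : ContactPfaff.IsJacobiCInfStructure η H F) :
    IsOpen (ContactPfaff.indepSet η H F) ∧ Dense (ContactPfaff.indepSet η H F) ∧
    (∀ p ∈ ContactPfaff.indepSet η H F, ∃ V : Set M, IsOpen V ∧ p ∈ V ∧
      V ⊆ ContactPfaff.indepSet η H F ∧
      (∃ R : ContactPfaff.VField (2 * n + 1) M, ContactPfaff.IsComplement η H F V R) ∧
      ∃ Ω : ContactPfaff.TopForm (2 * n + 1) M, Ω.IsVolumeOn V) ∧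
    ∀ V : Set M, IsOpen V → V ⊆ ContactPfaff.indepSet η H F →
      ∀ R : ContactPfaff.VField (2 * n + 1) M, ContactPfaff.IsComplement η H F V R →
        ContactPfaff.IsCInfStructure V (fun _ : Fin 1 => ContactPfaff.ham η H)
          (ContactPfaff.completed η F R) ∧
        ∀ Ω : ContactPfaff.TopForm (2 * n + 1) M, Ω.IsVolumeOn V →
          ContactPfaff.IntegratedByPfaff V (ContactPfaff.ham η H)
            (ContactPfaff.pfaffForm Ω (ContactPfaff.ham η H)
              (ContactPfaff.completed η F R)) := by
  refine ⟨ContactPfaff.isOpen_indepSet hη, ?_,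
    fun p hp => ContactPfaff.exists_isComplement hn hη hp, fun V hV hVU R hR => ?_⟩
  · obtain ⟨U, -, hU, hUi⟩ := hF.independence
    exact hU.mono hUi
  · have h := ContactPfaff.isInvolutiveFlag_completedFrame hn hη hF hV hVU hR
    exact ⟨h.isCInfStructure, fun Ω hΩ =>
      (ContactPfaff.isScaledDual_pfaffForm h hΩ).integratedByPfaff⟩
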